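/- **Setting.** Let $K\ge 1$ be the number of arms. At time $t=1,2,\dots$ the reward $X_{t,k}$ of arm $k$ has distribution $\nu_{t,k}$ with mean $\mu_{t,k}$ and is independent of the past (rewards, decisions, external randomness used to break ties). For every $t\le T$ the laws $\nu_{t,1},\dots,\nu_{t,K}$ belong to one common one-parameter exponential family $P_\theta(dx)\propto e^{\theta x}\rho(dx)$ with finite means; the base measure $\rho$ may change at each breakpoint. At each $t\le T$ the optimal arm $k^\star_t$ is unique. There are constants $\omega>0$ and $D$ such that, for all $t\le T$ and $k\ne k_t^\star$, writing $\xi=\frac12(\mu_{t,k}+\mu_{t,k^\star_t})$, one has $\mu_{t,k^\star_t}-\mu_{t,k}\le D$, $\mathrm{kl}(\xi,\mu_{t,k})\ge\omega$ and $\mathrm{kl}(\xi,\mu_{t,k_t^\star})\ge\omega$, where $\mathrm{kl}(\mu,\mu')$ is the Kullback–Leibler divergence between the members of the family at time $t$ with means $\mu$ and $\mu'$. There are at most $\Gamma_T\geq 1$ breakpoints, i.e. times $1\le t\le T-1$ with $\nu_{t,k}\neq\nu_{t+1,k}$ for some $k$. **Algorithm SW-LB-SDA with window $\tau\ge1$.**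 It works in rounds; in round $r$ a non-empty set $\mathcal A_r$ of arms is pulled, one after the other, each pull taking one time step; $\mathcal A_1$ contains all arms. Let $N_k^\tau(r)$ be the number of pulls of arm $k$ in the rounds $s\ge1$ with $r-\tau<s\le r$. - *Duels.* At round $r$, with leader $\ell(r)$, a challenger $k\neq\ell(r)$ is selected if (i) $N_k^\tau(r)\le\sqrt{\log\tau}$, or (ii) its diversity flag is raised, or (iii) the mean of its last $N_k^\tau(r)$ observations is at least the mean of the last $\min(N_k^\tau(r),N_{\ell(r)}^\tau(r))$ observations of the leader. $\mathcal A_{r+1}$ is the set of selected challengers, or $\{\ell(r)\}$ if there is none. - *Diversity flag.* With $L=\lceil (K-1)(\log\tau)^2\rceil$, the flag of $k\neq\ell(r)$ is raised at round $r$ if $r>L$, $N_k^\tau(r)\le(\log\tau)^2$ and, for every $s\in\{r-L,\dots,r-1\}$, $\ell(s)=\ell(r)$ and neither $\ell(r)$ nor $k$ is in $\mathcal A_{s+1}$. - *Leader.* $\ell(1)$ maximizes $N_k^\tau(1)$. If $N_{\ell(r)}^\tau(r+1)<\min(r,\tau)/(2K)$, then $\ell(r+1)$ maximizes $N_k^\tau(r+1)$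 over all arms; otherwise it maximizes it over $\mathcal B_r\cup\{\ell(r)\}$, where $\mathcal B_r=\{k\in\mathcal A_{r+1}: N_k^\tau(r+1)\ge\min(r,\tau)/K\}$. Ties are broken by any non-anticipating rule. **Theorem.** For all $K$, $\omega>0$, $D$ and $0<c_1\le c_2$ there is a constant $C$ such that for all $T\ge2$, all $\Gamma_T\ge1$, every environment as above with these $K,\omega,D$ and at most $\Gamma_T$ breakpoints up to time $T$, and every integer window $\tau\ge1$ with $$c_1\sqrt{T\log T/\Gamma_T}\ \le\ \tau\ \le\ c_2\sqrt{T\log T/\Gamma_T},$$ the dynamic regret of SW-LB-SDA with window $\tau$ satisfies $$\mathcal R_T=\mathbb E\Big[\sum_{t=1}^T\big(\max_k\mu_{t,k}-\mu_{t,A_t}\big)\Big]\ \le\ C\sqrt{T\,\Gamma_T\log T},$$ where $A_t$ is the arm pulled at time $t$. -/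

import Mathlib

open MeasureTheory ProbabilityTheory

namespace SWBandit

noncomputable section

/-! ## Bandit models and abruptly changing environments -/

/-- Mean of a reward distribution. -/
def mean (p : Measure ℝ) : ℝ := ∫ x, x ∂p

/-- The member with natural parameter `θ` of the one-parameter exponential family with base
measure `ρ`: the density with respect to `ρ` is `exp (θ x - Ψ θ)`,
`Ψ θ = log (∫ exp (θ x) dρ)`. -/
def expFam (ρ : Measure ℝ) (θ : ℝ) : Measure ℝ := ρ.tilted (fun x => θ * x)

/-- Parameters `θ` for which `expFam ρ θ` is a probability measure with a finite mean. -/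
def IsParam (ρ : Measure ℝ) (θ : ℝ) : Prop :=
  ρ ≠ 0 ∧ Integrable (fun x => Real.exp (θ * x)) ρ ∧ Integrable (fun x => x) (expFam ρ θ)

/-- For two members `θ, θ'` of the family with base `ρ`: the member `η` whose mean is the midpoint
`ξ` of their means satisfies `kl (ξ, mean θ) ≥ ω` and `kl (ξ, mean θ') ≥ ω`. -/
def MidpointSeparated (ρ : Measure ℝ) (ω θ θ' : ℝ) : Prop :=
  ∃ η : ℝ, IsParam ρ η ∧
    mean (expFam ρ η) = (mean (expFam ρ θ) + mean (expFam ρ θ')) / 2 ∧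
    ENNReal.ofReal ω ≤ InformationTheory.klDiv (expFam ρ η) (expFam ρ θ) ∧
    ENNReal.ofReal ω ≤ InformationTheory.klDiv (expFam ρ η) (expFam ρ θ')

/-- A stationary `K`-armed model: all arms lie in one common one-parameter exponential family,
the optimal arm `b` is unique, every gap is at most `D`, and every suboptimal arm is separated
from `b` with constant `ω`. -/
def IsExpFamModel {K : ℕ} (ω D : ℝ) (p : Fin K → Measure ℝ) : Prop :=
  ∃ (ρ : Measure ℝ) (θ : Fin K → ℝ),
    (∀ k, IsParam ρ (θ k) ∧ p k = expFam ρ (θ k)) ∧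
    ∃ b : Fin K, ∀ k, k ≠ b →
      mean (p k) < mean (p b) ∧ mean (p b) - mean (p k) ≤ D ∧
      MidpointSeparated ρ ω (θ k) (θ b)

open Classical in
/-- Number of breakpoints up to time `T`: the `t ∈ {1, …, T - 1}` at which the distribution of
some arm changes between `t` and `t + 1`. -/
def numBreakpoints {K : ℕ} (ν : ℕ → Fin K → Measure ℝ) (T : ℕ) : ℕ :=
  ((Finset.Ico 1 T).filter (fun t => ∃ k, ν t k ≠ ν (t + 1) k)).card

/-- Mean of the best arm at time `t`. -/
def bestMean {K : ℕ} (ν : ℕ → Fin K → Measure ℝ) (t : ℕ) : ℝ := ⨆ k, mean (ν t k)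

/-! ## Rounds, pulls and observations

Rounds and times are numbered from `1`. `A r` is the set of arms pulled at round `r`; they are
pulled one after the other, in increasing order, each taking one time step. `x t k` is the reward
obtained when arm `k` is pulled at time `t`. -/

variable {K : ℕ}

/-- Number of pulls (time steps) before round `r`. -/
def pullsBefore (A : ℕ → Finset (Fin K)) (r : ℕ) : ℕ := ∑ s ∈ Finset.Ico 1 r, (A s).card

/-- Time at which arm `k ∈ A r` is pulled during round `r`. -/
def pullTime (A : ℕ → Finset (Fin K)) (r : ℕ) (k : Fin K) : ℕ :=
  pullsBefore A r + ((A r).filter (fun j => j ≤ k)).card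

/-- Arm `k` is the arm pulled at time `t`. -/
def PulledAt (A : ℕ → Finset (Fin K)) (t : ℕ) (k : Fin K) : Prop :=
  ∃ r, 1 ≤ r ∧ k ∈ A r ∧ pullTime A r k = t

/-- `N_k(r)`: number of pulls of arm `k` in rounds `1, …, r`. -/
def count (A : ℕ → Finset (Fin K)) (k : Fin K) (r : ℕ) : ℕ :=
  ((Finset.Icc 1 r).filter (fun s => k ∈ A s)).card

/-- `N_k^τ(r)`: number of pulls of arm `k` in the last `τ` rounds `r - τ + 1, …, r`. -/
def windowCount (τ : ℕ) (A : ℕ → Finset (Fin K)) (k : Fin K) (r : ℕ) : ℕ :=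
  ((Finset.Icc 1 r).filter (fun s => r < s + τ ∧ k ∈ A s)).card

/-- Average of the last `n` observations of arm `k` available at the end of round `r`, i.e. of
those with index in `{N_k(r) - n + 1, …, N_k(r)}`. -/
def lastBlockMean (A : ℕ → Finset (Fin K)) (x : ℕ → Fin K → ℝ) (k : Fin K) (r n : ℕ) : ℝ :=
  (∑ s ∈ (Finset.Icc 1 r).filter (fun s => k ∈ A s ∧ count A k r < count A k s + n),
    x (pullTime A s k) k) / n

/-! ## The algorithm SW-LB-SDA with window `τ`

`l r` is the leader at round `r`, and `A (r + 1)` is the set of arms pulled as an outcome of the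
duels of round `r`. -/

/-- Number of rounds `⌈(K - 1) (log τ)²⌉` monitored by the diversity flags. -/
def flagLength (K τ : ℕ) : ℕ := ⌈((K : ℝ) - 1) * Real.log τ ^ 2⌉₊

/-- Diversity flag of arm `k` at round `r`: for the last `flagLength K τ` rounds the leader has
been one and the same arm other than `k`, it has not been pulled, `k` has not been pulled, and
`N_k^τ(r) ≤ (log τ)²`. -/
def DiversityFlag (τ : ℕ) (l : ℕ → Fin K) (A : ℕ → Finset (Fin K)) (k : Fin K) (r : ℕ) : Prop :=
  flagLength K τ < r ∧ k ≠ l r ∧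
    (∀ s, s < r → r ≤ s + flagLength K τ → l s = l r ∧ l r ∉ A (s + 1) ∧ k ∉ A (s + 1)) ∧
    (windowCount τ A k r : ℝ) ≤ Real.log τ ^ 2

/-- The challenger `k` wins its duel against the leader at round `r`: the mean of its
observations in the window is at least the mean of the last `min (N_k^τ, N_ℓ^τ)` observations of
the leader. -/
def WinsDuel (τ : ℕ) (x : ℕ → Fin K → ℝ) (l : ℕ → Fin K) (A : ℕ → Finset (Fin K))
    (k : Fin K) (r : ℕ) : Prop :=
  lastBlockMean A x (l r) r (min (windowCount τ A k r) (windowCount τ A (l r) r)) ≤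
    lastBlockMean A x k r (windowCount τ A k r)

open Classical in
/-- Challengers selected at round `r`: forced exploration, raised diversity flag, or won duel. -/
def winners (τ : ℕ) (x : ℕ → Fin K → ℝ) (l : ℕ → Fin K) (A : ℕ → Finset (Fin K)) (r : ℕ) :
    Finset (Fin K) :=
  Finset.univ.filter (fun k => k ≠ l r ∧
    ((windowCount τ A k r : ℝ) ≤ Real.sqrt (Real.log τ) ∨ DiversityFlag τ l A k r ∨
      WinsDuel τ x l A k r))

/-- `k` maximizes `N^τ(r)` over the set of arms `S`. -/
def IsArgmax (τ : ℕ) (A : ℕ → Finset (Fin K)) (r : ℕ) (S : Set (Fin K)) (k : Fin K) : Prop :=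
  k ∈ S ∧ ∀ j ∈ S, windowCount τ A j r ≤ windowCount τ A k r

/-- The arms of `A (r + 1)` with `N_k^τ(r + 1) ≥ min (r, τ) / K`. -/
def eligible (τ : ℕ) (A : ℕ → Finset (Fin K)) (r : ℕ) : Set (Fin K) :=
  {k | k ∈ A (r + 1) ∧ ((min r τ : ℕ) : ℝ) / K ≤ windowCount τ A k (r + 1)}

/-- The leaders `l` and pulled sets `A` form a run of SW-LB-SDA with window `τ` on the reward
table `x`. Ties in the choice of the leader may be broken in any way. -/
structure IsRun (τ : ℕ) (x : ℕ → Fin K → ℝ) (l : ℕ → Fin K) (A : ℕ → Finset (Fin K)) : Prop where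
  /-- every arm is drawn at round `1` -/
  first_round : A 1 = Finset.univ
  /-- the selected challengers are pulled -/
  pull_winners : ∀ r, 1 ≤ r → (winners τ x l A r).Nonempty → A (r + 1) = winners τ x l A r
  /-- if there is none, the leader is pulled -/
  pull_leader : ∀ r, 1 ≤ r → ¬ (winners τ x l A r).Nonempty → A (r + 1) = {l r}
  /-- the first leader -/
  first_leader : IsArgmax τ A 1 Set.univ (l 1)
  /-- the leader has too few observations: all arms are candidates -/
  leader_low : ∀ r, 1 ≤ r →
    (windowCount τ A (l r) (r + 1) : ℝ) < ((min r τ : ℕ) : ℝ) / (2 * K) →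
      IsArgmax τ A (r + 1) Set.univ (l (r + 1))
  /-- otherwise only the current leader and the eligible arms are candidates -/
  leader_keep : ∀ r, 1 ≤ r →
    ((min r τ : ℕ) : ℝ) / (2 * K) ≤ (windowCount τ A (l r) (r + 1) : ℝ) →
      IsArgmax τ A (r + 1) (eligible τ A r ∪ {l r}) (l (r + 1))

/-! ## The algorithm in a random environment -/

variable {Ω : Type*} [mΩ : MeasurableSpace Ω]

/-- `X t k` is the reward of arm `k` at time `t`: it has distribution `ν t k`, is known at time `t`
and is independent of the information `ℱ (t - 1)` available before time `t`. -/
structure IsEnvironment (P : Measure Ω) (ℱ : Filtration ℕ mΩ) (ν : ℕ → Fin K → Measure ℝ)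
    (X : ℕ → Fin K → Ω → ℝ) : Prop where
  adapted : ∀ t k, 1 ≤ t → Measurable[ℱ t] (X t k)
  law : ∀ t k, 1 ≤ t → P.map (X t k) = ν t k
  indep : ∀ t k, 1 ≤ t →
    Indep (MeasurableSpace.comap (X t k) inferInstance) (ℱ (t - 1)) P

/-- The random leaders `l` and pulled sets `A` are produced by SW-LB-SDA with window `τ` in the
environment `X`, using only the information available: if `t` pulls have been made by the end of
round `r`, then `l r` and `A (r + 1)` are determined by `ℱ t` (which may hold external
randomness, used to break ties). -/
structure IsPolicyRun (P : Measure Ω) (ℱ : Filtration ℕ mΩ) (X : ℕ → Fin K → Ω → ℝ) (τ : ℕ)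
    (l : Ω → ℕ → Fin K) (A : Ω → ℕ → Finset (Fin K)) : Prop where
  isRun : ∀ w, IsRun τ (fun t k => X t k w) (l w) (A w)
  nonanticipating : ∀ r t, 1 ≤ r → ∀ (j : Fin K) (S : Finset (Fin K)),
    MeasurableSet[ℱ t] {w | pullsBefore (A w) (r + 1) = t ∧ l w r = j ∧ A w (r + 1) = S}

open Classical in
/-- Dynamic regret `𝔼 [∑_{t ≤ T} (μ*_t - μ_{A_t, t})]`, where `A_t` is the arm pulled at time `t`. -/
def dynamicRegret (P : Measure Ω) (ν : ℕ → Fin K → Measure ℝ) (A : Ω → ℕ → Finset (Fin K))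
    (T : ℕ) : ℝ :=
  ∫ w, (∑ t ∈ Finset.Icc 1 T, ∑ k : Fin K,
    if PulledAt (A w) t k then bestMean ν t - mean (ν t k) else 0) ∂P

end

end SWBandit

/-! Time is cut into phases of length `10 τ K`; all but `O(Γ)` of them lie, together with the
preceding phase, between two breakpoints. Once the best arm of such a phase leads safely, it stays
the leader as long as all blocks of `n ≈ (5 / ω) log τ` consecutive observations have means on the
right side of the thresholds, which fails with probability at most `1 / τ` by the Chernoff bound,
and then every other arm is pulled at most `O(n)` times per window.

If the best arm does not lead, it takes over within one phase with probability at least `1 / 2`,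
whatever happened before: its diversity flag is raised unless the current leaders keep receiving
observations and winning their duels against it, and each new observation of a leader that does so
ends a block of badly deviating observations, of which few exist in the mean. Hence the probability
of not leading safely contracts by `1 / 2` per steady phase, and the expected number of bad phases
is `O(Γ + T / τ²)`. The regret is therefore `O(Γ τ + (T / τ) log τ)`, and the tuning of `τ`
balances the two terms. -/

namespace SWBandit

/-! ### Exponential families and Chernoff bounds -/

/-- `p` satisfies the Chernoff bound at the threshold `ξ` with rate `ω` and tilt `lam`: means of
`n` independent observations lie on the side of `ξ` given by the sign of `lam` with probability at
most `exp (-n ω)`. It is stated with the lower Lebesgue integral, so that it includes the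
finiteness of the exponential moment. -/
def ChernoffBound (p : Measure ℝ) (ω lam ξ : ℝ) : Prop :=
  ∫⁻ x, ENNReal.ofReal (Real.exp (lam * (x - ξ))) ∂p ≤ ENNReal.ofReal (Real.exp (-ω))

theorem ChernoffBound.mul_mean_sub_le {p : Measure ℝ} [IsProbabilityMeasure p] {ω lam ξ : ℝ}
    (h : ChernoffBound p ω lam ξ) (hp : Integrable (fun x => x) p) :
    lam * (mean p - ξ) ≤ -ω := by
  have hexp : Integrable (fun x => Real.exp (lam * (x - ξ))) p :=
    (lintegral_ofReal_ne_top_iff_integrable (by fun_prop)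
      (.of_forall fun x => (Real.exp_pos _).le)).1 (ne_top_of_le_ne_top ENNReal.ofReal_ne_top h)
  have hlin : Integrable (fun x => lam * (x - ξ)) p := (hp.sub (integrable_const ξ)).const_mul lam
  have hmean : ∫ x, lam * (x - ξ) ∂p = lam * (mean p - ξ) := by
    rw [integral_const_mul, integral_sub hp (integrable_const ξ), integral_const, probReal_univ,
      one_smul, mean]
  rw [← Real.exp_le_exp]
  calc Real.exp (lam * (mean p - ξ)) = Real.exp (∫ x, lam * (x - ξ) ∂p) := by rw [hmean]
    _ ≤ ∫ x, Real.exp (lam * (x - ξ)) ∂p :=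
        convexOn_exp.map_integral_le Real.continuous_exp.continuousOn isClosed_univ
          (.of_forall fun _ => Set.mem_univ _) hlin hexp
    _ ≤ Real.exp (-ω) := by
        rw [ChernoffBound, ← ofReal_integral_eq_lintegral_ofReal hexp
          (.of_forall fun x => (Real.exp_pos _).le)] at h
        exact (ENNReal.ofReal_le_ofReal_iff (Real.exp_pos _).le).1 h

namespace IsParam

variable {ρ : Measure ℝ} {θ η ω : ℝ}

theorem isProbabilityMeasure (h : IsParam ρ θ) : IsProbabilityMeasure (expFam ρ θ) :=
  have : NeZero ρ := ⟨h.1⟩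
  isProbabilityMeasure_tilted h.2.1

theorem tilted_expFam (hθ : IsParam ρ θ) (η : ℝ) :
    (expFam ρ θ).tilted (fun x => (η - θ) * x) = expFam ρ η := by
  unfold expFam
  rw [tilted_tilted hθ.2.1]
  congr with x
  simp only [Pi.add_apply]
  ring

theorem integrable_exp_mul (hθ : IsParam ρ θ) (hη : IsParam ρ η) :
    Integrable (fun x => Real.exp ((η - θ) * x)) (expFam ρ θ) := by
  unfold expFam
  rw [integrable_tilted_iff hθ.2.1]
  refine hη.2.1.congr (.of_forall fun x => ?_)
  simp only [smul_eq_mul, ← Real.exp_add]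
  ring_nf

theorem klDiv_expFam (hθ : IsParam ρ θ) (hη : IsParam ρ η) :
    InformationTheory.klDiv (expFam ρ η) (expFam ρ θ) =
      ENNReal.ofReal ((η - θ) * mean (expFam ρ η) - cgf id (expFam ρ θ) (η - θ)) := by
  have := hθ.isProbabilityMeasure
  have := hη.isProbabilityMeasure
  have hac : expFam ρ η ≪ expFam ρ θ := hθ.tilted_expFam η ▸ tilted_absolutelyContinuous _ _
  have hllr : llr (expFam ρ η) (expFam ρ θ) =ᵐ[expFam ρ η]
      fun x => (η - θ) * x - cgf id (expFam ρ θ) (η - θ) := by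
    have h := log_rnDeriv_tilted_left_self (hθ.integrable_exp_mul hη)
    rw [hθ.tilted_expFam η] at h
    exact hac.ae_le h
  have hint : Integrable (fun x => (η - θ) * x) (expFam ρ η) := hη.2.2.const_mul _
  rw [InformationTheory.klDiv_of_ac_of_integrable hac
    ((hint.sub (integrable_const _)).congr hllr.symm), integral_congr_ae hllr,
    integral_sub hint (integrable_const _), integral_const_mul]
  simp only [mean, integral_const, probReal_univ, one_smul, add_sub_cancel_right]

theorem chernoffBound_expFam (hθ : IsParam ρ θ) (hη : IsParam ρ η) (hω : 0 < ω)
    (hkl : ENNReal.ofReal ω ≤ InformationTheory.klDiv (expFam ρ η) (expFam ρ θ)) :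
    ChernoffBound (expFam ρ θ) ω (η - θ) (mean (expFam ρ η)) := by
  have := hθ.isProbabilityMeasure
  set m := mean (expFam ρ η)
  have hω' : ω ≤ (η - θ) * m - cgf id (expFam ρ θ) (η - θ) := by
    rw [hθ.klDiv_expFam hη, ENNReal.ofReal_le_ofReal_iff'] at hkl
    exact hkl.resolve_right hω.not_ge
  have hexp : ∀ x, Real.exp ((η - θ) * (x - m)) =
      Real.exp (-((η - θ) * m)) * Real.exp ((η - θ) * x) := fun x => by
    rw [← Real.exp_add]
    ring_nf
  have hint := hθ.integrable_exp_mul hη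
  unfold ChernoffBound
  simp only [hexp]
  rw [← ofReal_integral_eq_lintegral_ofReal (hint.const_mul _) (.of_forall fun x => by positivity),
    integral_const_mul]
  refine ENNReal.ofReal_le_ofReal ?_
  calc Real.exp (-((η - θ) * m)) * mgf id (expFam ρ θ) (η - θ)
      = Real.exp (cgf id (expFam ρ θ) (η - θ) - (η - θ) * m) := by
        rw [← exp_cgf (X := id) hint, ← Real.exp_add, neg_add_eq_sub]
    _ ≤ Real.exp (-ω) := Real.exp_le_exp.2 (by linarith)

end IsParam

/-! ### Separated models -/

/-- A stationary `K`-armed model of which only the properties that drive the regret analysis are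
retained: gaps bounded by `D`, and for each arm `k` other than the best arm `b` a threshold `ξ`
that separates the empirical means of `k` from those of `b` at the exponential rate `ω`. -/
structure IsSeparatedModel {K : ℕ} (ω D : ℝ) (p : Fin K → Measure ℝ) (b : Fin K) : Prop where
  isProbabilityMeasure : ∀ k, IsProbabilityMeasure (p k)
  integrable : ∀ k, Integrable (fun x => x) (p k)
  gap_le : ∀ k, k ≠ b → mean (p b) - mean (p k) ≤ D
  chernoffBound : ∀ k, k ≠ b → ∃ lam lam' ξ : ℝ, 0 < lam ∧ lam' < 0 ∧
    ChernoffBound (p k) ω lam ξ ∧ ChernoffBound (p b) ω lam' ξ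

theorem IsExpFamModel.exists_isSeparatedModel {K : ℕ} {ω D : ℝ} {p : Fin K → Measure ℝ}
    (hω : 0 < ω) (h : IsExpFamModel ω D p) : ∃ b, IsSeparatedModel ω D p b := by
  obtain ⟨ρ, θ, hp, b, hb⟩ := h
  obtain rfl : p = fun k => expFam ρ (θ k) := funext fun k => (hp k).2
  have hθ : ∀ k, IsParam ρ (θ k) := fun k => (hp k).1
  refine ⟨b, fun k => (hθ k).isProbabilityMeasure, fun k => (hθ k).2.2,
    fun k hk => (hb k hk).2.1, fun k hk => ?_⟩
  obtain ⟨hlt, -, η, hη, hmid, hkl, hkl'⟩ := hb k hk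
  have hC := (hθ k).chernoffBound_expFam hη hω hkl
  have hC' := (hθ b).chernoffBound_expFam hη hω hkl'
  have := (hθ k).isProbabilityMeasure
  have := (hθ b).isProbabilityMeasure
  refine ⟨η - θ k, η - θ b, mean (expFam ρ η), ?_, ?_, hC, hC'⟩
  · nlinarith [hC.mul_mean_sub_le (hθ k).2.2]
  · nlinarith [hC'.mul_mean_sub_le (hθ b).2.2]

namespace IsSeparatedModel

variable {K : ℕ} {ω D : ℝ} {p : Fin K → Measure ℝ} {b b' : Fin K}

theorem mean_lt (h : IsSeparatedModel ω D p b) (hω : 0 < ω) {k : Fin K} (hk : k ≠ b) :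
    mean (p k) < mean (p b) := by
  obtain ⟨lam, lam', ξ, hlam, hlam', hC, hC'⟩ := h.chernoffBound k hk
  have := h.isProbabilityMeasure k
  have := h.isProbabilityMeasure b
  have hkξ := hC.mul_mean_sub_le (h.integrable k)
  have hbξ := hC'.mul_mean_sub_le (h.integrable b)
  calc mean (p k) < ξ := by nlinarith
    _ < mean (p b) := by nlinarith

theorem best_unique (h : IsSeparatedModel ω D p b) (h' : IsSeparatedModel ω D p b') (hω : 0 < ω) :
    b = b' := by
  by_contra hne
  exact lt_asymm (h.mean_lt hω (Ne.symm hne)) (h'.mean_lt hω hne)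

theorem iSup_mean (h : IsSeparatedModel ω D p b) (hω : 0 < ω) : ⨆ k, mean (p k) = mean (p b) := by
  have : Nonempty (Fin K) := ⟨b⟩
  refine le_antisymm (ciSup_le fun k => ?_)
    (le_ciSup (f := fun k => mean (p k)) (Set.finite_range _).bddAbove b)
  rcases eq_or_ne k b with rfl | hk
  · exact le_rfl
  · exact (h.mean_lt hω hk).le

end IsSeparatedModel

/-! ### Counting pulls -/

section Counting

variable {K τ : ℕ} {A : ℕ → Finset (Fin K)} {k : Fin K} {x y z : ℕ}

/-- Number of rounds `s ∈ (x, y]` in which arm `k` is pulled. -/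
def pulls (A : ℕ → Finset (Fin K)) (k : Fin K) (x y : ℕ) : ℕ :=
  ((Finset.Ioc x y).filter (fun s => k ∈ A s)).card

theorem pulls_self (k : Fin K) (x : ℕ) : pulls A k x x = 0 := by simp [pulls]

theorem pulls_succ (k : Fin K) (h : x ≤ y) :
    pulls A k x (y + 1) = pulls A k x y + if k ∈ A (y + 1) then 1 else 0 := by
  unfold pulls
  rw [← Finset.insert_Ioc_right_eq_Ioc_add_one h, Finset.filter_insert]
  split_ifs with hk
  · rw [Finset.card_insert_of_notMem (by simp)]
  · rfl

theorem pulls_add (k : Fin K) (hxy : x ≤ y) (hyz : y ≤ z) :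
    pulls A k x y + pulls A k y z = pulls A k x z := by
  unfold pulls
  rw [← Finset.card_union_of_disjoint, ← Finset.filter_union, Finset.Ioc_union_Ioc_eq_Ioc hxy hyz]
  exact Finset.disjoint_filter_filter (Finset.Ioc_disjoint_Ioc_of_le le_rfl)

theorem pulls_le (k : Fin K) (x y : ℕ) : pulls A k x y ≤ y - x :=
  (Finset.card_filter_le _ _).trans (by simp)

theorem pulls_mono (k : Fin K) {x x' y y' : ℕ} (hx : x' ≤ x) (hy : y ≤ y') :
    pulls A k x y ≤ pulls A k x' y' :=
  Finset.card_le_card (Finset.filter_subset_filter _ (Finset.Ioc_subset_Ioc hx hy))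

theorem pulls_eq_of_forall_mem (h : ∀ s, x < s → s ≤ y → k ∈ A s) : pulls A k x y = y - x := by
  unfold pulls
  rw [Finset.filter_true_of_mem, Nat.card_Ioc]
  exact fun s hs => h s (Finset.mem_Ioc.1 hs).1 (Finset.mem_Ioc.1 hs).2

theorem pulls_lt_of_notMem {s : ℕ} (hx : x < s) (hy : s ≤ y) (hs : k ∉ A s) :
    pulls A k x y < y - x := by
  unfold pulls
  rw [← Nat.card_Ioc]
  exact Finset.card_lt_card (Finset.filter_ssubset.2 ⟨s, Finset.mem_Ioc.2 ⟨hx, hy⟩, hs⟩)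

theorem sub_le_sum_pulls (S : Finset (Fin K)) (h : ∀ s, x < s → s ≤ y → ∃ k ∈ S, k ∈ A s) :
    y - x ≤ ∑ k ∈ S, pulls A k x y := by
  have hcover : Finset.Ioc x y ⊆ S.biUnion fun k => (Finset.Ioc x y).filter (fun s => k ∈ A s) :=
    fun s hs => by
      obtain ⟨k, hkS, hks⟩ := h s (Finset.mem_Ioc.1 hs).1 (Finset.mem_Ioc.1 hs).2
      exact Finset.mem_biUnion.2 ⟨k, hkS, Finset.mem_filter.2 ⟨hs, hks⟩⟩
  calc y - x = (Finset.Ioc x y).card := (Nat.card_Ioc x y).symm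
    _ ≤ _ := (Finset.card_le_card hcover).trans Finset.card_biUnion_le

theorem sub_le_pulls_add_mul {n : ℕ} {b : Fin K} (hA : ∀ s, x < s → s ≤ y → (A s).Nonempty)
    (hn : ∀ k, k ≠ b → pulls A k x y ≤ n) : y - x ≤ pulls A b x y + (K - 1) * n := by
  have hcover : ∀ s, x < s → s ≤ y → ∃ k ∈ Finset.univ, k ∈ A s := fun s hx hy =>
    (hA s hx hy).imp fun k hk => ⟨Finset.mem_univ k, hk⟩
  calc y - x ≤ ∑ k, pulls A k x y := sub_le_sum_pulls _ hcover
    _ = pulls A b x y + ∑ k ∈ Finset.univ.erase b, pulls A k x y :=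
        (Finset.add_sum_erase _ _ (Finset.mem_univ b)).symm
    _ ≤ pulls A b x y + (K - 1) * n := by
        gcongr
        refine (Finset.sum_le_card_nsmul _ _ n fun k hk =>
          hn k (Finset.ne_of_mem_erase hk)).trans_eq ?_
        simp

theorem count_eq_pulls (k : Fin K) (r : ℕ) : count A k r = pulls A k 0 r := rfl

theorem windowCount_eq_pulls (τ : ℕ) (k : Fin K) (r : ℕ) :
    windowCount τ A k r = pulls A k (r - τ) r := by
  unfold windowCount pulls
  congr 1
  ext s
  simp only [Finset.mem_filter, Finset.mem_Icc, Finset.mem_Ioc]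
  exact ⟨fun ⟨⟨_, _⟩, _, hk⟩ => ⟨by omega, hk⟩, fun ⟨⟨_, _⟩, hk⟩ => ⟨by omega, by omega, hk⟩⟩

theorem windowCount_le (τ : ℕ) (k : Fin K) (r : ℕ) : windowCount τ A k r ≤ τ := by
  rw [windowCount_eq_pulls]
  exact (pulls_le _ _ _).trans (by omega)

theorem pulls_le_windowCount (k : Fin K) (h : y ≤ x + τ) :
    pulls A k x y ≤ windowCount τ A k y := by
  rw [windowCount_eq_pulls]
  exact pulls_mono k (by omega) le_rfl

theorem windowCount_le_add_sub (k : Fin K) (h : x ≤ y) (hy : y ≤ x + τ) :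
    windowCount τ A k x ≤ windowCount τ A k y + (y - x - pulls A k x y) := by
  have hsplit := pulls_add (A := A) k (show x - τ ≤ y - τ by omega) (show y - τ ≤ x by omega)
  have hsplit' := pulls_add (A := A) k (show y - τ ≤ x by omega) h
  have hle := pulls_le (A := A) k (x - τ) (y - τ)
  have hle' := pulls_le (A := A) k x y
  rw [windowCount_eq_pulls, windowCount_eq_pulls]
  omega

theorem windowCount_le_succ_add_one (τ : ℕ) (k : Fin K) (r : ℕ) :
    windowCount τ A k r ≤ windowCount τ A k (r + 1) + 1 := by
  rcases Nat.eq_zero_or_pos τ with rfl | hτ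
  · exact (windowCount_le 0 k r).trans (Nat.zero_le _)
  · have := windowCount_le_add_sub (A := A) (τ := τ) k (Nat.le_add_right r 1) (by omega)
    omega

theorem windowCount_le_succ_of_mem {r : ℕ} (hτ : 1 ≤ τ) (hk : k ∈ A (r + 1)) :
    windowCount τ A k r ≤ windowCount τ A k (r + 1) := by
  have h := windowCount_le_add_sub (A := A) (τ := τ) k (Nat.le_add_right r 1) (by omega)
  rw [pulls_succ k le_rfl, pulls_self, if_pos hk] at h
  omega

theorem windowCount_succ_le (τ : ℕ) (k : Fin K) (r : ℕ) :
    windowCount τ A k (r + 1) ≤ windowCount τ A k r + if k ∈ A (r + 1) then 1 else 0 := by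
  rw [windowCount_eq_pulls, windowCount_eq_pulls]
  calc pulls A k (r + 1 - τ) (r + 1) ≤ pulls A k (r - τ) (r + 1) := pulls_mono k (by omega) le_rfl
    _ = _ := pulls_succ k (by omega)

-- At its last pull in `(x, y]` the arm has all its earlier pulls in `(x, y]` in the window.
theorem pulls_le_succ_of_windowCount_le {n : ℕ} (hxy : x ≤ y) (hy : y ≤ x + τ)
    (h : ∀ s, x ≤ s → s < y → k ∈ A (s + 1) → windowCount τ A k s ≤ n) :
    pulls A k x y ≤ n + 1 := by
  induction y, hxy using Nat.le_induction with
  | base => simp [pulls_self]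
  | succ y hxy ih =>
    rw [pulls_succ k hxy]
    split_ifs with hk
    · have := h y hxy (by omega) hk
      have := pulls_le_windowCount (A := A) (τ := τ) k (show y ≤ x + τ by omega)
      omega
    · exact ih (by omega) fun s hxs hsy => h s hxs (by omega)

theorem pulls_le_mul_of_windowCount_le {n m : ℕ} (hxy : x ≤ y) (hy : y ≤ x + m * τ)
    (h : ∀ s, x ≤ s → s < y → k ∈ A (s + 1) → windowCount τ A k s ≤ n) :
    pulls A k x y ≤ m * (n + 1) := by
  induction m generalizing y with
  | zero =>
    obtain rfl : y = x := by omega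
    simp [pulls_self]
  | succ m ih =>
    rw [Nat.add_one_mul] at hy ⊢
    rcases le_total y (x + m * τ) with hle | hle
    · exact (ih hxy hle h).trans (Nat.le_add_right _ _)
    · rw [← pulls_add k (Nat.le_add_right x (m * τ)) hle]
      exact add_le_add (ih (by omega) le_rfl fun s hxs hs => h s hxs (by omega))
        (pulls_le_succ_of_windowCount_le hle (by omega) fun s hxs hs => h s (by omega) hs)

theorem min_le_sum_windowCount (hA : ∀ r, 1 ≤ r → (A r).Nonempty) (r : ℕ) :
    min r τ ≤ ∑ k, windowCount τ A k r := by
  simp only [windowCount_eq_pulls]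
  refine le_trans (by omega) (sub_le_sum_pulls (x := r - τ) (y := r) Finset.univ fun s hs _ => ?_)
  exact (hA s (by omega)).imp fun k hk => ⟨Finset.mem_univ k, hk⟩

end Counting

/-! ### The leader of a run -/

section Leader

variable {K τ n : ℕ} {x : ℕ → Fin K → ℝ} {l : ℕ → Fin K} {A : ℕ → Finset (Fin K)}

theorem mem_winners {k : Fin K} {r : ℕ} : k ∈ winners τ x l A r ↔ k ≠ l r ∧
    ((windowCount τ A k r : ℝ) ≤ Real.sqrt (Real.log τ) ∨ DiversityFlag τ l A k r ∨
      WinsDuel τ x l A k r) := by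
  simp [winners]

/-- The leader of round `r` has too few observations to keep its role without a new election. -/
def LowLeader (τ : ℕ) (l : ℕ → Fin K) (A : ℕ → Finset (Fin K)) (r : ℕ) : Prop :=
  (windowCount τ A (l r) (r + 1) : ℝ) < τ / (2 * K)

namespace IsRun

variable (h : IsRun τ x l A)
include h

theorem nonempty {r : ℕ} (hr : 1 ≤ r) : (A r).Nonempty := by
  obtain ⟨r, rfl⟩ := Nat.exists_eq_add_of_le' hr
  rcases Nat.eq_zero_or_pos r with rfl | hr'
  · rw [h.first_round]
    exact ⟨l 0, Finset.mem_univ _⟩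
  · by_cases hw : (winners τ x l A r).Nonempty
    · rwa [h.pull_winners r hr' hw]
    · rw [h.pull_leader r hr' hw]
      exact Finset.singleton_nonempty _

theorem mem_of_mem_winners {r : ℕ} (hr : 1 ≤ r) {k : Fin K} (hk : k ∈ winners τ x l A r) :
    k ∈ A (r + 1) := by
  rwa [h.pull_winners r hr ⟨k, hk⟩]

theorem mem_winners_of_mem {r : ℕ} (hr : 1 ≤ r) {k : Fin K} (hk : k ∈ A (r + 1))
    (hkl : k ≠ l r) : k ∈ winners τ x l A r := by
  by_cases hw : (winners τ x l A r).Nonempty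
  · rwa [h.pull_winners r hr hw] at hk
  · rw [h.pull_leader r hr hw] at hk
    exact absurd (Finset.mem_singleton.1 hk) hkl

theorem eq_leader_of_mem {r : ℕ} (hr : 1 ≤ r) (hl : l r ∈ A (r + 1)) {k : Fin K}
    (hk : k ∈ A (r + 1)) : k = l r := by
  by_cases hw : (winners τ x l A r).Nonempty
  · rw [h.pull_winners r hr hw] at hl
    exact absurd rfl (mem_winners.1 hl).1
  · rw [h.pull_leader r hr hw] at hk
    exact Finset.mem_singleton.1 hk

theorem div_le_windowCount_of_isArgmax {r : ℕ} {k : Fin K} (hk : IsArgmax τ A r Set.univ k) :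
    ((min r τ : ℕ) : ℝ) / K ≤ windowCount τ A k r := by
  have hK : (0 : ℝ) < K := by exact_mod_cast Fin.pos k
  rw [div_le_iff₀ hK]
  have hsum : min r τ ≤ windowCount τ A k r * K := calc
    min r τ ≤ ∑ j, windowCount τ A j r := min_le_sum_windowCount (fun _ => h.nonempty) r
    _ ≤ ∑ _j : Fin K, windowCount τ A k r :=
        Finset.sum_le_sum fun j _ => hk.2 j (Set.mem_univ j)
    _ = windowCount τ A k r * K := by simp [mul_comm]
  exact_mod_cast hsum

theorem div_le_windowCount_of_lowLeader {r : ℕ} (hr : 1 ≤ r) (hτ : τ ≤ r)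
    (hlow : LowLeader τ l A r) : (τ : ℝ) / K ≤ windowCount τ A (l (r + 1)) (r + 1) := by
  have hmax := h.div_le_windowCount_of_isArgmax (h.leader_low r hr (by rwa [min_eq_right hτ]))
  rwa [min_eq_right (by omega)] at hmax

theorem mem_eligible_of_ne {r : ℕ} (hr : 1 ≤ r) (hτ : τ ≤ r) (hne : l (r + 1) ≠ l r)
    (hlow : ¬ LowLeader τ l A r) : l (r + 1) ∈ eligible τ A r :=
  (h.leader_keep r hr (by rw [min_eq_right hτ]; exact not_lt.1 hlow)).1.resolve_right hne

theorem div_le_windowCount_of_ne {r : ℕ} (hr : 1 ≤ r) (hτ : τ ≤ r) (hne : l (r + 1) ≠ l r) :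
    (τ : ℝ) / K ≤ windowCount τ A (l (r + 1)) (r + 1) := by
  by_cases hlow : LowLeader τ l A r
  · exact h.div_le_windowCount_of_lowLeader hr hτ hlow
  · simpa only [min_eq_right hτ] using (h.mem_eligible_of_ne hr hτ hne hlow).2

theorem div_le_windowCount_leader {r : ℕ} (hr : 1 ≤ r) (hτ : τ < r) :
    (τ : ℝ) / (2 * K) ≤ windowCount τ A (l r) r := by
  obtain ⟨r, rfl⟩ := Nat.exists_eq_add_of_le' hr
  rcases Nat.eq_zero_or_pos r with rfl | hr'
  · obtain rfl : τ = 0 := by omega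
    simp
  have hle : (τ : ℝ) / (2 * K) ≤ τ / K := by
    rw [mul_comm, ← div_div]
    exact div_le_self (by positivity) one_le_two
  by_cases hlow : LowLeader τ l A r
  · exact hle.trans (h.div_le_windowCount_of_lowLeader hr' (by omega) hlow)
  · by_cases hne : l (r + 1) = l r
    · rw [hne]
      exact not_lt.1 hlow
    · exact hle.trans (h.div_le_windowCount_of_ne hr' (by omega) hne)

end IsRun

/-! ### Persistence of the best arm as a leader -/

/-- The duels of round `r` in which the arm `b` takes part are won by `b` as soon as both sides
have at least `n` observations. The challenger side and the leader side are listed separately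
because the algorithm only compares the leader with a challenger. -/
structure BestWinsDuels (τ : ℕ) (x : ℕ → Fin K → ℝ) (l : ℕ → Fin K) (A : ℕ → Finset (Fin K))
    (b : Fin K) (n r : ℕ) : Prop where
  not_winsDuel : l r = b → ∀ k, k ≠ b → n ≤ windowCount τ A k r → n ≤ windowCount τ A b r →
    ¬ WinsDuel τ x l A k r
  winsDuel : l r ≠ b → n ≤ windowCount τ A b r → n ≤ windowCount τ A (l r) r →
    WinsDuel τ x l A b r

/-- The window `τ` is large compared with the number `n` of observations from which empirical
means are reliable: `√(log τ) ≤ n ≤ (log τ)²`, and `(log τ)²` lies well between `K` and `τ`. -/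
structure Admissible (K τ n : ℕ) : Prop where
  two_le : 2 ≤ K
  sqrt_log_le : Real.sqrt (Real.log τ) ≤ n
  le_log_sq : (n : ℝ) ≤ Real.log τ ^ 2
  two_mul_le_log_sq : 2 * (K : ℝ) ≤ Real.log τ ^ 2
  log_sq_le : 4 * (K : ℝ) ^ 2 * (Real.log τ ^ 2 + 4) ≤ τ

/-- The largest integer below `(log τ)²`: the number of observations up to which an arm may raise
its diversity flag. -/
noncomputable def logSqFloor (τ : ℕ) : ℕ := ⌊Real.log τ ^ 2⌋₊

theorem logSqFloor_le (τ : ℕ) : (logSqFloor τ : ℝ) ≤ Real.log τ ^ 2 := Nat.floor_le (sq_nonneg _)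

theorem le_logSqFloor {m τ : ℕ} (h : (m : ℝ) ≤ Real.log τ ^ 2) : m ≤ logSqFloor τ := Nat.le_floor h

namespace Admissible

variable (ha : Admissible K τ n)
include ha

theorem two_le_cast : (2 : ℝ) ≤ K := by exact_mod_cast ha.two_le

theorem add_sixteen_le : K + 16 ≤ τ := by
  have hK := ha.two_le_cast
  have : (K : ℝ) + 16 ≤ τ := calc
    (K : ℝ) + 16 ≤ 4 * 2 ^ 2 * (2 * K + 4) := by linarith
    _ ≤ 4 * (K : ℝ) ^ 2 * (Real.log τ ^ 2 + 4) := by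
        gcongr
        exact ha.two_mul_le_log_sq
    _ ≤ τ := ha.log_sq_le
  exact_mod_cast this

theorem flagLength_le : flagLength K τ ≤ τ := by
  refine Nat.ceil_le.2 (le_trans ?_ ha.log_sq_le)
  have hK := ha.two_le_cast
  calc ((K : ℝ) - 1) * Real.log τ ^ 2 ≤ 4 * (K : ℝ) ^ 2 * Real.log τ ^ 2 := by
        gcongr
        nlinarith
    _ ≤ 4 * (K : ℝ) ^ 2 * (Real.log τ ^ 2 + 4) := by
        gcongr
        linarith

theorem four_mul_logSqFloor_le : 4 * (K : ℝ) ^ 2 * (logSqFloor τ + 4) ≤ τ := by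
  refine le_trans ?_ ha.log_sq_le
  gcongr
  exact logSqFloor_le τ

theorem mul_logSqFloor_le : (((K - 1) * (logSqFloor τ + 1) : ℕ) : ℝ) ≤ τ / (4 * K) := by
  have hK := ha.two_le_cast
  rw [le_div_iff₀ (by positivity)]
  calc (((K - 1) * (logSqFloor τ + 1) : ℕ) : ℝ) * (4 * K)
      ≤ ((K : ℝ) * (logSqFloor τ + 4)) * (4 * K) := by
        rw [Nat.cast_mul]
        gcongr
        · exact Nat.sub_le K 1
        · push_cast
          linarith
    _ = 4 * (K : ℝ) ^ 2 * (logSqFloor τ + 4) := by ring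
    _ ≤ τ := ha.four_mul_logSqFloor_le

theorem logSqFloor_add_one_lt : (logSqFloor τ : ℝ) + 1 < τ / (2 * K) := by
  have hK := ha.two_le_cast
  rw [lt_div_iff₀ (by positivity)]
  calc ((logSqFloor τ : ℝ) + 1) * (2 * K) < (logSqFloor τ + 4) * (2 * K) := by
        gcongr
        norm_num
    _ ≤ (logSqFloor τ + 4) * (4 * K ^ 2) :=
        mul_le_mul_of_nonneg_left (by nlinarith) (by positivity)
    _ = 4 * (K : ℝ) ^ 2 * (logSqFloor τ + 4) := by ring
    _ ≤ τ := ha.four_mul_logSqFloor_le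

theorem le_logSqFloor : n ≤ logSqFloor τ := SWBandit.le_logSqFloor ha.le_log_sq

theorem le_of_div_le {m : ℕ} (h : (τ : ℝ) / (2 * K) ≤ m) : n ≤ m := by
  have hlt : (logSqFloor τ : ℝ) < m := by linarith [ha.logSqFloor_add_one_lt]
  exact ha.le_logSqFloor.trans (by exact_mod_cast hlt.le)

theorem mul_logSqFloor_lt_flagLength : (K - 2) * (logSqFloor τ + 1) < flagLength K τ := by
  rw [flagLength, Nat.lt_ceil, Nat.cast_mul, Nat.cast_sub ha.two_le, Nat.cast_add, Nat.cast_one,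
    Nat.cast_ofNat]
  have hK := sub_nonneg.2 ha.two_le_cast
  calc ((K : ℝ) - 2) * (logSqFloor τ + 1) ≤ (K - 2) * (Real.log τ ^ 2 + 1) := by
        gcongr
        exact logSqFloor_le τ
    _ < (K - 1) * Real.log τ ^ 2 := by linarith [ha.two_mul_le_log_sq]

end Admissible

namespace IsRun

variable {b : Fin K} (h : IsRun τ x l A) (ha : Admissible K τ n)
include h ha

theorem le_windowCount_leader {r : ℕ} (hr : τ < r) : n ≤ windowCount τ A (l r) r :=
  ha.le_of_div_le (h.div_le_windowCount_leader (by omega) hr)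

theorem windowCount_le_logSqFloor {r : ℕ} (hr : τ < r) (hs : BestWinsDuels τ x l A b n r)
    (hl : l r = b) {k : Fin K} (hk : k ≠ b) (hkA : k ∈ A (r + 1)) :
    windowCount τ A k r ≤ logSqFloor τ := by
  rcases (mem_winners.1 (h.mem_winners_of_mem (by omega) hkA (hl ▸ hk))).2 with hfew | hflag | hwin
  · exact le_logSqFloor (hfew.trans (ha.sqrt_log_le.trans ha.le_log_sq))
  · exact le_logSqFloor hflag.2.2.2
  · by_contra! hlt
    exact hs.not_winsDuel hl k hk (ha.le_logSqFloor.trans hlt.le)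
      (hl ▸ h.le_windowCount_leader ha hr) hwin

theorem sub_le_pulls_leader {r v : ℕ} (hr : τ < r) (hrv : r ≤ v) (hv : v ≤ r + τ)
    (hs : ∀ s, r ≤ s → s < v → BestWinsDuels τ x l A b n s) (hl : ∀ s, r ≤ s → s < v → l s = b) :
    v - r ≤ pulls A b r v + (K - 1) * (logSqFloor τ + 1) :=
  sub_le_pulls_add_mul (fun s hrs _ => h.nonempty (by omega)) fun _ hk =>
    pulls_le_succ_of_windowCount_le hrv hv fun s hrs hsv hkA =>
      h.windowCount_le_logSqFloor ha (by omega) (hs s hrs hsv) (hl s hrs hsv) hk hkA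

theorem window_le_windowCount_add {r v : ℕ} (hr : τ < r) (hv : r + τ ≤ v)
    (hs : ∀ s, r ≤ s → s < v → BestWinsDuels τ x l A b n s) (hl : ∀ s, r ≤ s → s < v → l s = b) :
    τ ≤ windowCount τ A b v + (K - 1) * (logSqFloor τ + 1) := by
  have := h.sub_le_pulls_leader ha (r := v - τ) (v := v) (by omega) (by omega) (by omega)
    (fun s hs₁ hs₂ => hs s (by omega) hs₂) (fun s hs₁ hs₂ => hl s (by omega) hs₂)
  rw [windowCount_eq_pulls]
  omega

theorem windowCount_le_windowCount_add {r v : ℕ} (hr : τ < r) (hrv : r ≤ v)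
    (hs : ∀ s, r ≤ s → s < v → BestWinsDuels τ x l A b n s) (hl : ∀ s, r ≤ s → s < v → l s = b) :
    windowCount τ A b r ≤ windowCount τ A b v + (K - 1) * (logSqFloor τ + 1) := by
  rcases le_total (r + τ) v with hv | hv
  · exact (windowCount_le τ b r).trans (h.window_le_windowCount_add ha hr hv hs hl)
  · have hpulls := h.sub_le_pulls_leader ha hr hrv hv hs hl
    have := windowCount_le_add_sub (A := A) b hrv hv
    omega

theorem leader_succ_eq {r s : ℕ} (hr : τ < r) (hrs : r ≤ s)
    (hs : ∀ u, r ≤ u → u ≤ s → BestWinsDuels τ x l A b n u) (hl : ∀ u, r ≤ u → u ≤ s → l u = b)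
    (hN : 3 * (τ : ℝ) / (4 * K) ≤ windowCount τ A b r) : l (s + 1) = b := by
  have hls := hl s hrs le_rfl
  by_contra hne
  have hne' : l (s + 1) ≠ l s := hls ▸ hne
  by_cases hlow : LowLeader τ l A s
  · have hloss : (windowCount τ A b r : ℝ) ≤
        windowCount τ A b (s + 1) + ((K - 1) * (logSqFloor τ + 1) : ℕ) := by
      exact_mod_cast h.windowCount_le_windowCount_add ha hr (by omega)
        (fun u hru hus => hs u hru (by omega)) fun u hru hus => hl u hru (by omega)
    have hsplit : 3 * (τ : ℝ) / (4 * K) = τ / (2 * K) + τ / (4 * K) := by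
      have := ha.two_le_cast
      field_simp
      ring
    rw [LowLeader, hls] at hlow
    linarith [ha.mul_logSqFloor_le]
  · have helig := (h.mem_eligible_of_ne (by omega) (by omega) hne' hlow).1
    have hfew := h.windowCount_le_logSqFloor ha (by omega) (hs s hrs le_rfl) hls hne helig
    have hmany := h.div_le_windowCount_of_ne (by omega) (by omega) hne'
    have hsucc := windowCount_succ_le (A := A) τ (l (s + 1)) s
    rw [if_pos helig] at hsucc
    have hfew' : (windowCount τ A (l (s + 1)) (s + 1) : ℝ) ≤ logSqFloor τ + 1 := by
      exact_mod_cast hsucc.trans (by omega)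
    have hhalf : (τ : ℝ) / (2 * K) ≤ τ / K := by
      rw [mul_comm, ← div_div]
      exact div_le_self (by positivity) one_le_two
    linarith [ha.logSqFloor_add_one_lt]

theorem leader_persists {r v : ℕ} (hr : τ < r)
    (hs : ∀ s, r ≤ s → s < v → BestWinsDuels τ x l A b n s) (hl : l r = b)
    (hN : 3 * (τ : ℝ) / (4 * K) ≤ windowCount τ A b r) {s : ℕ} (hrs : r ≤ s) (hsv : s ≤ v) :
    l s = b := by
  induction s using Nat.strong_induction_on with
  | _ s ih =>
    rcases hrs.eq_or_lt with rfl | hlt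
    · exact hl
    · obtain ⟨s, rfl⟩ : ∃ u, s = u + 1 := ⟨s - 1, by omega⟩
      exact h.leader_succ_eq ha hr (Nat.le_of_lt_succ hlt)
        (fun u hru hus => hs u hru (by omega))
        (fun u hru hus => ih u (by omega) hru (by omega)) hN

/-- While a flag is raised neither the leader nor the flagged arm has been pulled during the last
`flagLength K τ` rounds, and the `K - 2` remaining arms are pulled too rarely to fill them. -/
theorem not_diversityFlag {r : ℕ} {k : Fin K} (hr : τ + flagLength K τ < r)
    (hs : ∀ s, r ≤ s + flagLength K τ → s < r → BestWinsDuels τ x l A b n s) (hl : l r = b) :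
    ¬ DiversityFlag τ l A k r := by
  rintro ⟨-, hkb, hflag, -⟩
  rw [hl] at hflag hkb
  have hLτ := ha.flagLength_le
  refine ha.mul_logSqFloor_lt_flagLength.not_ge ?_
  set L := flagLength K τ
  set S := (Finset.univ.erase b).erase k with hS
  have hcard : S.card = K - 2 := by
    rw [hS, Finset.card_erase_of_mem (by simpa using hkb), Finset.card_erase_of_mem (by simp),
      Finset.card_univ, Fintype.card_fin, Nat.sub_sub]
  have hcover : ∀ s, r - L < s → s ≤ r → ∃ j ∈ S, j ∈ A s := fun s hrs hsr => by
    obtain ⟨s, rfl⟩ : ∃ u, s = u + 1 := ⟨s - 1, by omega⟩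
    obtain ⟨-, hbA, hkA⟩ := hflag s (by omega) (by omega)
    obtain ⟨j, hj⟩ := h.nonempty (r := s + 1) (by omega)
    simp only [hS, Finset.mem_erase, Finset.mem_univ, and_true]
    exact ⟨j, ⟨fun e => hkA (e ▸ hj), fun e => hbA (e ▸ hj)⟩, hj⟩
  have hpulls : ∀ j ∈ S, pulls A j (r - L) r ≤ logSqFloor τ + 1 := fun j hj =>
    pulls_le_succ_of_windowCount_le (τ := τ) (by omega) (by omega) fun s hrs hsr hjA =>
      h.windowCount_le_logSqFloor ha (by omega) (hs s (by omega) hsr)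
        (hflag s hsr (by omega)).1 (Finset.ne_of_mem_erase (Finset.mem_of_mem_erase hj)) hjA
  calc L = r - (r - L) := by omega
    _ ≤ ∑ j ∈ S, pulls A j (r - L) r := sub_le_sum_pulls S hcover
    _ ≤ S.card * (logSqFloor τ + 1) := Finset.sum_le_card_nsmul _ _ _ hpulls
    _ = (K - 2) * (logSqFloor τ + 1) := by rw [hcard]

theorem windowCount_le_of_best_leader {r : ℕ} {k : Fin K} (hr : τ + flagLength K τ < r)
    (hs : ∀ s, r ≤ s + flagLength K τ → s ≤ r → BestWinsDuels τ x l A b n s) (hl : l r = b)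
    (hk : k ≠ b) (hkA : k ∈ A (r + 1)) : windowCount τ A k r ≤ n := by
  rcases (mem_winners.1 (h.mem_winners_of_mem (by omega) hkA (hl ▸ hk))).2 with hfew | hflag | hwin
  · exact_mod_cast hfew.trans ha.sqrt_log_le
  · exact absurd hflag (h.not_diversityFlag ha hr (fun s hrs hsr => hs s hrs hsr.le) hl)
  · by_contra! hlt
    exact (hs r (by omega) le_rfl).not_winsDuel hl k hk hlt.le
      (hl ▸ h.le_windowCount_leader ha (by omega)) hwin

end IsRun

end Leader

/-! ### How the best arm becomes the leader -/

theorem card_ge_of_forall_exists_mem {S : Finset ℕ} {y m d : ℕ}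
    (h : ∀ g < m, ∃ s ∈ S, y + g * d < s ∧ s ≤ y + (g + 1) * d) : m ≤ S.card := by
  choose! f hfS hlt hle using h
  have hinj : Set.InjOn f (Finset.range m) := by
    have hmono : ∀ g < m, ∀ g' < m, f g = f g' → g ≤ g' := fun g hg g' hg' he => by
      have hlow := he ▸ hlt g hg
      have hhigh := hle g' hg'
      by_contra! hgg'
      have : (g' + 1) * d ≤ g * d := Nat.mul_le_mul_right d hgg'
      omega
    intro g hg g' hg' he
    simp only [Finset.coe_range, Set.mem_Iio] at hg hg'
    exact (hmono g hg g' hg' he).antisymm (hmono g' hg' g hg he.symm)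
  simpa using Finset.card_le_card_of_injOn f (fun g hg => hfS g (Finset.mem_range.1 hg)) hinj

section Acquisition

variable {K τ n : ℕ} {x : ℕ → Fin K → ℝ} {l : ℕ → Fin K} {A : ℕ → Finset (Fin K)} {b : Fin K}

/-- Arm `b` is the leader at round `r` and has at least `τ / K` observations in the window, as
every newly elected leader does. -/
def LeadsAt (τ : ℕ) (l : ℕ → Fin K) (A : ℕ → Finset (Fin K)) (b : Fin K) (r : ℕ) : Prop :=
  l r = b ∧ (τ : ℝ) / K ≤ windowCount τ A b r

open Classical in
/-- The rounds in `(y, z]` in which the current leader is pulled and after which the arm `b` is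
not: each of them brings a new observation of a leader that wins its duel against `b`. -/
noncomputable def freshLeaderRounds (l : ℕ → Fin K) (A : ℕ → Finset (Fin K)) (b : Fin K)
    (y z : ℕ) : Finset ℕ :=
  (Finset.Ioc y z).filter fun s => l s ∈ A s ∧ b ∉ A (s + 1)

theorem mem_freshLeaderRounds {y z s : ℕ} :
    s ∈ freshLeaderRounds l A b y z ↔ (y < s ∧ s ≤ z) ∧ l s ∈ A s ∧ b ∉ A (s + 1) := by
  simp [freshLeaderRounds]

namespace IsRun

variable (h : IsRun τ x l A)
include h

theorem leader_ne_of_not_leadsAt {r v s : ℕ} (hr : 1 ≤ r) (hτ : τ ≤ r) (hl : l r ≠ b)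
    (hno : ∀ s, r ≤ s → s ≤ v → ¬ LeadsAt τ l A b s) (hrs : r ≤ s) (hsv : s ≤ v) : l s ≠ b := by
  induction s, hrs using Nat.le_induction with
  | base => exact hl
  | succ s hrs ih =>
    intro he
    have hne : l (s + 1) ≠ l s := he ▸ (ih (by omega)).symm
    exact hno (s + 1) (by omega) hsv ⟨he, he ▸ h.div_le_windowCount_of_ne (by omega) (by omega) hne⟩

theorem window_le_windowCount_leader {k : Fin K} {r : ℕ} (hr : 1 ≤ r) (hτ : τ ≤ r)
    (hk : ∀ s, r < s + τ → s ≤ r → k ∈ A (s + 1)) :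
    τ ≤ windowCount τ A (l (r + 1)) (r + 1) := by
  rcases τ.eq_zero_or_pos with rfl | hτ0
  · exact Nat.zero_le _
  have hfull : windowCount τ A k (r + 1) = τ := by
    rw [windowCount_eq_pulls, pulls_eq_of_forall_mem]
    · omega
    · intro s hs hsr
      obtain ⟨s, rfl⟩ : ∃ u, s = u + 1 := ⟨s - 1, by omega⟩
      exact hk s (by omega) (by omega)
  by_cases hlow : LowLeader τ l A r
  · have hlow' : (windowCount τ A (l r) (r + 1) : ℝ) < ((min r τ : ℕ) : ℝ) / (2 * K) := by
      rwa [min_eq_right hτ]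
    exact hfull.ge.trans <| (h.leader_low r hr hlow').2 k (Set.mem_univ k)
  · have hkeep : ((min r τ : ℕ) : ℝ) / (2 * K) ≤ windowCount τ A (l r) (r + 1) := by
      rw [min_eq_right hτ]
      exact not_lt.1 hlow
    have helig : k ∈ eligible τ A r := by
      refine ⟨hk r (by omega) le_rfl, ?_⟩
      have hK : (1 : ℝ) ≤ K := by exact_mod_cast Fin.pos k
      rw [hfull, min_eq_right hτ]
      exact div_le_self (Nat.cast_nonneg τ) hK
    exact hfull.ge.trans <| (h.leader_keep r hr hkeep).2 k (Or.inl helig)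

variable (ha : Admissible K τ n)
include ha

theorem exists_leader_ne {r : ℕ} (hr : τ < r)
    (hs : ∀ s, r ≤ s → s < r + τ → BestWinsDuels τ x l A b n s)
    (hno : ∀ s, r ≤ s → s ≤ r + τ → ¬ LeadsAt τ l A b s) :
    ∃ s, r ≤ s ∧ s ≤ r + τ ∧ l s ≠ b := by
  by_contra! hb
  refine hno (r + τ) (by omega) le_rfl ⟨hb _ (by omega) le_rfl, ?_⟩
  have hloss : (τ : ℝ) ≤ windowCount τ A b (r + τ) + ((K - 1) * (logSqFloor τ + 1) : ℕ) := by
    exact_mod_cast h.window_le_windowCount_add ha hr le_rfl hs fun s hrs hsr => hb s hrs hsr.le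
  have hK := ha.two_le_cast
  have hhalf : (τ : ℝ) / K ≤ τ / 2 := by gcongr
  have hquarter : (τ : ℝ) / (4 * K) ≤ τ / 2 := by gcongr; linarith
  linarith [ha.mul_logSqFloor_le]

theorem mem_of_leader_ne {r v : ℕ} (hr : τ < r)
    (hs : ∀ s, r ≤ s → s ≤ v → BestWinsDuels τ x l A b n s) (hl : ∀ s, r ≤ s → s ≤ v → l s ≠ b)
    (hn : n ≤ windowCount τ A b r) {s : ℕ} (hrs : r ≤ s) (hsv : s ≤ v) : b ∈ A (s + 1) := by
  have hstep : ∀ s, r ≤ s → s ≤ v → n ≤ windowCount τ A b s → b ∈ A (s + 1) :=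
    fun s hrs hsv hns => h.mem_of_mem_winners (by omega) <| mem_winners.2
      ⟨(hl s hrs hsv).symm, Or.inr <| Or.inr <|
        (hs s hrs hsv).winsDuel (hl s hrs hsv) hns (h.le_windowCount_leader ha (by omega))⟩
  have hkeep : n ≤ windowCount τ A b s := by
    induction s, hrs using Nat.le_induction with
    | base => exact hn
    | succ s hrs ih =>
      have hτ := ha.add_sixteen_le
      exact (ih (by omega)).trans (windowCount_le_succ_of_mem (by omega)
        (hstep s hrs (by omega) (ih (by omega))))
  exact hstep s hrs hsv hkeep

/-- Otherwise `b` would be pulled in every round, each later leader would need a full window, and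
the leaders of `K` successive rounds would be distinct arms other than `b`. -/
theorem windowCount_lt_of_leader_ne {r v : ℕ} (hr : τ < r)
    (hs : ∀ s, r ≤ s → s ≤ v → BestWinsDuels τ x l A b n s) (hl : ∀ s, r ≤ s → s ≤ v → l s ≠ b)
    (hv : r + τ + K + 1 ≤ v) : windowCount τ A b r < n := by
  by_contra! hn
  have hτ := ha.add_sixteen_le
  have hbA : ∀ s, r ≤ s → s ≤ v → b ∈ A (s + 1) :=
    fun s hrs hsv => h.mem_of_leader_ne ha hr hs hl hn hrs hsv
  have hne : ∀ s t, r + τ + 1 ≤ s → s < t → t ≤ r + τ + K → l s ≠ l t := by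
    intro s t hrs hst htv he
    obtain ⟨t, rfl⟩ : ∃ u, t = u + 1 := ⟨t - 1, by omega⟩
    have hnot : l s ∉ A (s + 1) := fun hm => hl s (by omega) (by omega)
      (h.eq_leader_of_mem (by omega) hm (hbA s (by omega) (by omega))).symm
    have hfull := h.window_le_windowCount_leader (k := b) (r := t) (by omega) (by omega)
      fun u hut hu => hbA u (by omega) (by omega)
    rw [← he, windowCount_eq_pulls] at hfull
    have := pulls_lt_of_notMem (x := t + 1 - τ) (y := t + 1) (by omega) (by omega) hnot
    omega
  have hmaps : ∀ s ∈ Finset.Icc (r + τ + 1) (r + τ + K), l s ∈ Finset.univ.erase b := by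
    intro s hsm
    have := Finset.mem_Icc.1 hsm
    simpa using hl s (by omega) (by omega)
  have hinj : Set.InjOn l (Finset.Icc (r + τ + 1) (r + τ + K)) := by
    intro s hs₁ t ht he
    have hs₂ := Finset.mem_Icc.1 hs₁
    have ht₂ := Finset.mem_Icc.1 ht
    rcases lt_trichotomy s t with hlt | heq | hlt
    · exact absurd he (hne s t hs₂.1 hlt ht₂.2)
    · exact heq
    · exact absurd he.symm (hne t s ht₂.1 hlt hs₂.2)
  have hcard := Finset.card_le_card_of_injOn l hmaps hinj
  rw [Nat.card_Icc, Finset.card_erase_of_mem (by simp), Finset.card_univ, Fintype.card_fin] at hcard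
  have := ha.two_le
  omega

omit ha in
theorem leader_eq_of_not_fresh {r v : ℕ} (hr : 1 ≤ r) (hτ : τ ≤ r) (hrv : r ≤ v)
    (hlow : ∀ s, r ≤ s → s < v → ¬ LowLeader τ l A s)
    (hfresh : ∀ s, r ≤ s → s < v → l (s + 1) ∉ A (s + 1)) {s : ℕ} (hrs : r ≤ s) (hsv : s ≤ v) :
    l s = l v := by
  induction v, hrv using Nat.le_induction with
  | base => rw [le_antisymm hsv hrs]
  | succ v hrv ih =>
    rcases hsv.eq_or_lt with rfl | hlt
    · rfl
    · rw [ih (fun u hu hv => hlow u hu (by omega)) (fun u hu hv => hfresh u hu (by omega))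
        (by omega)]
      by_contra hne
      exact hfresh v hrv (by omega)
        (h.mem_eligible_of_ne (by omega) (by omega) (Ne.symm hne) (hlow v hrv (by omega))).1

theorem exists_lowLeader_or_leader_mem {q : ℕ} (hq : τ + flagLength K τ < q)
    (hb : ∀ s, q ≤ s + flagLength K τ → s ≤ q → b ∉ A (s + 1)) (hl : l q ≠ b)
    (hN : windowCount τ A b q < n) :
    ∃ s, q < s + 1 + flagLength K τ ∧ s < q ∧ (LowLeader τ l A s ∨ l (s + 1) ∈ A (s + 1)) := by
  by_contra! hno
  have hconst : ∀ s, q ≤ s + flagLength K τ → s < q → l s = l q := fun s hsq hs =>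
    h.leader_eq_of_not_fresh (r := q - flagLength K τ) (v := q) (by omega) (by omega) (by omega)
      (fun u hu huq => (hno u (by omega) huq).1) (fun u hu huq => (hno u (by omega) huq).2)
      (by omega) hs.le
  have hflag : DiversityFlag τ l A b q := by
    refine ⟨by omega, hl.symm, fun s hsq hs => ⟨hconst s hs hsq, fun hm => ?_, hb s hs hsq.le⟩, ?_⟩
    · have hsucc : l (s + 1) = l q := by
        rcases (Nat.succ_le_of_lt hsq).eq_or_lt with heq | hlt
        · rw [← heq]
        · exact hconst (s + 1) (by omega) hlt
      exact (hno s (by omega) hsq).2 (hsucc ▸ hm)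
    · exact le_trans (by exact_mod_cast hN.le) ha.le_log_sq
  exact hb q (by omega) le_rfl
    (h.mem_of_mem_winners (by omega) (mem_winners.2 ⟨hl.symm, Or.inr (Or.inl hflag)⟩))

omit ha in
theorem div_le_windowCount_add_of_lowLeader {s u : ℕ} (hs : 1 ≤ s) (hτ : τ ≤ s)
    (hlow : LowLeader τ l A s) (hsu : s + 1 ≤ u) :
    (τ : ℝ) / K ≤ windowCount τ A (l u) u + (u - (s + 1)) := by
  induction u, hsu using Nat.le_induction with
  | base =>
    have := h.div_le_windowCount_of_lowLeader hs hτ hlow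
    push_cast
    linarith
  | succ u hsu ih =>
    by_cases hsame : l (u + 1) = l u
    · rw [hsame]
      have : (windowCount τ A (l u) u : ℝ) ≤ windowCount τ A (l u) (u + 1) + 1 := by
        exact_mod_cast windowCount_le_succ_add_one τ (l u) u
      push_cast
      linarith
    · have helected := h.div_le_windowCount_of_ne (by omega) (by omega) hsame
      have hsu' : (s : ℝ) + 1 ≤ u := by exact_mod_cast hsu
      push_cast
      linarith

omit ha in
theorem div_lt_sub_of_lowLeader {s t : ℕ} (hs : 1 ≤ s) (hτ : τ ≤ s) (hst : s < t)
    (hlow : LowLeader τ l A s) (hlow' : LowLeader τ l A t) : (τ : ℝ) / (2 * K) < t - s := by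
  have hlow_t : (windowCount τ A (l t) (t + 1) : ℝ) < τ / (2 * K) := hlow'
  have helected := h.div_le_windowCount_add_of_lowLeader hs hτ hlow (Nat.succ_le_of_lt hst)
  have hsucc : (windowCount τ A (l t) t : ℝ) ≤ windowCount τ A (l t) (t + 1) + 1 := by
    exact_mod_cast windowCount_le_succ_add_one τ (l t) t
  have hhalf : (τ : ℝ) / K = τ / (2 * K) + τ / (2 * K) := by
    rw [← add_div, ← two_mul, mul_div_mul_left _ _ two_ne_zero]
  linarith

open Classical in
omit ha in
theorem card_lowLeader_le_one {y z : ℕ} (hτ : τ ≤ y) (hy : 1 ≤ y)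
    (hyz : (z : ℝ) ≤ y + τ / (2 * K)) :
    ((Finset.Ioc y z).filter fun s => LowLeader τ l A (s - 1)).card ≤ 1 := by
  have hnot : ∀ s ∈ (Finset.Ioc y z).filter fun s => LowLeader τ l A (s - 1),
      ∀ t ∈ (Finset.Ioc y z).filter fun s => LowLeader τ l A (s - 1), ¬ s < t := by
    intro s hs t ht hst
    simp only [Finset.mem_filter, Finset.mem_Ioc] at hs ht
    have hgap := h.div_lt_sub_of_lowLeader (s := s - 1) (t := t - 1) (by omega) (by omega)
      (by omega) hs.2 ht.2
    have hle : ((t - 1 : ℕ) : ℝ) + y ≤ (s - 1 : ℕ) + z := by exact_mod_cast (by omega)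
    linarith
  exact Finset.card_le_one.2 fun s hs t ht =>
    le_antisymm (not_lt.1 (hnot t ht s hs)) (not_lt.1 (hnot s hs t ht))

/-- In each of `m` successive stretches of `flagLength K τ + 1` rounds, either `b` is pulled, or a
leader is short of observations, or a leader gets a new observation: otherwise the diversity flag
of `b` would be raised. The first two cases are rare. -/
theorem le_card_freshLeaderRounds {y m : ℕ} (hy : τ + flagLength K τ < y)
    (hm : ((m * (flagLength K τ + 1) : ℕ) : ℝ) ≤ τ / (2 * K))
    (hl : ∀ s, y ≤ s → s ≤ y + m * (flagLength K τ + 1) → l s ≠ b)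
    (hN : ∀ s, y ≤ s → s ≤ y + m * (flagLength K τ + 1) → windowCount τ A b s < n) :
    m ≤ n + 1 + (freshLeaderRounds l A b y (y + m * (flagLength K τ + 1))).card := by
  classical
  set L := flagLength K τ
  set z := y + m * (L + 1) with hz
  have hzτ : z ≤ y + τ := by
    have hhalf : (τ : ℝ) / (2 * K) ≤ τ :=
      div_le_self (by positivity) (by linarith [ha.two_le_cast])
    have : m * (L + 1) ≤ τ := by exact_mod_cast hm.trans hhalf
    omega
  set pulled := (Finset.Ioc y z).filter fun s => b ∈ A s
  set low := (Finset.Ioc y z).filter fun s => LowLeader τ l A (s - 1)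
  have hpulled : pulled.card ≤ n :=
    (pulls_le_windowCount b (by omega)).trans (hN z (by omega) le_rfl).le
  have hlow : low.card ≤ 1 := h.card_lowLeader_le_one (by omega) (by omega) (by
    rw [hz, Nat.cast_add]
    linarith)
  have hchunk : ∀ g < m, ∃ s ∈ pulled ∪ low ∪ freshLeaderRounds l A b y z,
      y + g * (L + 1) < s ∧ s ≤ y + (g + 1) * (L + 1) := by
    intro g hg
    have hgm : (g + 1) * (L + 1) ≤ m * (L + 1) := Nat.mul_le_mul_right _ hg
    have hsucc : (g + 1) * (L + 1) = g * (L + 1) + (L + 1) := add_one_mul _ _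
    by_cases hb : ∃ s, y + g * (L + 1) < s ∧ s ≤ y + (g + 1) * (L + 1) ∧ b ∈ A s
    · obtain ⟨s, hgs, hsg, hbs⟩ := hb
      exact ⟨s, by simp only [pulled, Finset.mem_union, Finset.mem_filter, Finset.mem_Ioc]
                   exact Or.inl (Or.inl ⟨by omega, hbs⟩), hgs, hsg⟩
    · push Not at hb
      obtain ⟨s, hqs, hsq, hcase⟩ := h.exists_lowLeader_or_leader_mem ha (b := b)
        (q := y + g * (L + 1) + L) (by omega) (fun s _ _ => hb (s + 1) (by omega) (by omega))
        (hl _ (by omega) (by omega)) (hN _ (by omega) (by omega))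
      refine ⟨s + 1, ?_, by omega, by omega⟩
      simp only [low, Finset.mem_union, Finset.mem_filter, Finset.mem_Ioc, mem_freshLeaderRounds]
      exact hcase.imp (fun hc => Or.inr ⟨by omega, hc⟩)
        fun hc => ⟨by omega, hc, hb (s + 1 + 1) (by omega) (by omega)⟩
  calc m ≤ (pulled ∪ low ∪ freshLeaderRounds l A b y z).card := card_ge_of_forall_exists_mem hchunk
    _ ≤ (pulled ∪ low).card + (freshLeaderRounds l A b y z).card := Finset.card_union_le _ _
    _ ≤ pulled.card + low.card + (freshLeaderRounds l A b y z).card := by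
        gcongr
        exact Finset.card_union_le _ _
    _ ≤ n + 1 + (freshLeaderRounds l A b y z).card := by gcongr

end IsRun

end Acquisition

/-! ### Rounds and times -/

section Times

variable {K : ℕ} {A : ℕ → Finset (Fin K)} {j k : Fin K} {r s t t₀ t₁ : ℕ}

theorem pullsBefore_one : pullsBefore A 1 = 0 := by simp [pullsBefore]

theorem pullsBefore_succ (hr : 1 ≤ r) : pullsBefore A (r + 1) = pullsBefore A r + (A r).card :=
  Finset.sum_Ico_succ_top hr _

theorem pullsBefore_mono (h : r ≤ s) : pullsBefore A r ≤ pullsBefore A s :=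
  Finset.sum_le_sum_of_subset (Finset.Ico_subset_Ico_right h)

theorem add_pullsBefore_le (hA : ∀ s, 1 ≤ s → (A s).Nonempty) (hr : 1 ≤ r) (m : ℕ) :
    pullsBefore A r + m ≤ pullsBefore A (r + m) := by
  induction m with
  | zero => simp
  | succ m ih =>
    rw [← add_assoc r, pullsBefore_succ (by omega)]
    have := (hA (r + m) (by omega)).card_pos
    omega

theorem pullsBefore_add_le (hr : 1 ≤ r) (m : ℕ) :
    pullsBefore A (r + m) ≤ pullsBefore A r + m * K := by
  induction m with
  | zero => simp
  | succ m ih =>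
    rw [← add_assoc, pullsBefore_succ (by omega), add_mul, one_mul]
    have := card_finset_fin_le (A (r + m))
    omega

theorem pullsBefore_lt_pullTime (hk : k ∈ A r) : pullsBefore A r < pullTime A r k :=
  Nat.lt_add_of_pos_right (Finset.card_pos.2 ⟨k, Finset.mem_filter.2 ⟨hk, le_rfl⟩⟩)

theorem pullTime_le (hr : 1 ≤ r) (k : Fin K) : pullTime A r k ≤ pullsBefore A (r + 1) := by
  rw [pullsBefore_succ hr]
  exact Nat.add_le_add_left (Finset.card_filter_le _ _) _

theorem pullTime_lt_of_lt (hr : 1 ≤ r) (hrs : r < s) (hk : k ∈ A s) :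
    pullTime A r j < pullTime A s k :=
  ((pullTime_le hr j).trans (pullsBefore_mono hrs)).trans_lt (pullsBefore_lt_pullTime hk)

theorem pullTime_lt_of_arm_lt (hjk : j < k) (hk : k ∈ A r) : pullTime A r j < pullTime A r k := by
  refine Nat.add_lt_add_left (Finset.card_lt_card ?_) _
  rw [Finset.ssubset_iff_of_subset
    (Finset.monotone_filter_right _ fun i _ (hij : i ≤ j) => hij.trans hjk.le)]
  exact ⟨k, Finset.mem_filter.2 ⟨hk, le_rfl⟩, fun hm => not_le.2 hjk (Finset.mem_filter.1 hm).2⟩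

theorem PulledAt.unique (hj : PulledAt A t j) (hk : PulledAt A t k) : j = k := by
  obtain ⟨r, hr, hjr, rfl⟩ := hj
  obtain ⟨s, hs, hks, he⟩ := hk
  rcases lt_trichotomy r s with hrs | rfl | hsr
  · exact absurd he (pullTime_lt_of_lt hr hrs hks).ne'
  · rcases lt_trichotomy j k with hlt | heq | hlt
    · exact absurd he (pullTime_lt_of_arm_lt hlt hks).ne'
    · exact heq
    · exact absurd he (pullTime_lt_of_arm_lt hlt hjr).ne
  · exact absurd he (pullTime_lt_of_lt hs hsr hjr).ne

theorem strictMonoOn_pullTime (k : Fin K) :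
    StrictMonoOn (fun s => pullTime A s k) {s | 1 ≤ s ∧ k ∈ A s} :=
  fun _ hr _ hs hrs => pullTime_lt_of_lt hr.1 hrs hs.2

theorem exists_round (hA : ∀ r, 1 ≤ r → (A r).Nonempty) (ht : K ≤ t) :
    ∃ r, 1 ≤ r ∧ pullsBefore A (r + 1) ≤ t ∧ t < pullsBefore A (r + 2) := by
  have hex : ∃ r, t < pullsBefore A (r + 2) := ⟨t, by
    have := add_pullsBefore_le hA le_rfl (t + 1)
    rw [show 1 + (t + 1) = t + 2 by omega] at this
    omega⟩
  have hfirst : pullsBefore A 2 ≤ t := by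
    have := pullsBefore_add_le (A := A) le_rfl 1
    rw [pullsBefore_one, show 1 + 1 = 2 from rfl] at this
    omega
  obtain ⟨r, hr⟩ : ∃ r, Nat.find hex = r + 1 := by
    refine Nat.exists_eq_succ_of_ne_zero fun h0 => ?_
    have := Nat.find_spec hex
    rw [h0] at this
    exact this.not_ge hfirst
  exact ⟨r + 1, by omega, not_lt.1 (Nat.find_min hex (m := r) (by omega)), hr ▸ Nat.find_spec hex⟩

theorem round_mono {v u : ℕ} (hr : pullsBefore A (r + 1) ≤ t) (hv : u < pullsBefore A (v + 2))
    (h : t ≤ u) : r ≤ v := by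
  by_contra! hlt
  have := pullsBefore_mono (A := A) (show v + 2 ≤ r + 1 by omega)
  omega

theorem round_add_le {v u m : ℕ} (hr : pullsBefore A (r + 1) ≤ t)
    (hv : u < pullsBefore A (v + 2)) (h : t + m * K ≤ u) : r + m ≤ v := by
  have hrv := round_mono hr hv (by omega)
  have hK := pullsBefore_add_le (A := A) (r := r + 1) (by omega) (v + 1 - r)
  rw [show r + 1 + (v + 1 - r) = v + 2 by omega] at hK
  have := Nat.lt_of_mul_lt_mul_right (show m * K < (v + 1 - r) * K by omega)
  omega

theorem le_pullsBefore_sub {d : ℕ} (h : t < pullsBefore A (r + 2)) (hd : t₀ + (d + 1) * K ≤ t) :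
    d ≤ r ∧ t₀ ≤ pullsBefore A (r - d + 1) := by
  have hdr := round_add_le (A := A) (r := 0) (t := 0) (m := d + 1)
    (by rw [zero_add, pullsBefore_one]) h (by omega)
  have hback := pullsBefore_add_le (A := A) (r := r - d + 1) (by omega) (d + 1)
  rw [show r - d + 1 + (d + 1) = r + 2 by omega] at hback
  exact ⟨by omega, by omega⟩

open Classical in
/-- Number of pulls of arm `k` up to time `t`, whereas `count` counts up to the end of a round. -/
noncomputable def pullCount (A : ℕ → Finset (Fin K)) (k : Fin K) (t : ℕ) : ℕ :=
  ((Finset.Icc 1 t).filter fun s => PulledAt A s k).card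

theorem pullCount_mono (k : Fin K) (h : s ≤ t) : pullCount A k s ≤ pullCount A k t := by
  classical
  exact Finset.card_le_card (Finset.filter_subset_filter _ (Finset.Icc_subset_Icc_right h))

theorem pullCount_le_add (k : Fin K) (s t : ℕ) :
    pullCount A k t ≤ pullCount A k s + (t - s) := by
  classical
  have hsub : ((Finset.Icc 1 t).filter fun u => PulledAt A u k) ⊆
      ((Finset.Icc 1 s).filter fun u => PulledAt A u k) ∪ Finset.Ioc s t := by
    intro u
    simp only [Finset.mem_filter, Finset.mem_Icc, Finset.mem_union, Finset.mem_Ioc]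
    rintro ⟨hu, hk⟩
    rcases le_or_gt u s with hus | hus
    · exact Or.inl ⟨⟨hu.1, hus⟩, hk⟩
    · exact Or.inr ⟨hus, hu.2⟩
  calc pullCount A k t
      ≤ (((Finset.Icc 1 s).filter fun u => PulledAt A u k) ∪ Finset.Ioc s t).card :=
        Finset.card_le_card hsub
    _ ≤ pullCount A k s + (Finset.Ioc s t).card := Finset.card_union_le _ _
    _ = pullCount A k s + (t - s) := by rw [Nat.card_Ioc]

theorem pullCount_eq_count (k : Fin K) (hle : ∀ s, 1 ≤ s → s ≤ r → k ∈ A s → pullTime A s k ≤ t)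
    (hlt : ∀ s, r < s → k ∈ A s → t < pullTime A s k) : pullCount A k t = count A k r := by
  classical
  have himage : ((Finset.Icc 1 t).filter fun u => PulledAt A u k) =
      ((Finset.Icc 1 r).filter fun s => k ∈ A s).image fun s => pullTime A s k := by
    ext u
    simp only [Finset.mem_filter, Finset.mem_Icc, Finset.mem_image]
    constructor
    · rintro ⟨⟨-, hut⟩, s, hs, hks, rfl⟩
      exact ⟨s, ⟨⟨hs, not_lt.1 fun hrs => (hlt s hrs hks).not_ge hut⟩, hks⟩, rfl⟩
    · rintro ⟨s, ⟨⟨hs, hsr⟩, hks⟩, rfl⟩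
      exact ⟨⟨Nat.one_le_of_lt (pullsBefore_lt_pullTime hks), hle s hs hsr hks⟩, s, hs, hks, rfl⟩
  rw [pullCount, himage, Finset.card_image_of_injOn, count]
  refine (strictMonoOn_pullTime k).injOn.mono fun s hs => ?_
  simp only [Finset.coe_filter, Finset.mem_Icc, Set.mem_ofPred_eq] at hs
  exact ⟨hs.1.1, hs.2⟩

theorem pullCount_pullTime (hr : 1 ≤ r) (hk : k ∈ A r) :
    pullCount A k (pullTime A r k) = count A k r :=
  pullCount_eq_count k
    (fun _ hs hsr hks => (strictMonoOn_pullTime k).monotoneOn ⟨hs, hks⟩ ⟨hr, hk⟩ hsr)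
    fun _ hrs hks => pullTime_lt_of_lt hr hrs hks

theorem pullCount_pullsBefore (k : Fin K) (r : ℕ) :
    pullCount A k (pullsBefore A (r + 1)) = count A k r :=
  pullCount_eq_count k
    (fun _ hs hsr _ => (pullTime_le hs k).trans (pullsBefore_mono (by omega)))
    fun _ hrs hks => (pullsBefore_mono hrs).trans_lt (pullsBefore_lt_pullTime hks)

theorem pullCount_le_count (k : Fin K) (h : t ≤ pullsBefore A (r + 1)) :
    pullCount A k t ≤ count A k r :=
  pullCount_pullsBefore (A := A) k r ▸ pullCount_mono k h

theorem count_le_pullCount (k : Fin K) (h : pullsBefore A (r + 1) ≤ t) :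
    count A k r ≤ pullCount A k t :=
  pullCount_pullsBefore (A := A) k r ▸ pullCount_mono k h

theorem count_mono (k : Fin K) (h : r ≤ s) : count A k r ≤ count A k s := pulls_mono k le_rfl h

theorem count_succ (k : Fin K) (r : ℕ) :
    count A k (r + 1) = count A k r + if k ∈ A (r + 1) then 1 else 0 :=
  pulls_succ k (Nat.zero_le r)

theorem count_lt_of_mem (h : r < s) (hk : k ∈ A s) : count A k r < count A k s := by
  obtain ⟨s, rfl⟩ : ∃ u, s = u + 1 := ⟨s - 1, by omega⟩
  have hmono := count_mono (A := A) k (show r ≤ s by omega)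
  rw [count_succ, if_pos hk]
  omega

theorem count_add_windowCount (τ : ℕ) (k : Fin K) (r : ℕ) :
    count A k (r - τ) + windowCount τ A k r = count A k r := by
  rw [windowCount_eq_pulls, count_eq_pulls, count_eq_pulls]
  exact pulls_add k (Nat.zero_le _) (Nat.sub_le _ _)

theorem pullCount_add_windowCount_le (τ : ℕ) (k : Fin K) (h : t ≤ pullsBefore A (r - τ + 1)) :
    pullCount A k t + windowCount τ A k r ≤ count A k r :=
  (Nat.add_le_add_right (pullCount_le_count k h) _).trans_eq (count_add_windowCount τ k r)

/-! ### Blocks of consecutive observations of an arm -/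

/-- The rounds of the last `n` pulls of arm `k` up to round `r`, over which `lastBlockMean`
averages. -/
def lastPullRounds (A : ℕ → Finset (Fin K)) (k : Fin K) (r n : ℕ) : Finset ℕ :=
  (Finset.Icc 1 r).filter fun s => k ∈ A s ∧ count A k r < count A k s + n

theorem mem_lastPullRounds {n : ℕ} :
    s ∈ lastPullRounds A k r n ↔ (1 ≤ s ∧ s ≤ r) ∧ k ∈ A s ∧ count A k r < count A k s + n := by
  simp [lastPullRounds]

theorem injOn_pullTime_lastPullRounds (k : Fin K) (r n : ℕ) :
    Set.InjOn (fun s => pullTime A s k) (lastPullRounds A k r n) :=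
  (strictMonoOn_pullTime k).injOn.mono fun _ hs =>
    (mem_lastPullRounds.1 hs).imp And.left And.left

theorem card_lastPullRounds {n : ℕ} (hn : n ≤ count A k r) : (lastPullRounds A k r n).card = n := by
  -- The pulls up to round `r` are numbered by `count A k` from `1` to `count A k r`.
  have himage : (lastPullRounds A k r n).image (count A k) =
      Finset.Ioc (count A k r - n) (count A k r) := by
    ext i
    simp only [Finset.mem_image, mem_lastPullRounds, Finset.mem_Ioc]
    constructor
    · rintro ⟨s, ⟨⟨-, hsr⟩, -, hlt⟩, rfl⟩
      exact ⟨by omega, count_mono k hsr⟩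
    · rintro ⟨hlt, hle⟩
      have hex : ∃ s, i ≤ count A k s := ⟨r, hle⟩
      have hpos : Nat.find hex ≠ 0 := fun h0 => by
        have := Nat.find_spec hex
        rw [h0, show count A k 0 = 0 by simp [count]] at this
        omega
      obtain ⟨s, hs⟩ := Nat.exists_eq_succ_of_ne_zero hpos
      have hprev : count A k s < i := not_le.1 (Nat.find_min hex (m := s) (by omega))
      have hfound : i ≤ count A k (s + 1) := Nat.succ_eq_add_one s ▸ hs ▸ Nat.find_spec hex
      have hsr : s + 1 ≤ r := hs.symm.trans_le (Nat.find_min' hex hle)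
      rw [count_succ] at hfound
      split_ifs at hfound with hk
      · have hi : count A k (s + 1) = i := by rw [count_succ, if_pos hk]; omega
        exact ⟨s + 1, ⟨⟨by omega, hsr⟩, hk, by omega⟩, hi⟩
      · omega
  have hmono : StrictMonoOn (count A k) (lastPullRounds A k r n) :=
    fun s _ u hu hsu => count_lt_of_mem hsu (mem_lastPullRounds.1 hu).2.1
  rw [← Finset.card_image_of_injOn hmono.injOn, himage, Nat.card_Ioc]
  omega

open Classical in
/-- Times in `(t₀, t₁]` of the pulls of arm `k` with numbers `i, …, i + n - 1` after time `t₀`. -/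
noncomputable def blockTimes (A : ℕ → Finset (Fin K)) (k : Fin K) (t₀ t₁ i n : ℕ) : Finset ℕ :=
  (Finset.Ioc t₀ t₁).filter fun t => PulledAt A t k ∧ pullCount A k t₀ + i ≤ pullCount A k t ∧
    pullCount A k t < pullCount A k t₀ + i + n

theorem blockTimes_eq_image {n : ℕ} (h₁ : pullsBefore A (r + 1) ≤ t₁)
    (hn : pullCount A k t₀ + n ≤ count A k r) :
    blockTimes A k t₀ t₁ (count A k r + 1 - n - pullCount A k t₀) n =
      (lastPullRounds A k r n).image fun s => pullTime A s k := by
  ext t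
  simp only [blockTimes, Finset.mem_filter, Finset.mem_Ioc, Finset.mem_image, mem_lastPullRounds]
  constructor
  · rintro ⟨-, ⟨s, hs, hks, rfl⟩, hlow, hhigh⟩
    rw [pullCount_pullTime hs hks] at hlow hhigh
    refine ⟨s, ⟨⟨hs, not_lt.1 fun hrs => ?_⟩, hks, by omega⟩, rfl⟩
    have := count_lt_of_mem hrs hks
    omega
  · rintro ⟨s, ⟨⟨hs, hsr⟩, hks, hlast⟩, rfl⟩
    have hle := count_mono (A := A) k hsr
    have hcount := pullCount_pullTime hs hks
    refine ⟨⟨not_le.1 fun hle₀ => ?_, ?_⟩, ⟨s, hs, hks, rfl⟩, by omega, by omega⟩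
    · have := pullCount_mono (A := A) k hle₀
      omega
    · exact ((pullTime_le hs k).trans (pullsBefore_mono (by omega))).trans h₁

/-- The `n` observations of the block all occur in `(t₀, t₁]`, and their mean lies on the side of
the threshold `ξ` given by the sign of `lam`. -/
def BadBlock (A : ℕ → Finset (Fin K)) (x : ℕ → Fin K → ℝ) (t₀ t₁ : ℕ) (k : Fin K) (i n : ℕ)
    (lam ξ : ℝ) : Prop :=
  (blockTimes A k t₀ t₁ i n).card = n ∧ 0 ≤ ∑ t ∈ blockTimes A k t₀ t₁ i n, lam * (x t k - ξ)

variable {x : ℕ → Fin K → ℝ} {n : ℕ}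

theorem sum_lastPullRounds (hn₀ : 1 ≤ n) (hn : n ≤ count A k r) (ξ : ℝ) :
    ∑ s ∈ lastPullRounds A k r n, (x (pullTime A s k) k - ξ) =
      n * (lastBlockMean A x k r n - ξ) := by
  have hn' : (n : ℝ) ≠ 0 := by positivity
  have hmean : ∑ s ∈ lastPullRounds A k r n, x (pullTime A s k) k = n * lastBlockMean A x k r n :=
    (mul_div_cancel₀ _ hn').symm
  rw [Finset.sum_sub_distrib, Finset.sum_const, card_lastPullRounds hn, hmean, nsmul_eq_mul,
    mul_sub]

theorem badBlock_iff {lam ξ : ℝ} (hn₀ : 1 ≤ n) (h₁ : pullsBefore A (r + 1) ≤ t₁)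
    (hn : pullCount A k t₀ + n ≤ count A k r) :
    BadBlock A x t₀ t₁ k (count A k r + 1 - n - pullCount A k t₀) n lam ξ ↔
      0 ≤ lam * (lastBlockMean A x k r n - ξ) := by
  have hinj := injOn_pullTime_lastPullRounds (A := A) k r n
  rw [BadBlock, blockTimes_eq_image h₁ hn, Finset.card_image_of_injOn hinj,
    Finset.sum_image hinj, ← Finset.mul_sum, sum_lastPullRounds hn₀ (by omega),
    card_lastPullRounds (by omega), mul_left_comm]
  simp only [true_and]
  exact mul_nonneg_iff_of_pos_left (by exact_mod_cast hn₀)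

/-- In the times `(t₀, t₁]`, all blocks of arm `k` whose starting number is at most `M` and whose
length is between `n₁` and `n₂` deviate from `ξ` in the direction opposite to `lam`. -/
def GoodBlocks (A : ℕ → Finset (Fin K)) (x : ℕ → Fin K → ℝ) (t₀ t₁ : ℕ) (k : Fin K)
    (M n₁ n₂ : ℕ) (lam ξ : ℝ) : Prop :=
  ∀ i n, 1 ≤ i → i ≤ M → n₁ ≤ n → n ≤ n₂ → ¬ BadBlock A x t₀ t₁ k i n lam ξ

namespace GoodBlocks

variable {M n₁ n₂ : ℕ} {lam ξ : ℝ}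

theorem mul_neg (h : GoodBlocks A x t₀ t₁ k M n₁ n₂ lam ξ) (hn₀ : 1 ≤ n)
    (h₁ : pullsBefore A (r + 1) ≤ t₁) (hn : pullCount A k t₀ + n ≤ count A k r)
    (hM : count A k r ≤ pullCount A k t₀ + M) (hn₁ : n₁ ≤ n) (hn₂ : n ≤ n₂) :
    lam * (lastBlockMean A x k r n - ξ) < 0 := by
  have hgood := h (count A k r + 1 - n - pullCount A k t₀) n (by omega) (by omega) hn₁ hn₂
  rwa [badBlock_iff hn₀ h₁ hn, not_le] at hgood

theorem mul_neg_of_le_windowCount {τ : ℕ} (h : GoodBlocks A x t₀ t₁ k (t₁ - t₀) n₁ (t₁ - t₀) lam ξ)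
    (hn₀ : 1 ≤ n₁) (h₀ : t₀ ≤ pullsBefore A (r - τ + 1)) (h₁ : pullsBefore A (r + 1) ≤ t₁)
    (hn₁ : n₁ ≤ n) (hn : n ≤ windowCount τ A k r) : lam * (lastBlockMean A x k r n - ξ) < 0 := by
  have hwindow := pullCount_add_windowCount_le τ k h₀
  have hcount := (count_le_pullCount k h₁).trans (pullCount_le_add k t₀ t₁)
  exact h.mul_neg (hn₀.trans hn₁) h₁ (by omega) hcount hn₁ (by omega)

end GoodBlocks

variable {b : Fin K} {lam lam' ξ : Fin K → ℝ} {τ : ℕ} {l : ℕ → Fin K}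

/-- In the times `(t₀, t₁]`, the means of all blocks of at least `n` observations of an arm
`k ≠ b` and of `b` are on the right side of the threshold `ξ k`. -/
def Reliable (A : ℕ → Finset (Fin K)) (x : ℕ → Fin K → ℝ) (t₀ t₁ n : ℕ) (b : Fin K)
    (lam lam' ξ : Fin K → ℝ) : Prop :=
  ∀ k, k ≠ b → GoodBlocks A x t₀ t₁ k (t₁ - t₀) n (t₁ - t₀) (lam k) (ξ k) ∧
    GoodBlocks A x t₀ t₁ b (t₁ - t₀) n (t₁ - t₀) (lam' k) (ξ k)

theorem Reliable.bestWinsDuels (hlam : ∀ k, k ≠ b → 0 < lam k ∧ lam' k < 0)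
    (h : Reliable A x t₀ t₁ n b lam lam' ξ) (hn : 1 ≤ n) (h₀ : t₀ ≤ pullsBefore A (r - τ + 1))
    (h₁ : pullsBefore A (r + 1) ≤ t₁) : BestWinsDuels τ x l A b n r := by
  have hlow : ∀ k, k ≠ b → ∀ m, n ≤ m → m ≤ windowCount τ A k r →
      lastBlockMean A x k r m < ξ k := fun k hk m hnm hm =>
    sub_neg.1 <| neg_of_mul_neg_right ((h k hk).1.mul_neg_of_le_windowCount hn h₀ h₁ hnm hm)
      (hlam k hk).1.le
  have hhigh : ∀ k, k ≠ b → ∀ m, n ≤ m → m ≤ windowCount τ A b r →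
      ξ k < lastBlockMean A x b r m := fun k hk m hnm hm =>
    sub_pos.1 <| pos_of_mul_neg_right ((h k hk).2.mul_neg_of_le_windowCount hn h₀ h₁ hnm hm)
      (hlam k hk).2.le
  constructor
  · intro hl k hk hnk hnb hwin
    rw [WinsDuel, hl] at hwin
    exact ((hlow k hk _ hnk le_rfl).trans
      (hhigh k hk _ (le_min hnk hnb) (min_le_right _ _))).not_ge hwin
  · intro hl hnb hnl
    exact ((hlow (l r) hl _ (le_min hnb hnl) (min_le_right _ _)).trans
      (hhigh (l r) hl _ hnb le_rfl)).le

/-- The smallest number of observations with which an arm escapes forced exploration. -/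
noncomputable def duelSize (τ : ℕ) : ℕ := ⌊Real.sqrt (Real.log τ)⌋₊ + 1

theorem duelSize_le_iff {m : ℕ} : duelSize τ ≤ m ↔ Real.sqrt (Real.log τ) < m :=
  Nat.succ_le_iff.trans (Nat.floor_lt (Real.sqrt_nonneg _))

/-- Indices of the blocks which may contain the new observation of a leader winning its duel
against `b`: the triple `(k, j, m)` stands for the `m` observations of arm `k ≠ b` that end with
the `j`-th one, among `d` observations. -/
noncomputable def shortBlocks (b : Fin K) (τ d n : ℕ) : Finset (Fin K × ℕ × ℕ) :=
  (Finset.univ.erase b) ×ˢ Finset.Icc 1 d ×ˢ Finset.Icc (duelSize τ) n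

theorem mem_shortBlocks {d : ℕ} {q : Fin K × ℕ × ℕ} : q ∈ shortBlocks b τ d n ↔
    q.1 ≠ b ∧ (1 ≤ q.2.1 ∧ q.2.1 ≤ d) ∧ duelSize τ ≤ q.2.2 ∧ q.2.2 ≤ n := by
  simp [shortBlocks, Finset.mem_product]

open Classical in
/-- The indices in `shortBlocks` of the bad blocks of the times `(t₀, t₁]`. -/
noncomputable def badShortBlocks (A : ℕ → Finset (Fin K)) (x : ℕ → Fin K → ℝ) (t₀ t₁ : ℕ)
    (b : Fin K) (τ n : ℕ) (lam ξ : Fin K → ℝ) : Finset (Fin K × ℕ × ℕ) :=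
  (shortBlocks b τ (t₁ - t₀) n).filter fun q =>
    BadBlock A x t₀ t₁ q.1 (q.2.1 + 1 - q.2.2) q.2.2 (lam q.1) (ξ q.1)

theorem mem_badShortBlocks {q : Fin K × ℕ × ℕ} : q ∈ badShortBlocks A x t₀ t₁ b τ n lam ξ ↔
    (q.1 ≠ b ∧ (1 ≤ q.2.1 ∧ q.2.1 ≤ t₁ - t₀) ∧ duelSize τ ≤ q.2.2 ∧ q.2.2 ≤ n) ∧
      BadBlock A x t₀ t₁ q.1 (q.2.1 + 1 - q.2.2) q.2.2 (lam q.1) (ξ q.1) := by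
  simp only [badShortBlocks, Finset.mem_filter, mem_shortBlocks]

/-- The block that ends with the new observation of the leader at round `s` and has the length of
the window sample of `b`. -/
noncomputable def leaderBlock (τ : ℕ) (l : ℕ → Fin K) (A : ℕ → Finset (Fin K)) (b : Fin K)
    (t₀ s : ℕ) : Fin K × ℕ × ℕ :=
  (l s, count A (l s) s - pullCount A (l s) t₀, windowCount τ A b s)

theorem leaderBlock_mem_badShortBlocks {M : ℕ} (hrun : IsRun τ x l A) (hadm : Admissible K τ n)
    (hlam : ∀ k, k ≠ b → 0 < lam k ∧ lam' k < 0)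
    (hgood : ∀ k, k ≠ b → GoodBlocks A x t₀ t₁ b M (duelSize τ) n (lam' k) (ξ k)) (hτ : τ < s)
    (h₀ : t₀ ≤ pullsBefore A (s - τ + 1)) (h₁ : pullsBefore A (s + 1) ≤ t₁)
    (hM : count A b s ≤ pullCount A b t₀ + M) (hl : l s ≠ b) (hN : windowCount τ A b s < n)
    (hb : b ∉ A (s + 1)) :
    leaderBlock τ l A b t₀ s ∈ badShortBlocks A x t₀ t₁ b τ n lam ξ := by
  have hloses : b ∉ winners τ x l A s := fun hm => hb (hrun.mem_of_mem_winners (by omega) hm)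
  rw [mem_winners] at hloses
  push Not at hloses
  obtain ⟨hexplored, -, hduel⟩ := hloses hl.symm
  have hsize : duelSize τ ≤ windowCount τ A b s := duelSize_le_iff.2 hexplored
  have hpos : 1 ≤ windowCount τ A b s := (Nat.succ_pos _).trans_le hsize
  have hNl : n ≤ windowCount τ A (l s) s := hrun.le_windowCount_leader hadm hτ
  have hcount_b := pullCount_add_windowCount_le τ b h₀
  have hcount_l := pullCount_add_windowCount_le τ (l s) h₀
  have hcount_l' := (count_le_pullCount (l s) h₁).trans (pullCount_le_add (l s) t₀ t₁)
  rw [WinsDuel, min_eq_left (by omega), not_le] at hduel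
  have hhigh : ξ (l s) < lastBlockMean A x b s (windowCount τ A b s) :=
    sub_pos.1 <| pos_of_mul_neg_right
      ((hgood (l s) hl).mul_neg hpos h₁ hcount_b hM hsize hN.le) (hlam (l s) hl).2.le
  have hbad := (badBlock_iff (x := x) (lam := lam (l s)) (ξ := ξ (l s)) hpos h₁
    (show pullCount A (l s) t₀ + windowCount τ A b s ≤ count A (l s) s by omega)).2
      (mul_nonneg (hlam (l s) hl).1.le (sub_nonneg.2 (hhigh.trans hduel).le))
  rw [show count A (l s) s + 1 - windowCount τ A b s - pullCount A (l s) t₀ =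
    count A (l s) s - pullCount A (l s) t₀ + 1 - windowCount τ A b s by omega] at hbad
  have hlow : 1 ≤ count A (l s) s - pullCount A (l s) t₀ := by omega
  have hup : count A (l s) s - pullCount A (l s) t₀ ≤ t₁ - t₀ := by omega
  exact mem_badShortBlocks.2 ⟨⟨hl, ⟨hlow, hup⟩, hsize, hN.le⟩, hbad⟩

theorem injOn_leaderBlock {S : Set ℕ} (h₀ : ∀ s ∈ S, t₀ ≤ pullsBefore A (s + 1))
    (hS : ∀ s ∈ S, l s ∈ A s) : Set.InjOn (leaderBlock τ l A b t₀) S := by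
  intro s hs u hu he
  obtain ⟨hl, hcount, -⟩ : l s = l u ∧ count A (l s) s - pullCount A (l s) t₀ =
      count A (l u) u - pullCount A (l u) t₀ ∧ windowCount τ A b s = windowCount τ A b u := by
    simpa [leaderBlock] using he
  have hmem_u := hS u hu
  rw [← hl] at hcount hmem_u
  have hge_s := pullCount_le_count (l s) (h₀ s hs)
  have hge_u := pullCount_le_count (l s) (h₀ u hu)
  rcases lt_trichotomy s u with hlt | heq | hlt
  · have := count_lt_of_mem hlt hmem_u
    omega
  · exact heq
  · have := count_lt_of_mem hlt (hS s hs)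
    omega

theorem card_freshLeaderRounds_le {M y z : ℕ} (hrun : IsRun τ x l A) (hadm : Admissible K τ n)
    (hlam : ∀ k, k ≠ b → 0 < lam k ∧ lam' k < 0) (hτ : τ ≤ y)
    (hgood : ∀ k, k ≠ b → GoodBlocks A x t₀ t₁ b M (duelSize τ) n (lam' k) (ξ k))
    (h₀ : t₀ ≤ pullsBefore A (y - τ + 1)) (h₁ : pullsBefore A (z + 1) ≤ t₁)
    (hM : count A b z ≤ pullCount A b t₀ + M) (hl : ∀ s, y ≤ s → s ≤ z → l s ≠ b)
    (hN : ∀ s, y ≤ s → s ≤ z → windowCount τ A b s < n) :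
    (freshLeaderRounds l A b y z).card ≤ (badShortBlocks A x t₀ t₁ b τ n lam ξ).card := by
  refine Finset.card_le_card_of_injOn (leaderBlock τ l A b t₀) (fun s hs => ?_)
    (injOn_leaderBlock (fun s hs => ?_) fun s hs => (mem_freshLeaderRounds.1 hs).2.1)
  · obtain ⟨⟨hys, hsz⟩, -, hb⟩ := mem_freshLeaderRounds.1 hs
    exact leaderBlock_mem_badShortBlocks hrun hadm hlam hgood (by omega)
      (h₀.trans (pullsBefore_mono (by omega))) ((pullsBefore_mono (by omega)).trans h₁)
      ((count_mono b hsz).trans hM) (hl s hys.le hsz) (hN s hys.le hsz) hb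
  · have := (mem_freshLeaderRounds.1 hs).1.1
    exact h₀.trans (pullsBefore_mono (by omega))

end Times

/-! ### Locking the best arm -/

section Lock

variable {K : ℕ} {A : ℕ → Finset (Fin K)} {τ n : ℕ} {x : ℕ → Fin K → ℝ} {l : ℕ → Fin K}
  {b : Fin K} {r v t t₀ t₁ t₂ : ℕ} {lam lam' ξ : Fin K → ℝ}

/-- Arm `b` leads round `r` with so many observations in the window that it remains the leader as
long as it wins its duels. -/
def HoldsLead (τ : ℕ) (l : ℕ → Fin K) (A : ℕ → Finset (Fin K)) (b : Fin K) (r : ℕ) : Prop :=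
  l r = b ∧ 3 * (τ : ℝ) / (4 * K) ≤ windowCount τ A b r

/-- Arm `b` holds the lead at the last round completed by time `t`. -/
def LockedAt (τ : ℕ) (l : ℕ → Fin K) (A : ℕ → Finset (Fin K)) (b : Fin K) (t : ℕ) : Prop :=
  ∃ r, 1 ≤ r ∧ pullsBefore A (r + 1) ≤ t ∧ t < pullsBefore A (r + 2) ∧ HoldsLead τ l A b r

open Classical in
/-- The times in `(t, u]` at which an arm other than `b` is pulled. -/
noncomputable def otherArmTimes (A : ℕ → Finset (Fin K)) (b : Fin K) (t u : ℕ) : Finset ℕ :=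
  (Finset.Ioc t u).filter fun s => ∃ k, k ≠ b ∧ PulledAt A s k

theorem card_otherArmTimes_le {u c : ℕ} (hr : pullsBefore A (r + 1) ≤ t)
    (hv : u < pullsBefore A (v + 2)) (hc : ∀ k, k ≠ b → pulls A k r (v + 1) ≤ c) :
    (otherArmTimes A b t u).card ≤ K * c := by
  have hsub : otherArmTimes A b t u ⊆ (Finset.univ.erase b).biUnion fun k =>
      ((Finset.Ioc r (v + 1)).filter fun s => k ∈ A s).image fun s => pullTime A s k := by
    intro u' hu'
    simp only [otherArmTimes, Finset.mem_filter, Finset.mem_Ioc] at hu'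
    obtain ⟨⟨htu, huu⟩, k, hkb, s, hs, hks, rfl⟩ := hu'
    refine Finset.mem_biUnion.2 ⟨k, by simpa using hkb, Finset.mem_image.2 ⟨s, ?_, rfl⟩⟩
    refine Finset.mem_filter.2 ⟨Finset.mem_Ioc.2 ⟨?_, ?_⟩, hks⟩
    · by_contra! hsr
      exact (((pullTime_le hs k).trans (pullsBefore_mono (by omega))).trans hr).not_gt htu
    · by_contra! hvs
      have := pullsBefore_mono (A := A) (show v + 2 ≤ s by omega)
      have := pullsBefore_lt_pullTime hks
      omega
  calc (otherArmTimes A b t u).card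
      ≤ ((Finset.univ.erase b).biUnion fun k =>
          ((Finset.Ioc r (v + 1)).filter fun s => k ∈ A s).image fun s => pullTime A s k).card :=
        Finset.card_le_card hsub
    _ ≤ (Finset.univ.erase b).card * c := Finset.card_biUnion_le_card_mul _ _ _ fun k hk =>
        Finset.card_image_le.trans (hc k (Finset.ne_of_mem_erase hk))
    _ ≤ K * c := Nat.mul_le_mul_right _ (card_finset_fin_le _)

theorem round_lt_add {u m : ℕ} (hA : ∀ s, 1 ≤ s → (A s).Nonempty) (hr : t < pullsBefore A (r + 2))
    (hv : pullsBefore A (v + 1) ≤ u) (htu : t ≤ u) (hm : u < t + m) : v < r + m := by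
  by_contra! hlt
  have := add_pullsBefore_le hA (r := r + 2) (by omega) (m - 1)
  have := pullsBefore_mono (A := A) (show r + 2 + (m - 1) ≤ v + 1 by omega)
  omega

theorem count_le_add_windowCount {k : Fin K} {y z : ℕ} (hry : r ≤ y) (hy : y ≤ r + 1 + τ)
    (hyz : y ≤ z) (hz : z ≤ y + τ) :
    count A k z ≤ count A k r + 1 + windowCount τ A k y + windowCount τ A k z := by
  have hry' : pulls A k r y ≤ windowCount τ A k y + 1 := by
    rcases hry.eq_or_lt with rfl | hlt
    · simp [pulls_self]
    · have hsplit := pulls_add (A := A) (y := r + 1) (z := y) k (Nat.le_succ r) hlt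
      have hone := pulls_le (A := A) k r (r + 1)
      have hrest := pulls_le_windowCount (A := A) (τ := τ) k (x := r + 1) (y := y) hy
      omega
  have hyz' := pulls_le_windowCount (A := A) (τ := τ) k hz
  have hr := pulls_add (A := A) k (Nat.zero_le r) hry
  have hy := pulls_add (A := A) k (Nat.zero_le y) hyz
  simp only [count_eq_pulls]
  omega

namespace IsRun

variable (h : IsRun τ x l A) (ha : Admissible K τ n)
include h ha

theorem holdsLead_add (hr : τ < r) (hrv : r + τ ≤ v)
    (hs : ∀ s, r ≤ s → s < v → BestWinsDuels τ x l A b n s) (hl : HoldsLead τ l A b r) :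
    HoldsLead τ l A b v := by
  have hlead := fun s => h.leader_persists ha (s := s) hr hs hl.1 hl.2
  have hloss : (τ : ℝ) ≤ windowCount τ A b v + ((K - 1) * (logSqFloor τ + 1) : ℕ) := by
    exact_mod_cast h.window_le_windowCount_add ha hr hrv hs fun s hrs hsv => hlead s hrs hsv.le
  have hK := ha.two_le_cast
  have hsplit : 3 * (τ : ℝ) / (4 * K) + τ / (4 * K) = τ / K := by field_simp; ring
  have hdiv : (τ : ℝ) / K ≤ τ := div_le_self (by positivity) (by linarith)
  exact ⟨hlead v (by omega) le_rfl, by linarith [ha.mul_logSqFloor_le]⟩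

theorem holdsLead_of_leadsAt (hr : τ < r) (hrv : r ≤ v)
    (hs : ∀ s, r ≤ s → s < v → BestWinsDuels τ x l A b n s) (hl : LeadsAt τ l A b r) :
    HoldsLead τ l A b v := by
  have hsplit : 3 * (τ : ℝ) / (4 * K) + τ / (4 * K) = τ / K := by field_simp; ring
  have hnonneg : (0 : ℝ) ≤ τ / (4 * K) := by positivity
  have hlead := fun s => h.leader_persists ha (s := s) hr hs hl.1 (by linarith [hl.2])
  have hloss : (windowCount τ A b r : ℝ) ≤
      windowCount τ A b v + ((K - 1) * (logSqFloor τ + 1) : ℕ) := by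
    exact_mod_cast h.windowCount_le_windowCount_add ha hr hrv hs fun s hrs hsv => hlead s hrs hsv.le
  exact ⟨hlead v hrv le_rfl, by linarith [ha.mul_logSqFloor_le, hl.2]⟩

theorem leader_ne_of_not_holdsLead (hr : τ < r) (hrv : r + τ ≤ v)
    (hs : ∀ s, r ≤ s → s ≤ v → BestWinsDuels τ x l A b n s) (hno : ¬ HoldsLead τ l A b v) {s : ℕ}
    (hrs : r + τ ≤ s) (hsv : s ≤ v) : l s ≠ b := by
  have hnever : ∀ s, r ≤ s → s ≤ v → ¬ LeadsAt τ l A b s := fun s hrs hsv hl =>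
    hno (h.holdsLead_of_leadsAt ha (by omega) hsv
      (fun u hsu huv => hs u (by omega) huv.le) hl)
  obtain ⟨r', hrr', hr'τ, hl⟩ := h.exists_leader_ne ha hr
    (fun s hrs hsr => hs s hrs (by omega)) (fun s hrs hsr => hnever s hrs (by omega))
  exact h.leader_ne_of_not_leadsAt (by omega) (by omega) hl
    (fun s hrs hsv => hnever s (by omega) hsv) (by omega) hsv

end IsRun

theorem LockedAt.of_reliable (h : IsRun τ x l A) (ha : Admissible K τ n) (hn : 1 ≤ n)
    (hlam : ∀ k, k ≠ b → 0 < lam k ∧ lam' k < 0) (hrel : Reliable A x t₀ t₂ n b lam lam' ξ)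
    (ht₁ : t₀ + 3 * τ * K ≤ t₁) (ht₂ : t₁ + 3 * τ * K ≤ t₂) (hlock : LockedAt τ l A b t₁) :
    LockedAt τ l A b t₂ ∧ ∀ m : ℕ, t₂ < t₁ + m * τ →
      (otherArmTimes A b t₁ t₂).card ≤ K * (m * (n + 1)) := by
  obtain ⟨r, hr, hr₁, hr₁', hlead⟩ := hlock
  have hA : ∀ r, 1 ≤ r → (A r).Nonempty := fun r => h.nonempty
  have hτ := ha.add_sixteen_le
  have hL := ha.flagLength_le
  have hKτ : K ≤ 3 * τ * K := Nat.le_mul_of_pos_left _ (by omega)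
  obtain ⟨v, hv, hv₂, hv₂'⟩ := exists_round hA (t := t₂) (by omega)
  have hrv := round_add_le hr₁ hv₂' ht₂
  obtain ⟨hr3, ht₀⟩ := le_pullsBefore_sub (d := 3 * τ - 1) hr₁'
    (by rwa [show 3 * τ - 1 + 1 = 3 * τ by omega])
  have hwins : ∀ s, r ≤ s + flagLength K τ → s ≤ v → BestWinsDuels τ x l A b n s :=
    fun s hrs hsv => hrel.bestWinsDuels hlam hn (ht₀.trans (pullsBefore_mono (by omega)))
      ((pullsBefore_mono (by omega)).trans hv₂)
  have hbest : ∀ s, r ≤ s → s ≤ v → l s = b := fun s => h.leader_persists ha (by omega)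
    (fun s hrs hsv => hwins s (by omega) hsv.le) hlead.1 hlead.2
  refine ⟨⟨v, hv, hv₂, hv₂', h.holdsLead_add ha (by omega) (by omega)
    (fun s hrs hsv => hwins s (by omega) hsv.le) hlead⟩, fun m hm => ?_⟩
  have hlen : v + 1 ≤ r + m * τ := round_lt_add hA hr₁' hv₂ (by omega) hm
  refine card_otherArmTimes_le hr₁ hv₂' fun k hk =>
    pulls_le_mul_of_windowCount_le (by omega) hlen fun s hrs hsv hkA => ?_
  exact h.windowCount_le_of_best_leader ha (by omega)
    (fun u hsu hus => hwins u (by omega) (by omega)) (hbest s hrs (by omega)) hk hkA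

theorem lockedAt_of_reliable {m : ℕ} (h : IsRun τ x l A) (ha : Admissible K τ n) (hn : 1 ≤ n)
    (hlam : ∀ k, k ≠ b → 0 < lam k ∧ lam' k < 0) (hrel : Reliable A x t₀ t₂ n b lam lam' ξ)
    (ht₀ : K ≤ t₀) (ht₁ : t₀ + 4 * τ * K ≤ t₁) (ht₂ : t₁ + 6 * τ * K ≤ t₂)
    (hgood : ∀ k, k ≠ b → GoodBlocks A x t₁ t₂ b (2 * n) (duelSize τ) n (lam' k) (ξ k))
    (hm : ((m * (flagLength K τ + 1) : ℕ) : ℝ) ≤ τ / (2 * K))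
    (hbad : n + 1 + (badShortBlocks A x t₁ t₂ b τ n lam ξ).card < m) : LockedAt τ l A b t₂ := by
  have hA : ∀ r, 1 ≤ r → (A r).Nonempty := fun r => h.nonempty
  have hτ := ha.add_sixteen_le
  have hL := ha.flagLength_le
  have hK := ha.two_le_cast
  obtain ⟨r₀, hr₀, hr₀t, hr₀t'⟩ := exists_round hA ht₀
  obtain ⟨r₁, hr₁, hr₁t, hr₁t'⟩ := exists_round hA (t := t₁) (by omega)
  obtain ⟨v, hv, hvt, hvt'⟩ := exists_round hA (t := t₂) (by omega)
  have hr₀₁ := round_add_le hr₀t hr₁t' ht₁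
  have hr₁v := round_add_le hr₁t hvt' ht₂
  have hmτ : m * (flagLength K τ + 1) ≤ τ := by
    exact_mod_cast hm.trans (div_le_self (by positivity) (by linarith))
  have hwins : ∀ s, r₀ + 1 + τ ≤ s → s ≤ v → BestWinsDuels τ x l A b n s := fun s hrs hsv =>
    hrel.bestWinsDuels hlam hn (hr₀t'.le.trans (pullsBefore_mono (by omega)))
      ((pullsBefore_mono (by omega)).trans hvt)
  by_contra hlock
  have hne : ∀ s, r₀ + 1 + τ + τ ≤ s → s ≤ v → l s ≠ b := fun s =>
    h.leader_ne_of_not_holdsLead ha (by omega) (by omega) hwins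
      fun hlead => hlock ⟨v, hv, hvt, hvt', hlead⟩
  have hN : ∀ s, r₀ + 1 + τ + τ ≤ s → s + τ + K + 1 ≤ v → windowCount τ A b s < n :=
    fun s hrs => h.windowCount_lt_of_leader_ne ha (by omega)
      (fun u hsu huv => hwins u (by omega) huv) (fun u hsu huv => hne u (by omega) huv)
  set y := r₁ + 1 + τ
  obtain ⟨z, hz⟩ : ∃ z, z = y + m * (flagLength K τ + 1) := ⟨_, rfl⟩
  have hmany := h.le_card_freshLeaderRounds ha (b := b) (y := y) (by omega) hm
    (fun s hys hsz => hne s (by omega) (by omega)) (fun s hys hsz => hN s (by omega) (by omega))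
  rw [← hz] at hmany
  have hM : count A b z ≤ pullCount A b t₁ + 2 * n := by
    have hcount := count_le_add_windowCount (A := A) (τ := τ) (k := b) (r := r₁) (y := y) (z := z)
      (by omega) le_rfl (by omega) (by omega)
    have hstart := count_le_pullCount (A := A) b hr₁t
    have hNy := hN y (by omega) (by omega)
    have hNz := hN z (by omega) (by omega)
    omega
  have hfew := card_freshLeaderRounds_le (y := y) (z := z) h ha hlam (by omega) hgood
    (hr₁t'.le.trans (pullsBefore_mono (by omega))) ((pullsBefore_mono (by omega)).trans hvt) hM
    (fun s hys hsz => hne s (by omega) (by omega)) (fun s hys hsz => hN s (by omega) (by omega))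
  omega

end Lock

/-! ### Deviations of predictably selected observations -/

section Deviation

variable {Ω : Type*} [mΩ : MeasurableSpace Ω] {P : Measure Ω}

theorem ChernoffBound.lintegral_exp_add_le_one {p : Measure ℝ} {ω lam ξ : ℝ}
    (h : ChernoffBound p ω lam ξ) :
    ∫⁻ y, ENNReal.ofReal (Real.exp (lam * (y - ξ) + ω)) ∂p ≤ 1 := by
  have hfactor (y : ℝ) : ENNReal.ofReal (Real.exp (lam * (y - ξ) + ω)) =
      ENNReal.ofReal (Real.exp ω) * ENNReal.ofReal (Real.exp (lam * (y - ξ))) := by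
    rw [← ENNReal.ofReal_mul (Real.exp_pos _).le, ← Real.exp_add, add_comm]
  calc ∫⁻ y, ENNReal.ofReal (Real.exp (lam * (y - ξ) + ω)) ∂p
      = ENNReal.ofReal (Real.exp ω) * ∫⁻ y, ENNReal.ofReal (Real.exp (lam * (y - ξ))) ∂p := by
        rw [lintegral_congr hfactor, lintegral_const_mul _ (by fun_prop)]
    _ ≤ ENNReal.ofReal (Real.exp ω) * ENNReal.ofReal (Real.exp (-ω)) := by
        gcongr
        exact h
    _ = 1 := by simp [← ENNReal.ofReal_mul (Real.exp_pos _).le, ← Real.exp_add]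

open Classical in
theorem lintegral_ite_mul_le_of_indep {Ω : Type*} {m₁ m₂ : MeasurableSpace Ω}
    [mΩ : MeasurableSpace Ω] {P : Measure Ω} (hm₁ : m₁ ≤ mΩ) (hm₂ : m₂ ≤ mΩ)
    (hind : Indep m₁ m₂ P) {f g : Ω → ENNReal} (hg : Measurable[m₁] g) (hf : Measurable[m₂] f)
    {H : Set Ω} (hH : MeasurableSet[m₂] H) (hle : ∫⁻ w, g w ∂P ≤ 1) :
    ∫⁻ w, (if w ∈ H then g w else 1) * f w ∂P ≤ ∫⁻ w, f w ∂P := by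
  have hsplit (w : Ω) : (if w ∈ H then g w else 1) * f w =
      Hᶜ.indicator f w + g w * H.indicator f w := by
    by_cases hw : w ∈ H <;> simp [hw]
  have hmeas : Measurable (Hᶜ.indicator f) := (hf.indicator hH.compl).mono hm₂ le_rfl
  calc ∫⁻ w, (if w ∈ H then g w else 1) * f w ∂P
      = ∫⁻ w, Hᶜ.indicator f w ∂P + (∫⁻ w, g w ∂P) * ∫⁻ w, H.indicator f w ∂P := by
        rw [lintegral_congr hsplit, lintegral_add_left hmeas,
          lintegral_mul_eq_lintegral_mul_lintegral_of_independent_measurableSpace hm₁ hm₂ hind hg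
            (hf.indicator hH)]
    _ ≤ ∫⁻ w, Hᶜ.indicator f w ∂P + 1 * ∫⁻ w, H.indicator f w ∂P := by gcongr
    _ = ∫⁻ w, f w ∂P := by
        rw [one_mul, ← lintegral_add_left hmeas]
        exact lintegral_congr fun w => congrFun (Set.indicator_compl_add_self H f) w

open Classical in
/-- The factor of an exponential supermartingale contributed by the observation `Y t`, which counts
only on the event `H t` that it is selected. -/
noncomputable def chernoffFactor (ω lam ξ : ℝ) (Y : ℕ → Ω → ℝ) (H : ℕ → Set Ω) (t : ℕ) (w : Ω) :
    ENNReal :=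
  if w ∈ H t then ENNReal.ofReal (Real.exp (lam * (Y t w - ξ) + ω)) else 1

variable {ℱ : Filtration ℕ mΩ} {Y : ℕ → Ω → ℝ} {p : ℕ → Measure ℝ} {ω lam ξ : ℝ} {t₀ t₁ n : ℕ}
  {H : ℕ → Set Ω} {G : Set Ω}

theorem measurable_chernoffFactor {t u : ℕ} (hY : Measurable[ℱ t] (Y t))
    (hH : MeasurableSet[ℱ (t - 1)] (H t)) (htu : t ≤ u) :
    Measurable[ℱ u] (chernoffFactor ω lam ξ Y H t) := by
  have hφ : Measurable fun y : ℝ => ENNReal.ofReal (Real.exp (lam * (y - ξ) + ω)) := by fun_prop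
  exact Measurable.ite (ℱ.mono (by omega) _ hH) (hφ.comp (hY.mono (ℱ.mono htu) le_rfl))
    measurable_const

theorem lintegral_indicator_prod_chernoffFactor_le
    (hY : ∀ t, t₀ < t → t ≤ t₁ → Measurable[ℱ t] (Y t))
    (hlaw : ∀ t, t₀ < t → t ≤ t₁ → P.map (Y t) = p t)
    (hind : ∀ t, t₀ < t → t ≤ t₁ →
      Indep (MeasurableSpace.comap (Y t) inferInstance) (ℱ (t - 1)) P)
    (hexp : ∀ t, t₀ < t → t ≤ t₁ → ChernoffBound (p t) ω lam ξ)
    (hH : ∀ t, t₀ < t → t ≤ t₁ → MeasurableSet[ℱ (t - 1)] (H t)) (hG : MeasurableSet[ℱ t₀] G)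
    {u : ℕ} (hu : t₀ ≤ u) (hut : u ≤ t₁) :
    ∫⁻ w, (∏ t ∈ Finset.Ioc t₀ u, chernoffFactor ω lam ξ Y H t w) * G.indicator 1 w ∂P ≤ P G := by
  induction u, hu using Nat.le_induction with
  | base => simp [lintegral_indicator_one (ℱ.le t₀ _ hG)]
  | succ u hu ih =>
    have hYu := hY (u + 1) (by omega) hut
    have hYm : Measurable (Y (u + 1)) := hYu.mono (ℱ.le _) le_rfl
    have hφ : Measurable fun y : ℝ => ENNReal.ofReal (Real.exp (lam * (y - ξ) + ω)) := by fun_prop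
    have hone : ∫⁻ w, ENNReal.ofReal (Real.exp (lam * (Y (u + 1) w - ξ) + ω)) ∂P ≤ 1 := by
      rw [← lintegral_map hφ hYm, hlaw (u + 1) (by omega) hut]
      exact (hexp (u + 1) (by omega) hut).lintegral_exp_add_le_one
    have hpast : Measurable[ℱ u] fun w =>
        (∏ t ∈ Finset.Ioc t₀ u, chernoffFactor ω lam ξ Y H t w) * G.indicator 1 w := by
      refine Measurable.mul (Finset.measurable_prod _ fun t ht => ?_)
        (measurable_const.indicator (ℱ.mono hu _ hG))
      obtain ⟨htt, htu⟩ := Finset.mem_Ioc.1 ht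
      exact measurable_chernoffFactor (hY t htt (by omega)) (hH t htt (by omega)) htu
    refine le_trans (le_of_eq ?_) ((lintegral_ite_mul_le_of_indep hYm.comap_le (ℱ.le u)
      (hind (u + 1) (by omega) hut) (hφ.comp (comap_measurable _)) hpast
      (hH (u + 1) (by omega) hut) hone).trans (ih (by omega)))
    simp only [← Finset.insert_Ioc_right_eq_Ioc_add_one hu]
    refine lintegral_congr fun w => ?_
    rw [Finset.prod_insert (by simp), mul_assoc]
    rfl

open Classical in
theorem measureReal_selected_le [IsFiniteMeasure P]
    (hY : ∀ t, t₀ < t → t ≤ t₁ → Measurable[ℱ t] (Y t))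
    (hlaw : ∀ t, t₀ < t → t ≤ t₁ → P.map (Y t) = p t)
    (hind : ∀ t, t₀ < t → t ≤ t₁ →
      Indep (MeasurableSpace.comap (Y t) inferInstance) (ℱ (t - 1)) P)
    (hexp : ∀ t, t₀ < t → t ≤ t₁ → ChernoffBound (p t) ω lam ξ)
    (hH : ∀ t, t₀ < t → t ≤ t₁ → MeasurableSet[ℱ (t - 1)] (H t)) (hG : MeasurableSet[ℱ t₀] G)
    (ht : t₀ ≤ t₁) :
    P.real (G ∩ {w | ((Finset.Ioc t₀ t₁).filter fun t => w ∈ H t).card = n ∧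
      0 ≤ ∑ t ∈ (Finset.Ioc t₀ t₁).filter (fun t => w ∈ H t), lam * (Y t w - ξ)}) ≤
      Real.exp (-(n * ω)) * P.real G := by
  set f : Ω → ENNReal := fun w =>
    (∏ t ∈ Finset.Ioc t₀ t₁, chernoffFactor ω lam ξ Y H t w) * G.indicator 1 w with hf
  have hfm : AEMeasurable f P := by
    refine (Measurable.mul (Finset.measurable_prod _ fun t ht => ?_)
      (measurable_one.indicator (ℱ.le t₀ _ hG))).aemeasurable
    obtain ⟨htt, htu⟩ := Finset.mem_Ioc.1 ht
    exact (measurable_chernoffFactor (hY t htt htu) (hH t htt htu) htu).mono (ℱ.le _) le_rfl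
  have hlarge : G ∩ {w | ((Finset.Ioc t₀ t₁).filter fun t => w ∈ H t).card = n ∧
      0 ≤ ∑ t ∈ (Finset.Ioc t₀ t₁).filter (fun t => w ∈ H t), lam * (Y t w - ξ)} ⊆
      {w | ENNReal.ofReal (Real.exp (n * ω)) ≤ f w} := by
    rintro w ⟨hwG, hcard, hsum⟩
    have hfw : f w = ENNReal.ofReal (Real.exp
        (∑ t ∈ (Finset.Ioc t₀ t₁).filter (fun t => w ∈ H t), lam * (Y t w - ξ) + n * ω)) := by
      simp only [hf, chernoffFactor, Set.indicator_of_mem hwG, Pi.one_apply, mul_one]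
      rw [← Finset.prod_filter, ← ENNReal.ofReal_prod_of_nonneg fun _ _ => (Real.exp_pos _).le,
        ← Real.exp_sum, Finset.sum_add_distrib, Finset.sum_const, hcard, nsmul_eq_mul]
    rw [Set.mem_ofPred_eq, hfw]
    exact ENNReal.ofReal_le_ofReal (Real.exp_le_exp.2 (by linarith))
  have hmarkov : P {w | ENNReal.ofReal (Real.exp (n * ω)) ≤ f w} ≤
      ENNReal.ofReal (Real.exp (-(n * ω))) * P G := by
    refine (meas_ge_le_lintegral_div hfm (by simp [Real.exp_pos]) ENNReal.ofReal_ne_top).trans ?_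
    rw [ENNReal.div_eq_inv_mul, Real.exp_neg, ENNReal.ofReal_inv_of_pos (Real.exp_pos _)]
    gcongr
    exact lintegral_indicator_prod_chernoffFactor_le hY hlaw hind hexp hH hG ht le_rfl
  have hreal := ENNReal.toReal_mono (ENNReal.mul_ne_top ENNReal.ofReal_ne_top (measure_ne_top P G))
    ((measure_mono hlarge).trans hmarkov)
  rwa [ENNReal.toReal_mul, ENNReal.toReal_ofReal (Real.exp_pos _).le] at hreal

variable {ι : Type*} [IsFiniteMeasure P]

theorem integrable_sum_indicator_toMeasurable (Q : Finset ι) (B : ι → Set Ω) :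
    Integrable (fun w => ∑ q ∈ Q, (toMeasurable P (B q)).indicator (fun _ => (1 : ℝ)) w) P :=
  integrable_finsetSum _ fun _ _ =>
    (integrable_const 1).indicator (measurableSet_toMeasurable _ _)

theorem integral_sum_indicator_toMeasurable (Q : Finset ι) (B : ι → Set Ω) :
    ∫ w, ∑ q ∈ Q, (toMeasurable P (B q)).indicator (fun _ => (1 : ℝ)) w ∂P =
      ∑ q ∈ Q, P.real (B q) := by
  rw [integral_finsetSum _ fun q _ =>
    (integrable_const 1).indicator (measurableSet_toMeasurable _ _)]
  refine Finset.sum_congr rfl fun q _ => ?_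
  rw [integral_indicator_const _ (measurableSet_toMeasurable _ _), smul_eq_mul, mul_one,
    Measure.real, measure_toMeasurable, Measure.real]

theorem mul_measureReal_le_sum (Q : Finset ι) (B : ι → Set Ω) {c : ℝ} (hc : 0 ≤ c) {S : Set Ω}
    (hS : ∀ w ∈ S, c ≤ ∑ q ∈ Q, (B q).indicator (fun _ => (1 : ℝ)) w) :
    c * P.real S ≤ ∑ q ∈ Q, P.real (B q) := by
  have hsub : S ⊆ {w | c ≤ ∑ q ∈ Q, (toMeasurable P (B q)).indicator (fun _ => (1 : ℝ)) w} :=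
    fun w hw => (hS w hw).trans <| Finset.sum_le_sum fun q _ =>
      Set.indicator_le_indicator_of_subset (subset_toMeasurable P (B q)) (fun _ => zero_le_one) w
  rw [← integral_sum_indicator_toMeasurable]
  refine (mul_le_mul_of_nonneg_left (measureReal_mono hsub) hc).trans
    (mul_meas_ge_le_integral_of_nonneg (.of_forall fun w => Finset.sum_nonneg fun q _ =>
      Set.indicator_nonneg (fun _ _ => zero_le_one) w)
      (integrable_sum_indicator_toMeasurable Q B) c)

end Deviation

/-! ### The information available at a given time -/

section History

variable {K : ℕ} {Ω : Type*} {l : Ω → ℕ → Fin K} {A : Ω → ℕ → Finset (Fin K)} {t : ℕ} {w w' : Ω}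

/-- The rounds completed by time `t` went the same way in `w` and `w'`. -/
def Agree (l : Ω → ℕ → Fin K) (A : Ω → ℕ → Finset (Fin K)) (t : ℕ) (w w' : Ω) : Prop :=
  ∀ r, 1 ≤ r → (pullsBefore (A w) (r + 1) ≤ t ↔ pullsBefore (A w') (r + 1) ≤ t) ∧
    (pullsBefore (A w) (r + 1) ≤ t → l w r = l w' r ∧ A w (r + 1) = A w' (r + 1))

theorem Agree.symm (h : Agree l A t w w') : Agree l A t w' w := fun r hr =>
  ⟨(h r hr).1.symm, fun hrt =>
    ⟨((h r hr).2 ((h r hr).1.2 hrt)).1.symm, ((h r hr).2 ((h r hr).1.2 hrt)).2.symm⟩⟩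

open Classical in
/-- The leader and the selection of each of the rounds `1, …, t`, as far as the round is completed
by time `t`. A round takes at least one time step, so that no other round is completed by then. -/
noncomputable def history (l : Ω → ℕ → Fin K) (A : Ω → ℕ → Finset (Fin K)) (t : ℕ) (w : Ω)
    (i : Fin t) : Option (Fin K × Finset (Fin K)) :=
  if pullsBefore (A w) (i + 2) ≤ t then some (l w (i + 1), A w (i + 2)) else none

theorem history_eq_some_iff {i : Fin t} {q : Fin K × Finset (Fin K)} :
    history l A t w i = some q ↔
      pullsBefore (A w) (i + 2) ≤ t ∧ l w (i + 1) = q.1 ∧ A w (i + 2) = q.2 := by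
  unfold history
  split_ifs with hi <;> simp [hi, Prod.ext_iff]

theorem Agree.of_history_eq (hA : ∀ w r, 1 ≤ r → (A w r).Nonempty)
    (h : history l A t w = history l A t w') : Agree l A t w w' := by
  intro r hr
  by_cases hrt : r ≤ t
  · obtain ⟨i, rfl⟩ : ∃ i, r = i + 1 := ⟨r - 1, by omega⟩
    have hi := congrFun h ⟨i, by omega⟩
    simp only [history] at hi
    split_ifs at hi with hw hw' hw'
    · simp only [Option.some.injEq, Prod.mk.injEq] at hi
      exact ⟨iff_of_true hw hw', fun _ => hi⟩
    · exact ⟨iff_of_false hw hw', fun hlt => absurd hlt hw⟩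
  · have hlate (w : Ω) : ¬ pullsBefore (A w) (r + 1) ≤ t := by
      have := add_pullsBefore_le (hA w) le_rfl r
      rw [add_comm 1 r] at this
      omega
    exact ⟨iff_of_false (hlate w) (hlate w'), fun hlt => absurd hlt (hlate w)⟩

variable [mΩ : MeasurableSpace Ω] {P : Measure Ω} {ℱ : Filtration ℕ mΩ}
  {X : ℕ → Fin K → Ω → ℝ} {τ : ℕ}

namespace IsPolicyRun

variable (h : IsPolicyRun P ℱ X τ l A)
include h

theorem measurableSet_history_eq_some (i : Fin t) (q : Fin K × Finset (Fin K)) :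
    MeasurableSet[ℱ t] {w | history l A t w i = some q} := by
  have hunion : {w | history l A t w i = some q} = ⋃ u ∈ Finset.range (t + 1),
      {w | pullsBefore (A w) (i + 2) = u ∧ l w (i + 1) = q.1 ∧ A w (i + 2) = q.2} := by
    ext w
    simp [history_eq_some_iff, and_left_comm]
  rw [hunion]
  exact Finset.measurableSet_biUnion _ fun u hu =>
    ℱ.mono (Nat.le_of_lt_succ (Finset.mem_range.1 hu)) _
      (h.nonanticipating (i + 1) u (by omega) q.1 q.2)

theorem measurableSet_history_eq (c : Fin t → Option (Fin K × Finset (Fin K))) :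
    MeasurableSet[ℱ t] {w | history l A t w = c} := by
  have hcoord (i : Fin t) (o : Option (Fin K × Finset (Fin K))) :
      MeasurableSet[ℱ t] {w | history l A t w i = o} := by
    cases o with
    | some q => exact h.measurableSet_history_eq_some i q
    | none =>
      have hcompl : {w | history l A t w i = none} = (⋃ q, {w | history l A t w i = some q})ᶜ := by
        ext w
        simp [Option.eq_none_iff_forall_ne_some]
      rw [hcompl]
      exact (MeasurableSet.iUnion fun q => h.measurableSet_history_eq_some i q).compl
  simp only [funext_iff, Set.ofPred_forall]
  exact MeasurableSet.iInter fun i => hcoord i (c i)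

theorem measurableSet_of_agree {S : Set Ω} (hS : ∀ w w', Agree l A t w w' → w ∈ S → w' ∈ S) :
    MeasurableSet[ℱ t] S := by
  have hA : ∀ w r, 1 ≤ r → (A w r).Nonempty := fun w _ => (h.isRun w).nonempty
  have hunion : S = ⋃ c ∈ history l A t '' S, {w | history l A t w = c} := by
    ext w
    simp only [Set.mem_iUnion, Set.mem_ofPred_eq, exists_prop]
    constructor
    · exact fun hw => ⟨_, ⟨w, hw, rfl⟩, rfl⟩
    · rintro ⟨_, ⟨w', hw', rfl⟩, hc⟩
      exact hS w' w (.of_history_eq hA hc.symm) hw'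
  rw [hunion]
  exact MeasurableSet.biUnion (Set.toFinite _).countable fun c _ => h.measurableSet_history_eq c

end IsPolicyRun

namespace Agree

variable (h : IsPolicyRun P ℱ X τ l A) (hag : Agree l A t w w')
include h hag

theorem arms_eq {s u : ℕ} (hs : pullsBefore (A w) s ≤ t) (hu : 1 ≤ u) (hus : u ≤ s) :
    A w u = A w' u := by
  obtain ⟨u, rfl⟩ : ∃ v, u = v + 1 := ⟨u - 1, by omega⟩
  rcases Nat.eq_zero_or_pos u with rfl | hpos
  · rw [(h.isRun w).first_round, (h.isRun w').first_round]
  · exact ((hag u hpos).2 ((pullsBefore_mono hus).trans hs)).2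

theorem pullsBefore_eq {s u : ℕ} (hs : pullsBefore (A w) s ≤ t) (hus : u ≤ s + 1) :
    pullsBefore (A w) u = pullsBefore (A w') u :=
  Finset.sum_congr rfl fun v hv => by
    obtain ⟨hv, hvu⟩ := Finset.mem_Ico.1 hv
    rw [hag.arms_eq h hs hv (by omega)]

theorem pulledAt {u : ℕ} {k : Fin K} (hu : u ≤ t + 1) (hk : PulledAt (A w) u k) :
    PulledAt (A w') u k := by
  obtain ⟨r, hr, hkr, rfl⟩ := hk
  have hrt : pullsBefore (A w) r ≤ t := by
    have := pullsBefore_lt_pullTime hkr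
    omega
  have harms := hag.arms_eq h hrt hr le_rfl
  exact ⟨r, hr, harms ▸ hkr, by rw [pullTime, pullTime, hag.pullsBefore_eq h hrt (by omega), harms]⟩

theorem pulledAt_iff {u : ℕ} {k : Fin K} (hu : u ≤ t + 1) :
    PulledAt (A w) u k ↔ PulledAt (A w') u k :=
  ⟨hag.pulledAt h hu, hag.symm.pulledAt h hu⟩

theorem pullCount_eq {u : ℕ} (k : Fin K) (hu : u ≤ t + 1) :
    pullCount (A w) k u = pullCount (A w') k u := by
  classical
  exact congrArg Finset.card <| Finset.filter_congr fun s hs =>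
    hag.pulledAt_iff h ((Finset.mem_Icc.1 hs).2.trans hu)

theorem windowCount_eq {r : ℕ} (k : Fin K) (hr : pullsBefore (A w) r ≤ t) :
    windowCount τ (A w) k r = windowCount τ (A w') k r := by
  classical
  refine congrArg Finset.card <| Finset.filter_congr fun s hs => ?_
  obtain ⟨hs, hsr⟩ := Finset.mem_Icc.1 hs
  rw [hag.arms_eq h hr (by omega) hsr]

theorem lockedAt {b : Fin K} (hl : LockedAt τ (l w) (A w) b t) :
    LockedAt τ (l w') (A w') b t := by
  obtain ⟨r, hr, hrt, hrt', hlead, hcount⟩ := hl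
  refine ⟨r, hr, (hag r hr).1.1 hrt, ?_, ((hag r hr).2 hrt).1 ▸ hlead, ?_⟩
  · rwa [← hag.pullsBefore_eq h hrt le_rfl]
  · rwa [← hag.windowCount_eq h b ((pullsBefore_mono r.le_succ).trans hrt)]

end Agree

theorem IsPolicyRun.measurableSet_lockedAt (h : IsPolicyRun P ℱ X τ l A) (b : Fin K) (t : ℕ) :
    MeasurableSet[ℱ t] {w | LockedAt τ (l w) (A w) b t} :=
  h.measurableSet_of_agree fun _ _ hag hw => hag.lockedAt h hw

theorem IsPolicyRun.measurableSet_mem_blockTimes (h : IsPolicyRun P ℱ X τ l A) (k : Fin K)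
    {t₀ t₁ i n : ℕ} (ht : t₀ < t) :
    MeasurableSet[ℱ (t - 1)] {w | t ∈ blockTimes (A w) k t₀ t₁ i n} := by
  refine h.measurableSet_of_agree fun w w' hag hw => ?_
  simp only [blockTimes, Set.mem_ofPred_eq, Finset.mem_filter] at hw ⊢
  rwa [← hag.pulledAt_iff h (by omega), ← hag.pullCount_eq h k (by omega),
    ← hag.pullCount_eq h k (by omega)]

end History

/-! ### Choice of the parameters -/

section Parameters

open Filter

variable {K : ℕ} {ω : ℝ}

/-- Conditions on the numbers of observations used in the analysis: `n` observations are reliable,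
and the best arm gets locked by examining `m` stretches of rounds of the length monitored by the
diversity flags. -/
structure GoodParameters (K τ : ℕ) (ω : ℝ) (n m : ℕ) : Prop where
  admissible : Admissible K τ n
  one_le : 1 ≤ n
  mul_le : ((m * (flagLength K τ + 1) : ℕ) : ℝ) ≤ τ / (2 * K)
  lt : n + 1 < m
  reliable : 2 * K * (20 * (τ : ℝ) * K) ^ 2 * Real.exp (-(n * ω)) ≤ 1 / τ
  locking : 2 * K * (10 * (τ : ℝ) * K) ^ 2 * Real.exp (-(n * ω)) +
    2 * K * (n : ℝ) ^ 2 * Real.exp (-(duelSize τ * ω)) +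
    K * (6 * (τ : ℝ) * K) * n * Real.exp (-(duelSize τ * ω)) / ((m : ℝ) - (n + 1)) ≤ 1 / 2

/-- A number `n` of observations for which a failure has probability at most
`exp (-n ω) ≤ τ ^ (-5)`, so that a union bound over blocks near one point leaves `O(1 / τ)`. -/
noncomputable def sampleSize (ω : ℝ) (τ : ℕ) : ℕ := ⌈(5 / ω + 1) * Real.log τ⌉₊

/-- The number of stretches of `flagLength K τ + 1` rounds that fit into `τ / (2 K)` rounds. -/
noncomputable def stretchCount (K τ : ℕ) : ℕ := ⌊(τ : ℝ) / (2 * K * (flagLength K τ + 1))⌋₊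

theorem eventually_le_log (a : ℝ) : ∀ᶠ τ : ℕ in atTop, a ≤ Real.log τ :=
  (Real.tendsto_log_atTop.comp tendsto_natCast_atTop_atTop).eventually_ge_atTop a

theorem eventually_mul_log_pow_le (C : ℝ) (d : ℕ) :
    ∀ᶠ τ : ℕ in atTop, C * Real.log τ ^ d ≤ τ := by
  have hlittle := ((Real.isLittleO_pow_log_id_atTop (n := d)).comp_tendsto
    (tendsto_natCast_atTop_atTop (R := ℝ))).const_mul_left C
  filter_upwards [hlittle.def one_pos] with τ hτ
  simp only [Function.comp, id, one_mul, Real.norm_natCast] at hτ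
  exact (le_abs_self _).trans hτ

theorem eventually_log_pow_mul_exp_le {ε : ℝ} (hω : 0 < ω) (hε : 0 < ε) :
    ∀ᶠ τ : ℕ in atTop, Real.log τ ^ 3 * Real.exp (-(Real.sqrt (Real.log τ) * ω)) ≤ ε := by
  have hlim := (Real.tendsto_pow_mul_exp_neg_atTop_nhds_zero 6).comp
    ((Real.tendsto_sqrt_atTop.comp
      (Real.tendsto_log_atTop.comp tendsto_natCast_atTop_atTop)).atTop_mul_const hω)
  filter_upwards [hlim.eventually_le_const (show 0 < ω ^ 6 * ε by positivity),
    eventually_le_log 0] with τ hτ hlog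
  have hpow : (Real.sqrt (Real.log τ) * ω) ^ 6 = ω ^ 6 * Real.log τ ^ 3 := by
    rw [mul_pow, show 6 = 2 * 3 by norm_num, pow_mul, Real.sq_sqrt hlog, mul_comm]
  simp only [Function.comp, hpow, mul_assoc] at hτ
  exact le_of_mul_le_mul_left hτ (by positivity)

theorem mul_log_le_sampleSize (ω : ℝ) (τ : ℕ) : (5 / ω + 1) * Real.log τ ≤ sampleSize ω τ :=
  Nat.le_ceil _

theorem sampleSize_le {τ : ℕ} (hω : 0 < ω) (hτ : 1 ≤ Real.log τ) :
    (sampleSize ω τ : ℝ) ≤ (5 / ω + 2) * Real.log τ := by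
  have hlt : (sampleSize ω τ : ℝ) < (5 / ω + 1) * Real.log τ + 1 :=
    Nat.ceil_lt_add_one (by positivity)
  linarith

theorem exp_neg_sampleSize_mul_le {τ : ℕ} (hω : 0 < ω) (hτ : 1 ≤ τ) :
    Real.exp (-(sampleSize ω τ * ω)) ≤ 1 / (τ : ℝ) ^ 5 := by
  have : 0 ≤ Real.log τ := Real.log_natCast_nonneg τ
  have hexp : Real.exp (Real.log τ) = τ := Real.exp_log (by exact_mod_cast hτ)
  have hle : 5 * Real.log τ ≤ sampleSize ω τ * ω := by
    calc 5 * Real.log τ ≤ 5 * Real.log τ + ω * Real.log τ := le_add_of_nonneg_right (by positivity)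
      _ = (5 / ω + 1) * Real.log τ * ω := by field_simp
      _ ≤ sampleSize ω τ * ω := by gcongr; exact mul_log_le_sampleSize ω τ
  calc Real.exp (-(sampleSize ω τ * ω)) ≤ Real.exp (-(5 * Real.log τ)) :=
        Real.exp_le_exp.2 (neg_le_neg hle)
    _ = 1 / (τ : ℝ) ^ 5 := by
        rw [Real.exp_neg, one_div, ← hexp, Real.log_exp, ← Real.exp_nat_mul]
        norm_num

theorem exp_neg_duelSize_mul_le {τ : ℕ} (hω : 0 < ω) :
    Real.exp (-(duelSize τ * ω)) ≤ Real.exp (-(Real.sqrt (Real.log τ) * ω)) := by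
  have hlt : Real.sqrt (Real.log τ) ≤ duelSize τ := by
    exact_mod_cast (Nat.lt_floor_add_one (Real.sqrt (Real.log τ))).le
  gcongr

theorem flagLength_add_one_le {τ : ℕ} (hK : 1 ≤ K) (hτ : 2 ≤ Real.log τ) :
    (flagLength K τ : ℝ) + 1 ≤ K * Real.log τ ^ 2 := by
  have hK' : (0 : ℝ) ≤ K - 1 := by
    have : (1 : ℝ) ≤ K := by exact_mod_cast hK
    linarith
  have hlt : (flagLength K τ : ℝ) < ((K : ℝ) - 1) * Real.log τ ^ 2 + 1 :=
    Nat.ceil_lt_add_one (by positivity)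
  nlinarith

theorem stretchCount_mul_le (hK : 1 ≤ K) (τ : ℕ) :
    ((stretchCount K τ * (flagLength K τ + 1) : ℕ) : ℝ) ≤ τ / (2 * K) := by
  push_cast
  calc (stretchCount K τ : ℝ) * (flagLength K τ + 1)
      ≤ τ / (2 * K * (flagLength K τ + 1)) * (flagLength K τ + 1) := by
        gcongr
        exact Nat.floor_le (by positivity)
    _ = τ / (2 * K) := by
        have : (K : ℝ) ≠ 0 := by positivity
        field_simp

theorem eventually_le_stretchCount_sub (hK : 1 ≤ K) (hω : 0 < ω) :
    ∀ᶠ τ : ℕ in atTop, (τ : ℝ) / (4 * K * (flagLength K τ + 1)) ≤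
      (stretchCount K τ : ℝ) - (sampleSize ω τ + 1) := by
  filter_upwards [eventually_le_log 2, eventually_mul_log_pow_le (4 * K ^ 2 * (5 / ω + 4)) 3]
    with τ hlog hτ
  have : (0 : ℝ) < K := by exact_mod_cast hK
  have hhalf : (τ : ℝ) / (2 * K * (flagLength K τ + 1)) =
      τ / (4 * K * (flagLength K τ + 1)) + τ / (4 * K * (flagLength K τ + 1)) := by
    field_simp; ring
  have hfloor : (τ : ℝ) / (2 * K * (flagLength K τ + 1)) < stretchCount K τ + 1 :=
    Nat.lt_floor_add_one _
  have hsample : (sampleSize ω τ : ℝ) + 2 ≤ τ / (4 * K * (flagLength K τ + 1)) := by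
    rw [le_div_iff₀ (by positivity)]
    calc ((sampleSize ω τ : ℝ) + 2) * (4 * K * (flagLength K τ + 1))
        ≤ ((5 / ω + 2) * Real.log τ + 2 * Real.log τ) * (4 * K * (K * Real.log τ ^ 2)) := by
          gcongr
          · exact sampleSize_le hω (by linarith)
          · linarith
          · exact flagLength_add_one_le hK hlog
      _ = 4 * K ^ 2 * (5 / ω + 4) * Real.log τ ^ 3 := by ring
      _ ≤ τ := hτ
  linarith

theorem eventually_admissible (hK : 2 ≤ K) (hω : 0 < ω) :
    ∀ᶠ τ : ℕ in atTop, Admissible K τ (sampleSize ω τ) := by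
  filter_upwards [eventually_le_log (2 * K), eventually_le_log (5 / ω + 2), eventually_le_log 2,
    eventually_mul_log_pow_le (8 * K ^ 2) 2] with τ hlogK hlogω hlog hτ
  have hsq : Real.log τ ≤ Real.log τ ^ 2 := le_self_pow₀ (by linarith) two_ne_zero
  refine ⟨hK, ?_, ?_, hlogK.trans hsq, ?_⟩
  · calc Real.sqrt (Real.log τ) ≤ Real.log τ := Real.sqrt_le_iff.2 ⟨by linarith, hsq⟩
      _ ≤ (5 / ω + 1) * Real.log τ :=
          le_mul_of_one_le_left (by linarith) (le_add_of_nonneg_left (by positivity))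
      _ ≤ sampleSize ω τ := mul_log_le_sampleSize ω τ
  · calc (sampleSize ω τ : ℝ) ≤ (5 / ω + 2) * Real.log τ := sampleSize_le hω (by linarith)
      _ ≤ Real.log τ ^ 2 := by rw [sq]; gcongr
  · have : (4 : ℝ) ≤ Real.log τ ^ 2 := by nlinarith
    calc 4 * (K : ℝ) ^ 2 * (Real.log τ ^ 2 + 4)
        ≤ 4 * K ^ 2 * (Real.log τ ^ 2 + Real.log τ ^ 2) := by gcongr
      _ = 8 * K ^ 2 * Real.log τ ^ 2 := by ring
      _ ≤ τ := hτ

theorem eventually_reliable_le (hω : 0 < ω) : ∀ᶠ τ : ℕ in atTop,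
    2 * K * (20 * (τ : ℝ) * K) ^ 2 * Real.exp (-(sampleSize ω τ * ω)) ≤ 1 / τ := by
  filter_upwards [eventually_ge_atTop (800 * K ^ 3), eventually_ge_atTop 1] with τ hτK hτ
  have hτ' : (1 : ℝ) ≤ τ := by exact_mod_cast hτ
  calc 2 * K * (20 * (τ : ℝ) * K) ^ 2 * Real.exp (-(sampleSize ω τ * ω))
      ≤ 2 * K * (20 * (τ : ℝ) * K) ^ 2 * (1 / (τ : ℝ) ^ 5) := by
        gcongr
        exact exp_neg_sampleSize_mul_le hω hτ
    _ = (800 * K ^ 3) / τ / (τ : ℝ) ^ 2 := by field_simp; ring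
    _ ≤ 1 / (τ : ℝ) ^ 2 := by
        gcongr
        exact (div_le_one (by positivity)).2 (by exact_mod_cast hτK)
    _ ≤ 1 / τ := one_div_le_one_div_of_le (by positivity) (le_self_pow₀ hτ' two_ne_zero)

theorem eventually_sampleSize_sq_mul_exp_le (hK : 1 ≤ K) (hω : 0 < ω) : ∀ᶠ τ : ℕ in atTop,
    2 * K * (sampleSize ω τ : ℝ) ^ 2 * Real.exp (-(duelSize τ * ω)) ≤ 1 / 6 := by
  filter_upwards [eventually_le_log 1, eventually_log_pow_mul_exp_le hω
    (show 0 < 1 / (12 * K * (5 / ω + 2) ^ 2) by positivity)] with τ hlog hτ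
  calc 2 * K * (sampleSize ω τ : ℝ) ^ 2 * Real.exp (-(duelSize τ * ω))
      ≤ 2 * K * ((5 / ω + 2) * Real.log τ) ^ 2 * Real.exp (-(Real.sqrt (Real.log τ) * ω)) := by
        gcongr 2 * K * ?_ ^ 2 * ?_
        exacts [sampleSize_le hω hlog, exp_neg_duelSize_mul_le hω]
    _ = 2 * K * (5 / ω + 2) ^ 2 *
          (Real.log τ ^ 2 * Real.exp (-(Real.sqrt (Real.log τ) * ω))) := by ring
    _ ≤ 2 * K * (5 / ω + 2) ^ 2 *
          (Real.log τ ^ 3 * Real.exp (-(Real.sqrt (Real.log τ) * ω))) := by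
        gcongr
        norm_num
    _ ≤ 2 * K * (5 / ω + 2) ^ 2 * (1 / (12 * K * (5 / ω + 2) ^ 2)) := by gcongr
    _ = 1 / 6 := by
        have : (0 : ℝ) < K := by positivity
        field_simp
        norm_num

theorem eventually_mul_sampleSize_mul_exp_div_le (hK : 1 ≤ K) (hω : 0 < ω) : ∀ᶠ τ : ℕ in atTop,
    K * (6 * (τ : ℝ) * K) * sampleSize ω τ * Real.exp (-(duelSize τ * ω)) /
      ((stretchCount K τ : ℝ) - (sampleSize ω τ + 1)) ≤ 1 / 6 := by
  filter_upwards [eventually_le_log 2, eventually_ge_atTop 1, eventually_le_stretchCount_sub hK hω,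
    eventually_log_pow_mul_exp_le hω (show 0 < 1 / (144 * K ^ 4 * (5 / ω + 2)) by positivity)]
    with τ hlog hτ hm hexp
  have : (0 : ℝ) < K := by exact_mod_cast hK
  have : (0 : ℝ) < τ := by exact_mod_cast hτ
  calc K * (6 * (τ : ℝ) * K) * sampleSize ω τ * Real.exp (-(duelSize τ * ω)) /
        ((stretchCount K τ : ℝ) - (sampleSize ω τ + 1))
      ≤ K * (6 * (τ : ℝ) * K) * ((5 / ω + 2) * Real.log τ) *
          Real.exp (-(Real.sqrt (Real.log τ) * ω)) / (τ / (4 * K * (flagLength K τ + 1))) := by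
        gcongr ?_ * ?_ * ?_ / ?_
        exacts [sampleSize_le hω (by linarith), exp_neg_duelSize_mul_le hω]
    _ = 24 * K ^ 3 * ((5 / ω + 2) * Real.log τ) * Real.exp (-(Real.sqrt (Real.log τ) * ω)) *
          (flagLength K τ + 1) := by field_simp; ring
    _ ≤ 24 * K ^ 3 * ((5 / ω + 2) * Real.log τ) * Real.exp (-(Real.sqrt (Real.log τ) * ω)) *
          (K * Real.log τ ^ 2) := by
        gcongr
        exact flagLength_add_one_le hK hlog
    _ = 24 * K ^ 4 * (5 / ω + 2) *
          (Real.log τ ^ 3 * Real.exp (-(Real.sqrt (Real.log τ) * ω))) := by ring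
    _ ≤ 24 * K ^ 4 * (5 / ω + 2) * (1 / (144 * K ^ 4 * (5 / ω + 2))) := by gcongr
    _ = 1 / 6 := by
        field_simp
        norm_num

theorem eventually_goodParameters (hK : 2 ≤ K) (hω : 0 < ω) : ∀ᶠ τ : ℕ in atTop,
    GoodParameters K τ ω (sampleSize ω τ) (stretchCount K τ) := by
  have hK₁ : 1 ≤ K := by omega
  filter_upwards [eventually_admissible hK hω, eventually_reliable_le (K := K) hω,
    eventually_sampleSize_sq_mul_exp_le hK₁ hω, eventually_mul_sampleSize_mul_exp_div_le hK₁ hω,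
    eventually_le_stretchCount_sub hK₁ hω, eventually_le_log 1, eventually_ge_atTop 6]
    with τ hadm hrel hlong hshort hm hlog hτ
  have hτ' : (6 : ℝ) ≤ τ := by exact_mod_cast hτ
  refine ⟨hadm, Nat.ceil_pos.2 (by positivity), stretchCount_mul_le hK₁ τ, ?_, hrel, ?_⟩
  · have : (0 : ℝ) < τ / (4 * K * (flagLength K τ + 1)) := by positivity
    have : (sampleSize ω τ : ℝ) + 1 < stretchCount K τ := by linarith
    exact_mod_cast this
  · have hrel' : 2 * K * (10 * (τ : ℝ) * K) ^ 2 * Real.exp (-(sampleSize ω τ * ω)) ≤ 1 / 6 := by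
      refine le_trans ?_ (hrel.trans (one_div_le_one_div_of_le (by norm_num) hτ'))
      gcongr
      norm_num
    linarith

end Parameters

/-! ### Probabilities of the good events -/

section Union

variable {K : ℕ} {Ω : Type*} [mΩ : MeasurableSpace Ω] {P : Measure Ω} [IsFiniteMeasure P]
  {ℱ : Filtration ℕ mΩ} {ν : ℕ → Fin K → Measure ℝ} {X : ℕ → Fin K → Ω → ℝ} {τ : ℕ}
  {l : Ω → ℕ → Fin K} {A : Ω → ℕ → Finset (Fin K)} {p : Fin K → Measure ℝ} {ω : ℝ} {t₀ t₁ n : ℕ}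
  {G : Set Ω} {k b : Fin K} {c : ℝ}

theorem measureReal_badBlock_le {lam ξ : ℝ} (hE : IsEnvironment P ℱ ν X)
    (h : IsPolicyRun P ℱ X τ l A) (hν : ∀ t, t₀ < t → t ≤ t₁ → ν t = p) (ht : t₀ ≤ t₁)
    (hexp : ChernoffBound (p k) ω lam ξ) (hG : MeasurableSet[ℱ t₀] G) (i n : ℕ) :
    P.real (G ∩ {w | BadBlock (A w) (fun t k => X t k w) t₀ t₁ k i n lam ξ}) ≤
      Real.exp (-(n * ω)) * P.real G := by
  classical
  have hselected (w : Ω) : (Finset.Ioc t₀ t₁).filter (fun t => t ∈ blockTimes (A w) k t₀ t₁ i n) =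
      blockTimes (A w) k t₀ t₁ i n := by
    rw [Finset.filter_mem_eq_inter]
    exact Finset.inter_eq_right.2 (Finset.filter_subset _ _)
  have hle := measureReal_selected_le (P := P) (n := n) (Y := fun t => X t k)
    (p := fun t => ν t k) (H := fun t => {w | t ∈ blockTimes (A w) k t₀ t₁ i n})
    (fun t h₀ _ => hE.adapted t k (by omega)) (fun t h₀ _ => hE.law t k (by omega))
    (fun t h₀ _ => hE.indep t k (by omega)) (fun t h₀ h₁ => (hν t h₀ h₁).symm ▸ hexp)
    (fun t h₀ _ => h.measurableSet_mem_blockTimes k h₀) hG ht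
  simp only [Set.mem_ofPred_eq, hselected] at hle
  exact hle

theorem measureReal_badBlock_le_of_le {lam ξ : ℝ} (hE : IsEnvironment P ℱ ν X)
    (h : IsPolicyRun P ℱ X τ l A) (hν : ∀ t, t₀ < t → t ≤ t₁ → ν t = p) (ht : t₀ ≤ t₁)
    (hexp : ChernoffBound (p k) ω lam ξ) (hω : 0 ≤ ω) (hG : MeasurableSet[ℱ t₀] G) (i : ℕ)
    {n₁ n : ℕ} (hn : n₁ ≤ n) :
    P.real (G ∩ {w | BadBlock (A w) (fun t k => X t k w) t₀ t₁ k i n lam ξ}) ≤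
      Real.exp (-(n₁ * ω)) * P.real G := by
  refine (measureReal_badBlock_le hE h hν ht hexp hG i n).trans ?_
  gcongr

theorem measureReal_not_goodBlocks_le {lam ξ : ℝ} (hE : IsEnvironment P ℱ ν X)
    (h : IsPolicyRun P ℱ X τ l A) (hν : ∀ t, t₀ < t → t ≤ t₁ → ν t = p) (ht : t₀ ≤ t₁)
    (hexp : ChernoffBound (p k) ω lam ξ) (hω : 0 ≤ ω) (hG : MeasurableSet[ℱ t₀] G) {M n₁ n₂ : ℕ}
    (hn₁ : 1 ≤ n₁) :
    P.real (G ∩ {w | ¬ GoodBlocks (A w) (fun t k => X t k w) t₀ t₁ k M n₁ n₂ lam ξ}) ≤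
      M * n₂ * Real.exp (-(n₁ * ω)) * P.real G := by
  have hsub : (G ∩ {w | ¬ GoodBlocks (A w) (fun t k => X t k w) t₀ t₁ k M n₁ n₂ lam ξ}) ⊆
      ⋃ q ∈ Finset.Icc 1 M ×ˢ Finset.Icc n₁ n₂,
        G ∩ {w | BadBlock (A w) (fun t k => X t k w) t₀ t₁ k q.1 q.2 lam ξ} := by
    rintro w ⟨hw, hbad⟩
    simp only [GoodBlocks, Set.mem_ofPred_eq, not_forall, not_not] at hbad
    obtain ⟨i, n, hi, hiM, hn, hn₂, hbad⟩ := hbad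
    simp only [Set.mem_iUnion, exists_prop]
    exact ⟨(i, n), by simp [hi, hiM, hn, hn₂], hw, hbad⟩
  calc P.real (G ∩ {w | ¬ GoodBlocks (A w) (fun t k => X t k w) t₀ t₁ k M n₁ n₂ lam ξ})
      ≤ ∑ q ∈ Finset.Icc 1 M ×ˢ Finset.Icc n₁ n₂,
          P.real (G ∩ {w | BadBlock (A w) (fun t k => X t k w) t₀ t₁ k q.1 q.2 lam ξ}) :=
        (measureReal_mono hsub (measure_ne_top _ _)).trans (measureReal_biUnion_finset_le _ _)
    _ ≤ (Finset.Icc 1 M ×ˢ Finset.Icc n₁ n₂).card • (Real.exp (-(n₁ * ω)) * P.real G) :=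
        Finset.sum_le_card_nsmul _ _ _ fun q hq => measureReal_badBlock_le_of_le hE h hν ht hexp
          hω hG _ (Finset.mem_Icc.1 (Finset.mem_product.1 hq).2).1
    _ ≤ (M * n₂ : ℕ) • (Real.exp (-(n₁ * ω)) * P.real G) := by
        refine nsmul_le_nsmul_left (by positivity) ?_
        rw [Finset.card_product, Nat.card_Icc, Nat.card_Icc]
        exact Nat.mul_le_mul (by omega) (by omega)
    _ = M * n₂ * Real.exp (-(n₁ * ω)) * P.real G := by
        rw [nsmul_eq_mul, Nat.cast_mul, ← mul_assoc]

/-- Tilts `lam`, `lam'` and thresholds `ξ` which separate each arm from the arm `b`: the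
observations of arm `k` lie below `ξ k` and those of `b` above it, up to exponentially small
probabilities. -/
def Thresholds (ω : ℝ) (p : Fin K → Measure ℝ) (b : Fin K) (lam lam' ξ : Fin K → ℝ) : Prop :=
  ∀ k, k ≠ b → (0 < lam k ∧ lam' k < 0) ∧ ChernoffBound (p k) ω (lam k) (ξ k) ∧
    ChernoffBound (p b) ω (lam' k) (ξ k)

theorem IsSeparatedModel.exists_thresholds {D : ℝ} (h : IsSeparatedModel ω D p b) :
    ∃ lam lam' ξ : Fin K → ℝ, Thresholds ω p b lam lam' ξ := by
  choose! lam lam' ξ hlam hlam' hk hb using h.chernoffBound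
  exact ⟨lam, lam', ξ, fun k hne => ⟨⟨hlam k hne, hlam' k hne⟩, hk k hne, hb k hne⟩⟩

variable {lam lam' ξ : Fin K → ℝ}

theorem measureReal_exists_ne_le (hc : 0 ≤ c) {S : Fin K → Set Ω}
    (hS : ∀ k, k ≠ b → P.real (G ∩ S k) ≤ c) :
    P.real (G ∩ {w | ∃ k, k ≠ b ∧ w ∈ S k}) ≤ K * c := by
  have hsub : (G ∩ {w | ∃ k, k ≠ b ∧ w ∈ S k}) ⊆ ⋃ k ∈ Finset.univ.erase b, G ∩ S k := by
    rintro w ⟨hw, k, hk, hkS⟩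
    simp only [Set.mem_iUnion, exists_prop]
    exact ⟨k, by simpa using hk, hw, hkS⟩
  calc P.real (G ∩ {w | ∃ k, k ≠ b ∧ w ∈ S k})
      ≤ ∑ k ∈ Finset.univ.erase b, P.real (G ∩ S k) :=
        (measureReal_mono hsub (measure_ne_top _ _)).trans (measureReal_biUnion_finset_le _ _)
    _ ≤ (Finset.univ.erase b).card • c :=
        Finset.sum_le_card_nsmul _ _ _ fun k hk => hS k (Finset.ne_of_mem_erase hk)
    _ ≤ K • c := nsmul_le_nsmul_left hc (card_finset_fin_le _)
    _ = K * c := nsmul_eq_mul _ _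

theorem measureReal_not_reliable_le (hE : IsEnvironment P ℱ ν X) (h : IsPolicyRun P ℱ X τ l A)
    (hν : ∀ t, t₀ < t → t ≤ t₁ → ν t = p) (ht : t₀ ≤ t₁) (hthr : Thresholds ω p b lam lam' ξ)
    (hω : 0 ≤ ω) (hG : MeasurableSet[ℱ t₀] G) (hn : 1 ≤ n) :
    P.real (G ∩ {w | ¬ Reliable (A w) (fun t k => X t k w) t₀ t₁ n b lam lam' ξ}) ≤
      2 * K * ((t₁ - t₀ : ℕ) : ℝ) ^ 2 * Real.exp (-(n * ω)) * P.real G := by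
  have hsub : (G ∩ {w | ¬ Reliable (A w) (fun t k => X t k w) t₀ t₁ n b lam lam' ξ}) ⊆
      G ∩ {w | ∃ k, k ≠ b ∧ w ∈ {w | ¬ GoodBlocks (A w) (fun t k => X t k w) t₀ t₁ k (t₁ - t₀) n
          (t₁ - t₀) (lam k) (ξ k)} ∪
        {w | ¬ GoodBlocks (A w) (fun t k => X t k w) t₀ t₁ b (t₁ - t₀) n (t₁ - t₀)
          (lam' k) (ξ k)}} := by
    rintro w ⟨hw, hnot⟩
    simp only [Reliable, Set.mem_ofPred_eq, not_forall, not_and_or, exists_prop] at hnot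
    exact ⟨hw, hnot⟩
  refine (measureReal_mono hsub).trans ((measureReal_exists_ne_le (c := 2 *
    (((t₁ - t₀ : ℕ) : ℝ) * ((t₁ - t₀ : ℕ) : ℝ) * Real.exp (-(n * ω)) * P.real G)) (by positivity)
    fun k hk => ?_).trans_eq (by ring))
  rw [Set.inter_union_distrib_left, two_mul]
  exact (measureReal_union_le _ _).trans (add_le_add
    (measureReal_not_goodBlocks_le hE h hν ht (hthr k hk).2.1 hω hG hn)
    (measureReal_not_goodBlocks_le hE h hν ht (hthr k hk).2.2 hω hG hn))

theorem mul_measureReal_le_card_badShortBlocks (hE : IsEnvironment P ℱ ν X)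
    (h : IsPolicyRun P ℱ X τ l A) (hν : ∀ t, t₀ < t → t ≤ t₁ → ν t = p) (ht : t₀ ≤ t₁)
    (hthr : Thresholds ω p b lam lam' ξ) (hω : 0 ≤ ω) (hG : MeasurableSet[ℱ t₀] G) (hc : 0 ≤ c) :
    c * P.real (G ∩ {w | c ≤
        (badShortBlocks (A w) (fun t k => X t k w) t₀ t₁ b τ n lam ξ).card}) ≤
      K * (t₁ - t₀ : ℕ) * n * Real.exp (-(duelSize τ * ω)) * P.real G := by
  classical
  refine (mul_measureReal_le_sum (shortBlocks b τ (t₁ - t₀) n) (fun q => G ∩ {w | BadBlock (A w)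
    (fun t k => X t k w) t₀ t₁ q.1 (q.2.1 + 1 - q.2.2) q.2.2 (lam q.1) (ξ q.1)}) hc ?_).trans ?_
  · rintro w ⟨hw, hcard⟩
    refine le_trans hcard (le_of_eq ?_)
    simp only [badShortBlocks, Finset.card_filter, Nat.cast_sum, Nat.cast_ite, Nat.cast_one,
      Nat.cast_zero, Set.indicator_apply, Set.mem_inter_iff, hw, true_and, Set.mem_ofPred_eq]
  · calc _ ≤ (shortBlocks b τ (t₁ - t₀) n).card • (Real.exp (-(duelSize τ * ω)) * P.real G) := by
          refine Finset.sum_le_card_nsmul _ _ _ fun q hq => ?_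
          have hq' := mem_shortBlocks.1 hq
          exact measureReal_badBlock_le_of_le hE h hν ht (hthr q.1 hq'.1).2.1 hω hG _ hq'.2.2.1
      _ ≤ (K * (t₁ - t₀) * n) • (Real.exp (-(duelSize τ * ω)) * P.real G) := by
          refine nsmul_le_nsmul_left (by positivity) ?_
          rw [shortBlocks, Finset.card_product, Finset.card_product, Nat.card_Icc, Nat.card_Icc,
            mul_assoc K]
          exact Nat.mul_le_mul (card_finset_fin_le _)
            (Nat.mul_le_mul (by omega) (by rw [duelSize]; omega))
      _ = K * (t₁ - t₀ : ℕ) * n * Real.exp (-(duelSize τ * ω)) * P.real G := by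
          rw [nsmul_eq_mul]
          push_cast
          ring

theorem not_reliable_or_of_not_lockedAt {l : ℕ → Fin K} {A : ℕ → Finset (Fin K)}
    {x : ℕ → Fin K → ℝ} {m t₂ : ℕ} (h : IsRun τ x l A) (hpar : GoodParameters K τ ω n m)
    (hlam : ∀ k, k ≠ b → 0 < lam k ∧ lam' k < 0) (ht₀ : K ≤ t₀) (ht₁ : t₀ + 4 * τ * K ≤ t₁)
    (ht₂ : t₁ + 6 * τ * K ≤ t₂) (hlock : ¬ LockedAt τ l A b t₂) :
    ¬ Reliable A x t₀ t₂ n b lam lam' ξ ∨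
      (∃ k, k ≠ b ∧ ¬ GoodBlocks A x t₁ t₂ b (2 * n) (duelSize τ) n (lam' k) (ξ k)) ∨
      (m : ℝ) - (n + 1) ≤ (badShortBlocks A x t₁ t₂ b τ n lam ξ).card := by
  by_contra! hcon
  obtain ⟨hrel, hshort, hmany⟩ := hcon
  refine hlock (lockedAt_of_reliable h hpar.admissible hpar.one_le hlam hrel ht₀ ht₁ ht₂ hshort
    hpar.mul_le ?_)
  have : ((n + 1 + (badShortBlocks A x t₁ t₂ b τ n lam ξ).card : ℕ) : ℝ) < m := by
    push_cast
    linarith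
  exact_mod_cast this

theorem measureReal_not_lockedAt_le {m t₂ : ℕ} (hE : IsEnvironment P ℱ ν X)
    (h : IsPolicyRun P ℱ X τ l A) (hν : ∀ t, t₀ < t → t ≤ t₂ → ν t = p) (ht₀ : K ≤ t₀)
    (ht₂ : t₂ = t₀ + 10 * τ * K) (hthr : Thresholds ω p b lam lam' ξ) (hω : 0 ≤ ω)
    (hpar : GoodParameters K τ ω n m) (hG : MeasurableSet[ℱ t₀] G) :
    P.real (G ∩ {w | ¬ LockedAt τ (l w) (A w) b t₂}) ≤ 1 / 2 * P.real G := by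
  obtain ⟨t₁, ht₁, ht₁₂⟩ : ∃ t₁, t₁ = t₀ + 4 * τ * K ∧ t₂ = t₁ + 6 * τ * K :=
    ⟨_, rfl, by rw [ht₂]; ring⟩
  have hν₁ : ∀ t, t₁ < t → t ≤ t₂ → ν t = p := fun t h₁ h₂ => hν t (by omega) h₂
  have hG₁ : MeasurableSet[ℱ t₁] G := ℱ.mono (by omega) _ hG
  set rel := {w | ¬ Reliable (A w) (fun t k => X t k w) t₀ t₂ n b lam lam' ξ}
  set short := {w | ∃ k, k ≠ b ∧ w ∈ {w | ¬ GoodBlocks (A w) (fun t k => X t k w) t₁ t₂ b (2 * n)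
    (duelSize τ) n (lam' k) (ξ k)}}
  set many := {w | ((m : ℝ) - (n + 1)) ≤
    (badShortBlocks (A w) (fun t k => X t k w) t₁ t₂ b τ n lam ξ).card}
  have hsub : (G ∩ {w | ¬ LockedAt τ (l w) (A w) b t₂}) ⊆ G ∩ rel ∪ G ∩ short ∪ G ∩ many := by
    rintro w ⟨hw, hlock⟩
    rcases not_reliable_or_of_not_lockedAt (h.isRun w) hpar (fun k hk => (hthr k hk).1) ht₀ ht₁.ge
      ht₁₂.ge hlock with hrel | hshort | hmany
    · exact .inl (.inl ⟨hw, hrel⟩)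
    · exact .inl (.inr ⟨hw, hshort⟩)
    · exact .inr ⟨hw, hmany⟩
  have hm : (0 : ℝ) < (m : ℝ) - (n + 1) := by
    have : ((n + 1 : ℕ) : ℝ) < m := by exact_mod_cast hpar.lt
    push_cast at this
    linarith
  have hrel := measureReal_not_reliable_le hE h hν (by omega) hthr hω hG hpar.one_le
  have hshort := measureReal_exists_ne_le (P := P) (G := G) (b := b)
    (c := (2 * n : ℕ) * n * Real.exp (-(duelSize τ * ω)) * P.real G) (by positivity)
    fun k hk => measureReal_not_goodBlocks_le hE h hν₁ (by omega) (hthr k hk).2.2 hω hG₁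
      (Nat.succ_pos _)
  have hmany := mul_measureReal_le_card_badShortBlocks (n := n) hE h hν₁ (by omega) hthr hω hG₁
    hm.le
  rw [show t₂ - t₀ = 10 * τ * K by omega] at hrel
  rw [show t₂ - t₁ = 6 * τ * K by omega, mul_comm, ← le_div_iff₀ hm] at hmany
  calc P.real (G ∩ {w | ¬ LockedAt τ (l w) (A w) b t₂})
      ≤ P.real (G ∩ rel) + P.real (G ∩ short) + P.real (G ∩ many) := by
        refine (measureReal_mono hsub).trans ((measureReal_union_le _ _).trans ?_)
        gcongr
        exact measureReal_union_le _ _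
    _ ≤ _ := add_le_add (add_le_add hrel hshort) hmany
    _ = (2 * K * (10 * (τ : ℝ) * K) ^ 2 * Real.exp (-(n * ω)) +
          2 * K * (n : ℝ) ^ 2 * Real.exp (-(duelSize τ * ω)) +
          K * (6 * (τ : ℝ) * K) * n * Real.exp (-(duelSize τ * ω)) / ((m : ℝ) - (n + 1))) *
          P.real G := by
        push_cast
        ring
    _ ≤ 1 / 2 * P.real G := mul_le_mul_of_nonneg_right hpar.locking measureReal_nonneg

end Union

/-! ### The regret -/

section Regret

variable {K : ℕ} {ω D : ℝ} {ν : ℕ → Fin K → Measure ℝ} {best : ℕ → Fin K} {T : ℕ}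

open Classical in
/-- The regret up to time `T` accumulated along one path, of which `dynamicRegret` is the mean. -/
noncomputable def pathRegret (ν : ℕ → Fin K → Measure ℝ) (A : ℕ → Finset (Fin K)) (T : ℕ) : ℝ :=
  ∑ t ∈ Finset.Icc 1 T, ∑ k : Fin K, if PulledAt A t k then bestMean ν t - mean (ν t k) else 0

open Classical in
/-- Number of times in `S` at which an arm other than the best one is pulled. -/
noncomputable def suboptimalPulls (A : ℕ → Finset (Fin K)) (best : ℕ → Fin K) (S : Finset ℕ) : ℕ :=
  (S.filter fun t => ∃ k, k ≠ best t ∧ PulledAt A t k).card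

theorem suboptimalPulls_le_card (A : ℕ → Finset (Fin K)) (best : ℕ → Fin K) (S : Finset ℕ) :
    suboptimalPulls A best S ≤ S.card := by
  classical
  exact Finset.card_filter_le _ _

theorem suboptimalPulls_Ioc_eq_card {t u : ℕ} {b : Fin K} (A : ℕ → Finset (Fin K))
    (hbest : ∀ s, t < s → s ≤ u → best s = b) :
    suboptimalPulls A best (Finset.Ioc t u) = (otherArmTimes A b t u).card := by
  classical
  refine congrArg Finset.card (Finset.filter_congr fun s hs => ?_)
  obtain ⟨hts, hsu⟩ := Finset.mem_Ioc.1 hs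
  rw [hbest s hts hsu]

theorem suboptimalPulls_Icc_le_sum {W : ℕ} (A : ℕ → Finset (Fin K)) (best : ℕ → Fin K)
    (hW : 0 < W) (T : ℕ) :
    suboptimalPulls A best (Finset.Icc 1 T) ≤
      ∑ j ∈ Finset.range (T / W + 1), suboptimalPulls A best (Finset.Ioc (j * W) (j * W + W)) := by
  classical
  refine le_trans (Finset.card_le_card fun t ht => ?_) Finset.card_biUnion_le
  obtain ⟨ht, hpull⟩ := Finset.mem_filter.1 ht
  obtain ⟨ht₁, htT⟩ := Finset.mem_Icc.1 ht
  have hdiv : (t - 1) / W ≤ T / W := Nat.div_le_div_right (by omega)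
  have hlow := Nat.div_mul_le_self (t - 1) W
  have hhigh := Nat.lt_div_mul_add (a := t - 1) hW
  exact Finset.mem_biUnion.2 ⟨(t - 1) / W, Finset.mem_range.2 (by omega),
    Finset.mem_filter.2 ⟨Finset.mem_Ioc.2 ⟨by omega, by omega⟩, hpull⟩⟩

theorem IsSeparatedModel.gap_nonneg {p : Fin K → Measure ℝ} {b : Fin K}
    (h : IsSeparatedModel ω D p b) (hω : 0 < ω) (k : Fin K) : 0 ≤ mean (p b) - mean (p k) := by
  rcases eq_or_ne k b with rfl | hk
  · exact (sub_self _).ge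
  · exact (sub_pos.2 (h.mean_lt hω hk)).le

theorem pathRegret_nonneg (hω : 0 < ω)
    (hbest : ∀ t, 1 ≤ t → t ≤ T → IsSeparatedModel ω D (ν t) (best t)) (A : ℕ → Finset (Fin K)) :
    0 ≤ pathRegret ν A T := by
  refine Finset.sum_nonneg fun t ht => Finset.sum_nonneg fun k _ => ?_
  have hmodel := hbest t (Finset.mem_Icc.1 ht).1 (Finset.mem_Icc.1 ht).2
  split_ifs
  · rw [bestMean, hmodel.iSup_mean hω]
    exact hmodel.gap_nonneg hω k
  · exact le_rfl

theorem pathRegret_le (hω : 0 < ω)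
    (hbest : ∀ t, 1 ≤ t → t ≤ T → IsSeparatedModel ω D (ν t) (best t)) (A : ℕ → Finset (Fin K)) :
    pathRegret ν A T ≤ |D| * suboptimalPulls A best (Finset.Icc 1 T) := by
  classical
  rw [suboptimalPulls, Finset.card_filter, Nat.cast_sum, Finset.mul_sum]
  refine Finset.sum_le_sum fun t ht => ?_
  have hmodel := hbest t (Finset.mem_Icc.1 ht).1 (Finset.mem_Icc.1 ht).2
  by_cases hpull : ∃ k, PulledAt A t k
  · obtain ⟨k, hk⟩ := hpull
    rw [Finset.sum_eq_single k (fun j _ hj => if_neg fun hj' => hj (hj'.unique hk)) (by simp),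
      if_pos hk, bestMean, hmodel.iSup_mean hω]
    rcases eq_or_ne k (best t) with rfl | hkb
    · rw [sub_self]
      positivity
    · rw [if_pos ⟨k, hkb, hk⟩, Nat.cast_one, mul_one]
      exact (hmodel.gap_le k hkb).trans (le_abs_self D)
  · rw [Finset.sum_eq_zero fun k _ => if_neg fun hk => hpull ⟨k, hk⟩]
    positivity

/-- The distributions of the rewards are constant during the times `s - W + 1, …, s + W`. -/
def Steady (ν : ℕ → Fin K → Measure ℝ) (T W s : ℕ) : Prop :=
  W ≤ s ∧ s + W ≤ T ∧ ∀ t, s - W < t → t ≤ s + W → ν t = ν s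

theorem Steady.of_eq_succ {W s : ℕ} (hs : W ≤ s) (hT : s + W ≤ T)
    (hν : ∀ t, s - W < t → t < s + W → ν t = ν (t + 1)) : Steady ν T W s := by
  have hconst : ∀ t, s - W + 1 ≤ t → t ≤ s + W → ν t = ν (s - W + 1) := by
    intro t ht
    induction t, ht using Nat.le_induction with
    | base => exact fun _ => rfl
    | succ t ht ih => exact fun htW => (hν t ht htW).symm.trans (ih (by omega))
  exact ⟨hs, hT, fun t ht htW => (hconst t ht htW).trans (hconst s (by omega) (by omega)).symm⟩

open Classical in
theorem card_not_steady_le {W : ℕ} (ν : ℕ → Fin K → Measure ℝ) (T : ℕ) (hW : 0 < W) :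
    ((Finset.range (T / W + 1)).filter fun j => ¬ Steady ν T W (j * W)).card ≤
      2 + 2 * numBreakpoints ν T := by
  set B := (Finset.Ico 1 T).filter fun t => ∃ k, ν t k ≠ ν (t + 1) k
  have hsub : ((Finset.range (T / W + 1)).filter fun j => ¬ Steady ν T W (j * W)) ⊆
      {0, T / W} ∪ B.biUnion fun t => {t / W, t / W + 1} := by
    intro j hj
    obtain ⟨hjT, hnot⟩ := Finset.mem_filter.1 hj
    have hjT := Finset.mem_range.1 hjT
    by_contra hcon
    simp only [Finset.mem_union, Finset.mem_insert, Finset.mem_singleton, Finset.mem_biUnion,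
      not_or, not_exists, not_and] at hcon
    obtain ⟨⟨hj₀, hjN⟩, hfar⟩ := hcon
    have hWj : W ≤ j * W := Nat.le_mul_of_pos_left _ (by omega)
    have hjW : j * W + W ≤ T :=
      (Nat.succ_mul j W).ge.trans ((Nat.le_div_iff_mul_le hW).1 (by omega))
    refine hnot (Steady.of_eq_succ hWj hjW fun t ht htW => ?_)
    by_contra hne
    obtain ⟨hne₁, hne₂⟩ := hfar t
      (Finset.mem_filter.2 ⟨Finset.mem_Ico.2 ⟨by omega, by omega⟩, Function.ne_iff.1 hne⟩)
    have hlt : t / W < j + 1 := (Nat.div_lt_iff_lt_mul hW).2 (by rwa [Nat.succ_mul])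
    have hle : j - 1 ≤ t / W := (Nat.le_div_iff_mul_le hW).2 (by rw [Nat.sub_one_mul]; omega)
    omega
  refine (Finset.card_le_card hsub).trans ((Finset.card_union_le _ _).trans
    (Nat.add_le_add Finset.card_le_two ?_))
  rw [mul_comm]
  exact Finset.card_biUnion_le_card_mul _ _ _ fun _ _ => Finset.card_le_two

theorem Steady.best_eq {W s t : ℕ} (hs : Steady ν T W s) (hω : 0 < ω)
    (hbest : ∀ t, 1 ≤ t → t ≤ T → IsSeparatedModel ω D (ν t) (best t)) (ht : s - W < t)
    (htW : t ≤ s + W) : best t = best s := by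
  obtain ⟨hWs, hT, hν⟩ := hs
  have hmodel := hbest t (by omega) (by omega)
  rw [hν t ht htW] at hmodel
  exact hmodel.best_unique (hbest s (by omega) (by omega)) hω

variable {Ω : Type*} [mΩ : MeasurableSpace Ω] {P : Measure Ω} [IsProbabilityMeasure P]
  {ℱ : Filtration ℕ mΩ} {X : ℕ → Fin K → Ω → ℝ} {τ : ℕ} {l : Ω → ℕ → Fin K}
  {A : Ω → ℕ → Finset (Fin K)} {n m s : ℕ}

theorem dynamicRegret_le_of_exceptional {W M : ℕ} {S : ℕ → Set Ω} (hω : 0 < ω)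
    (hbest : ∀ t, 1 ≤ t → t ≤ T → IsSeparatedModel ω D (ν t) (best t)) (hW : 0 < W)
    (hS : ∀ j, ∀ w ∉ S j, suboptimalPulls (A w) best (Finset.Ioc (j * W) (j * W + W)) ≤ M) :
    dynamicRegret P ν A T ≤ |D| * (((T / W : ℕ) + 1) * M +
      W * ∑ j ∈ Finset.range (T / W + 1), P.real (S j)) := by
  set f : Ω → ℝ := fun w => ∑ j ∈ Finset.range (T / W + 1),
    (toMeasurable P (S j)).indicator (fun _ => (1 : ℝ)) w with hf
  have hfint : Integrable f P := integrable_sum_indicator_toMeasurable _ _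
  have hf_integral : ∫ w, f w ∂P = ∑ j ∈ Finset.range (T / W + 1), P.real (S j) :=
    integral_sum_indicator_toMeasurable _ _
  have hphase (w : Ω) (j : ℕ) :
      (suboptimalPulls (A w) best (Finset.Ioc (j * W) (j * W + W)) : ℝ) ≤
        M + W * (toMeasurable P (S j)).indicator (fun _ => (1 : ℝ)) w := by
    by_cases hw : w ∈ toMeasurable P (S j)
    · have hcard := suboptimalPulls_le_card (A w) best (Finset.Ioc (j * W) (j * W + W))
      rw [Nat.card_Ioc, Nat.add_sub_cancel_left] at hcard
      rw [Set.indicator_of_mem hw, mul_one]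
      exact_mod_cast hcard.trans (Nat.le_add_left _ _)
    · rw [Set.indicator_of_notMem hw, mul_zero, add_zero]
      exact_mod_cast hS j w fun hwS => hw (subset_toMeasurable P _ hwS)
  have hpath (w : Ω) : pathRegret ν (A w) T ≤ |D| * (((T / W : ℕ) + 1) * M + W * f w) := by
    refine (pathRegret_le hω hbest (A w)).trans (mul_le_mul_of_nonneg_left ?_ (abs_nonneg D))
    calc (suboptimalPulls (A w) best (Finset.Icc 1 T) : ℝ)
        ≤ ∑ j ∈ Finset.range (T / W + 1),
            (suboptimalPulls (A w) best (Finset.Ioc (j * W) (j * W + W)) : ℝ) := by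
          exact_mod_cast suboptimalPulls_Icc_le_sum (A w) best hW T
      _ ≤ _ := Finset.sum_le_sum fun j _ => hphase w j
      _ = ((T / W : ℕ) + 1) * M + W * f w := by
          rw [Finset.sum_add_distrib, ← Finset.mul_sum]
          simp [hf]
  calc dynamicRegret P ν A T
      ≤ ∫ w, |D| * (((T / W : ℕ) + 1) * M + W * f w) ∂P :=
        integral_mono_of_nonneg (.of_forall fun w => pathRegret_nonneg hω hbest (A w))
          (((integrable_const _).add (hfint.const_mul _)).const_mul _) (.of_forall hpath)
    _ = |D| * (((T / W : ℕ) + 1) * M + W * ∑ j ∈ Finset.range (T / W + 1), P.real (S j)) := by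
        rw [integral_const_mul, integral_add (integrable_const _) (hfint.const_mul _),
          integral_const, probReal_univ, one_smul, integral_const_mul, hf_integral]

/-- The event that the best arm of time `s` does not hold the lead safely at that time. -/
def Unlocked (τ : ℕ) (l : Ω → ℕ → Fin K) (A : Ω → ℕ → Finset (Fin K)) (best : ℕ → Fin K)
    (s : ℕ) : Set Ω :=
  {w | ¬ LockedAt τ (l w) (A w) (best s) s}

theorem Steady.exists_unreliable (hs : Steady ν T (10 * τ * K) s) (hω : 0 < ω)
    (hpar : GoodParameters K τ ω n m)
    (hbest : ∀ t, 1 ≤ t → t ≤ T → IsSeparatedModel ω D (ν t) (best t))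
    (hE : IsEnvironment P ℱ ν X) (h : IsPolicyRun P ℱ X τ l A) :
    ∃ R : Set Ω, P.real R ≤ 1 / τ ∧ ∀ w ∉ R, w ∉ Unlocked τ l A best s →
      w ∉ Unlocked τ l A best (s + 10 * τ * K) ∧
      suboptimalPulls (A w) best (Finset.Ioc s (s + 10 * τ * K)) ≤
        K * ((10 * K + 1) * (n + 1)) := by
  have hτ := hpar.admissible.add_sixteen_le
  have hW : 10 * τ * K = 3 * τ * K + 7 * τ * K := by ring
  have hWpos : 0 < 10 * τ * K := Nat.mul_pos (by omega) (by have := hpar.admissible.two_le; omega)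
  have hbest_eq := fun t => hs.best_eq (t := t) hω hbest
  obtain ⟨hWs, hT, hν⟩ := hs
  obtain ⟨lam, lam', ξ, hthr⟩ := (hbest s (by omega) (by omega)).exists_thresholds
  refine ⟨{w | ¬ Reliable (A w) (fun t k => X t k w) (s - 10 * τ * K) (s + 10 * τ * K) n (best s)
    lam lam' ξ}, ?_, fun w hrel hlock => ?_⟩
  · have hrel := measureReal_not_reliable_le (G := Set.univ) hE h hν (by omega) hthr hω.le
      MeasurableSet.univ hpar.one_le
    rw [Set.univ_inter, probReal_univ, mul_one,
      show s + 10 * τ * K - (s - 10 * τ * K) = 20 * τ * K by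
        rw [show 20 * τ * K = 2 * (10 * τ * K) by ring]; omega] at hrel
    push_cast at hrel
    exact hrel.trans hpar.reliable
  · obtain ⟨hlock', hpulls⟩ := (not_not.1 hlock).of_reliable (h.isRun w) hpar.admissible
      hpar.one_le (fun k hk => (hthr k hk).1) (not_not.1 hrel) (by omega)
      (show s + 3 * τ * K ≤ s + 10 * τ * K by omega)
    refine ⟨not_not.2 ?_, ?_⟩
    · rwa [hbest_eq (s + 10 * τ * K) (by omega) le_rfl]
    · rw [suboptimalPulls_Ioc_eq_card (A w) fun t ht htW => hbest_eq t (by omega) htW]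
      exact hpulls _ (by rw [show (10 * K + 1) * τ = 10 * τ * K + τ by ring]; omega)

theorem Steady.measureReal_unlocked_inter_le (hs : Steady ν T (10 * τ * K) s) (hω : 0 < ω)
    (hpar : GoodParameters K τ ω n m)
    (hbest : ∀ t, 1 ≤ t → t ≤ T → IsSeparatedModel ω D (ν t) (best t))
    (hE : IsEnvironment P ℱ ν X) (h : IsPolicyRun P ℱ X τ l A) :
    P.real (Unlocked τ l A best s ∩ Unlocked τ l A best (s + 10 * τ * K)) ≤
      1 / 2 * P.real (Unlocked τ l A best s) := by
  have hτ := hpar.admissible.add_sixteen_le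
  have hKW : K ≤ 10 * τ * K := Nat.le_mul_of_pos_left _ (by omega)
  have hK := hpar.admissible.two_le
  have hU : Unlocked τ l A best (s + 10 * τ * K) =
      {w | ¬ LockedAt τ (l w) (A w) (best s) (s + 10 * τ * K)} := by
    rw [Unlocked, hs.best_eq hω hbest (by omega) le_rfl]
  obtain ⟨hWs, hT, hν⟩ := hs
  obtain ⟨lam, lam', ξ, hthr⟩ := (hbest s (by omega) (by omega)).exists_thresholds
  rw [hU]
  exact measureReal_not_lockedAt_le hE h (fun t ht htW => hν t (by omega) htW) (by omega)
    rfl hthr hω.le hpar (h.measurableSet_lockedAt (best s) s).compl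

open Classical in
theorem exists_exceptional (hω : 0 < ω) (hpar : GoodParameters K τ ω n m)
    (hbest : ∀ t, 1 ≤ t → t ≤ T → IsSeparatedModel ω D (ν t) (best t))
    (hE : IsEnvironment P ℱ ν X) (h : IsPolicyRun P ℱ X τ l A) (s : ℕ) {v : ℝ}
    (hv : v = 1 / τ + if ¬ Steady ν T (10 * τ * K) s then 1 else 0) :
    ∃ S : Set Ω, P.real S ≤ P.real (Unlocked τ l A best s) + v ∧
      P.real (Unlocked τ l A best (s + 10 * τ * K)) ≤
        1 / 2 * P.real (Unlocked τ l A best s) + v ∧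
      ∀ w ∉ S, suboptimalPulls (A w) best (Finset.Ioc s (s + 10 * τ * K)) ≤
        K * ((10 * K + 1) * (n + 1)) := by
  set U := Unlocked τ l A best
  by_cases hs : Steady ν T (10 * τ * K) s
  · rw [if_neg (not_not.2 hs), add_zero] at hv
    obtain ⟨R, hR, hstep⟩ := hs.exists_unreliable hω hpar hbest hE h
    have hsub : U (s + 10 * τ * K) ⊆ U s ∩ U (s + 10 * τ * K) ∪ R := fun w hw =>
      or_iff_not_imp_right.2 fun hwR => ⟨by_contra fun hwU => (hstep w hwR hwU).1 hw, hw⟩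
    refine ⟨U s ∪ R, ?_, ?_, fun w hw => (hstep w (fun hwR => hw (.inr hwR))
      fun hwU => hw (.inl hwU)).2⟩
    · exact (measureReal_union_le _ _).trans (by rw [hv]; gcongr)
    · refine (measureReal_mono hsub).trans ((measureReal_union_le _ _).trans ?_)
      rw [hv]
      exact add_le_add (hs.measureReal_unlocked_inter_le hω hpar hbest hE h) hR
  · have hv₁ : 1 ≤ v := by
      rw [hv, if_pos hs]
      exact le_add_of_nonneg_left (by positivity)
    refine ⟨Set.univ, ?_, ?_, fun w hw => absurd (Set.mem_univ w) hw⟩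
    · rw [probReal_univ]
      linarith [measureReal_nonneg (μ := P) (s := U s)]
    · linarith [measureReal_nonneg (μ := P) (s := U s),
        measureReal_le_one (μ := P) (s := U (s + 10 * τ * K))]

theorem sum_le_of_contraction {u v : ℕ → ℝ} (hu₀ : u 0 ≤ 1) (hu : ∀ j, 0 ≤ u j)
    (h : ∀ j, u (j + 1) ≤ 1 / 2 * u j + v j) (N : ℕ) :
    ∑ j ∈ Finset.range (N + 1), u j ≤ 2 + 2 * ∑ j ∈ Finset.range (N + 1), v j := by
  have hsum : ∑ j ∈ Finset.range (N + 1), u (j + 1) ≤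
      1 / 2 * ∑ j ∈ Finset.range (N + 1), u j + ∑ j ∈ Finset.range (N + 1), v j := by
    rw [Finset.mul_sum, ← Finset.sum_add_distrib]
    exact Finset.sum_le_sum fun j _ => h j
  linarith [Finset.sum_range_succ' u (N + 1), Finset.sum_range_succ u (N + 1), hu (N + 1)]

theorem dynamicRegret_le {Γ : ℕ} (hω : 0 < ω) (hpar : GoodParameters K τ ω n m)
    (hbest : ∀ t, 1 ≤ t → t ≤ T → IsSeparatedModel ω D (ν t) (best t))
    (hE : IsEnvironment P ℱ ν X) (h : IsPolicyRun P ℱ X τ l A) (hΓ : numBreakpoints ν T ≤ Γ) :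
    dynamicRegret P ν A T ≤ |D| * (10 * τ * K * (8 + 6 * Γ) +
      ((T : ℝ) / (10 * τ * K) + 1) * (K * ((10 * K + 1) * (n + 1)) + 30 * K)) := by
  classical
  set W := 10 * τ * K with hW
  have hτ : 0 < τ := by have := hpar.admissible.add_sixteen_le; omega
  have hWpos : 0 < W := Nat.mul_pos (by omega) (by have := hpar.admissible.two_le; omega)
  set N := T / W
  set v : ℕ → ℝ := fun j => 1 / τ + if ¬ Steady ν T W (j * W) then 1 else 0 with hv
  choose S hS hU hpulls using fun j => exists_exceptional hω hpar hbest hE h (j * W)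
    (v := v j) rfl
  have hvsum : ∑ j ∈ Finset.range (N + 1), v j ≤ (N + 1) / τ + (2 + 2 * Γ) := by
    have hcard : (((Finset.range (N + 1)).filter fun j => ¬ Steady ν T W (j * W)).card : ℝ) ≤
        2 + 2 * Γ := by
      exact_mod_cast (card_not_steady_le ν T hWpos).trans (by omega)
    rw [hv, Finset.sum_add_distrib, Finset.sum_const, Finset.card_range, nsmul_eq_mul,
      Nat.cast_add_one, mul_one_div, Finset.sum_boole]
    exact add_le_add_right hcard _
  have hUsum := sum_le_of_contraction (u := fun j => P.real (Unlocked τ l A best (j * W)))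
    measureReal_le_one (fun j => measureReal_nonneg)
    (fun j => (congrArg (fun s => P.real (Unlocked τ l A best s)) (Nat.succ_mul j W)).trans_le
      (hU j)) N
  have hSsum : ∑ j ∈ Finset.range (N + 1), P.real (S j) ≤ 8 + 6 * Γ + 3 * ((N + 1) / τ) := by
    have := (Finset.sum_le_sum fun j _ => hS j).trans_eq
      (Finset.sum_add_distrib (s := Finset.range (N + 1)))
    linarith
  refine (dynamicRegret_le_of_exceptional hω hbest hWpos hpulls).trans
    (mul_le_mul_of_nonneg_left ?_ (abs_nonneg D))
  calc ((N : ℝ) + 1) * (K * ((10 * K + 1) * (n + 1)) : ℕ) +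
        W * ∑ j ∈ Finset.range (N + 1), P.real (S j)
      ≤ (N + 1) * (K * ((10 * K + 1) * (n + 1)) : ℕ) +
        W * (8 + 6 * Γ + 3 * ((N + 1) / τ)) := by gcongr
    _ = 10 * τ * K * (8 + 6 * Γ) + (N + 1) * (K * ((10 * K + 1) * (n + 1)) + 30 * K) := by
        rw [hW]
        push_cast
        field_simp
        ring
    _ ≤ _ := by
        gcongr
        refine Nat.cast_div_le.trans_eq ?_
        rw [hW, Nat.cast_mul, Nat.cast_mul, Nat.cast_ofNat]

theorem dynamicRegret_le_abs_mul (hω : 0 < ω)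
    (hbest : ∀ t, 1 ≤ t → t ≤ T → IsSeparatedModel ω D (ν t) (best t)) :
    dynamicRegret P ν A T ≤ |D| * T := by
  have hpath (w : Ω) : pathRegret ν (A w) T ≤ |D| * T := by
    refine (pathRegret_le hω hbest (A w)).trans (mul_le_mul_of_nonneg_left ?_ (abs_nonneg D))
    exact_mod_cast (suboptimalPulls_le_card (A w) best _).trans_eq (by simp)
  refine (integral_mono_of_nonneg (.of_forall fun w => pathRegret_nonneg hω hbest (A w))
    (integrable_const _) (.of_forall hpath)).trans_eq ?_
  rw [integral_const, probReal_univ, one_smul]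

omit [IsProbabilityMeasure P] in
theorem dynamicRegret_nonpos (hK : K ≤ 1) (hω : 0 < ω)
    (hbest : ∀ t, 1 ≤ t → t ≤ T → IsSeparatedModel ω D (ν t) (best t)) :
    dynamicRegret P ν A T ≤ 0 := by
  classical
  refine integral_nonpos fun w => (pathRegret_le hω hbest (A w)).trans_eq ?_
  have hsubs : Subsingleton (Fin K) := Fin.subsingleton_iff_le_one.2 hK
  have hzero : suboptimalPulls (A w) best (Finset.Icc 1 T) = 0 :=
    Finset.card_eq_zero.2 (Finset.filter_eq_empty_iff.2 fun t _ ⟨k, hk, _⟩ =>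
      hk (Subsingleton.elim k _))
  rw [hzero, Nat.cast_zero, mul_zero, Pi.zero_apply]

end Regret

/-! ### Tuning the window -/

section Window

variable {T Γ τ : ℕ} {c₁ c₂ : ℝ}

theorem sqrt_div_mul_sqrt_mul (hT : 1 ≤ T) (hΓ : 1 ≤ Γ) :
    √(T * Real.log T / Γ) * √(T * Γ * Real.log T) = T * Real.log T := by
  have : 0 ≤ Real.log T := Real.log_nonneg (Nat.one_le_cast.2 hT)
  have : (0 : ℝ) < Γ := Nat.cast_pos.2 hΓ
  rw [← Real.sqrt_mul (by positivity),
    show (T : ℝ) * Real.log T / Γ * (T * Γ * Real.log T) = (T * Real.log T) ^ 2 by field_simp,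
    Real.sqrt_sq (by positivity)]

theorem mul_sqrt_div (hΓ : 1 ≤ Γ) :
    Γ * √(T * Real.log T / Γ) = √(T * Γ * Real.log T) := by
  have hΓ : (0 : ℝ) < Γ := Nat.cast_pos.2 hΓ
  rw [show (T : ℝ) * Γ * Real.log T = Γ ^ 2 * (T * Real.log T / Γ) by field_simp,
    Real.sqrt_mul (by positivity), Real.sqrt_sq hΓ.le]

theorem mul_log_le_of_window (hT : 1 ≤ T) (hΓ : 1 ≤ Γ) (hc₁ : 0 < c₁)
    (h : c₁ * √(T * Real.log T / Γ) ≤ τ) :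
    T * Real.log T ≤ τ * √(T * Γ * Real.log T) / c₁ := by
  rw [le_div_iff₀' hc₁, ← sqrt_div_mul_sqrt_mul hT hΓ, ← mul_assoc]
  gcongr

theorem mul_window_le (hΓ : 1 ≤ Γ) (h : τ ≤ c₂ * √(T * Real.log T / Γ)) :
    Γ * τ ≤ |c₂| * √(T * Γ * Real.log T) := by
  rw [← mul_sqrt_div hΓ, mul_left_comm]
  gcongr
  exact h.trans (by gcongr; exact le_abs_self c₂)

theorem log_window_le (hT : 2 ≤ T) (hΓ : 1 ≤ Γ) (hτ : 1 ≤ τ)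
    (h : τ ≤ c₂ * √(T * Real.log T / Γ)) :
    Real.log τ ≤ (|Real.log c₂| / Real.log 2 + 1) * Real.log T := by
  have hT₂ : (2 : ℝ) ≤ T := Nat.ofNat_le_cast.2 hT
  have hΓ : (1 : ℝ) ≤ Γ := Nat.one_le_cast.2 hΓ
  have hτ : (0 : ℝ) < τ := Nat.cast_pos.2 hτ
  have hlog₂ : 0 < Real.log 2 := Real.log_pos one_lt_two
  have hsqrt : √(T * Real.log T / Γ) ≤ T := by
    refine Real.sqrt_le_iff.2 ⟨by positivity, ?_⟩
    calc T * Real.log T / Γ ≤ T * Real.log T :=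
          div_le_self (mul_nonneg (by positivity) (Real.log_nonneg (by linarith))) hΓ
      _ ≤ T ^ 2 := by
          rw [sq]
          gcongr
          exact Real.log_le_self (by positivity)
  have hc₂ : 0 < c₂ := pos_of_mul_pos_left (hτ.trans_le h) (Real.sqrt_nonneg _)
  calc Real.log τ ≤ Real.log (c₂ * T) := Real.log_le_log hτ (h.trans (by gcongr))
    _ = Real.log c₂ + Real.log T := Real.log_mul hc₂.ne' (by positivity)
    _ ≤ |Real.log c₂| / Real.log 2 * Real.log 2 + Real.log T := by
        rw [div_mul_cancel₀ _ hlog₂.ne']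
        gcongr
        exact le_abs_self _
    _ ≤ |Real.log c₂| / Real.log 2 * Real.log T + Real.log T := by gcongr
    _ = (|Real.log c₂| / Real.log 2 + 1) * Real.log T := by ring

theorem horizon_le_of_window_le {τ₀ : ℕ} (hT : 2 ≤ T) (hΓ : 1 ≤ Γ) (hc₁ : 0 < c₁)
    (h : c₁ * √(T * Real.log T / Γ) ≤ τ) (hτ : τ ≤ τ₀) :
    T ≤ τ₀ / (c₁ * Real.log 2) * √(T * Γ * Real.log T) := by
  have : 0 < Real.log 2 := Real.log_pos one_lt_two
  have hlog : Real.log 2 ≤ Real.log T := Real.log_le_log two_pos (Nat.ofNat_le_cast.2 hT)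
  calc (T : ℝ) = T * Real.log 2 / Real.log 2 := by field_simp
    _ ≤ T * Real.log T / Real.log 2 := by gcongr
    _ ≤ τ * √(T * Γ * Real.log T) / c₁ / Real.log 2 := by
        gcongr
        exact mul_log_le_of_window (by omega) hΓ hc₁ h
    _ ≤ τ₀ * √(T * Γ * Real.log T) / c₁ / Real.log 2 := by gcongr
    _ = τ₀ / (c₁ * Real.log 2) * √(T * Γ * Real.log T) := by field_simp

theorem phases_mul_log_le {E : ℝ} (hT : 2 ≤ T) (hΓ : 1 ≤ Γ) (hτ : 1 ≤ τ) (hc₁ : 0 < c₁)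
    (hE : 0 ≤ E) (h₁ : c₁ * √(T * Real.log T / Γ) ≤ τ)
    (h₂ : τ ≤ c₂ * √(T * Real.log T / Γ)) :
    (T / τ + 1) * (E * Real.log τ) ≤
      E * ((|Real.log c₂| / Real.log 2 + 1) / c₁ + |c₂|) * √(T * Γ * Real.log T) := by
  set S := √(T * Γ * Real.log T)
  set c₃ := |Real.log c₂| / Real.log 2 + 1
  have : 0 < Real.log 2 := Real.log_pos one_lt_two
  have hΓ' : (1 : ℝ) ≤ Γ := Nat.one_le_cast.2 hΓ
  have hτ' : (0 : ℝ) < τ := Nat.cast_pos.2 hτ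
  have hshort : T / τ * Real.log τ ≤ c₃ / c₁ * S :=
    calc T / τ * Real.log τ ≤ T / τ * (c₃ * Real.log T) := by
          gcongr
          exact log_window_le hT hΓ hτ h₂
      _ = c₃ / τ * (T * Real.log T) := by ring
      _ ≤ c₃ / τ * (τ * S / c₁) := by
          gcongr
          exact mul_log_le_of_window (by omega) hΓ hc₁ h₁
      _ = c₃ / c₁ * S := by field_simp
  have hlast : Real.log τ ≤ |c₂| * S :=
    calc Real.log τ ≤ τ := Real.log_le_self hτ'.le
      _ ≤ Γ * τ := le_mul_of_one_le_left hτ'.le hΓ'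
      _ ≤ |c₂| * S := mul_window_le hΓ h₂
  calc (T / τ + 1) * (E * Real.log τ) = E * (T / τ * Real.log τ + Real.log τ) := by ring
    _ ≤ E * (c₃ / c₁ * S + |c₂| * S) := by gcongr
    _ = E * (c₃ / c₁ + |c₂|) * S := by ring

/-- The factor of `√(T * Γ * log T)` in the regret when the sample size is at most `c * log τ`. -/
noncomputable def windowConstant (K : ℕ) (c c₁ c₂ : ℝ) : ℝ :=
  140 * K * |c₂| + (K * ((10 * K + 1) * (c + 1)) + 30 * K) *
    ((|Real.log c₂| / Real.log 2 + 1) / c₁ + |c₂|)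

theorem le_windowConstant_mul_sqrt {K n : ℕ} {c : ℝ} (hK : 1 ≤ K) (hT : 2 ≤ T) (hΓ : 1 ≤ Γ)
    (hc₁ : 0 < c₁) (hc : 0 ≤ c) (h₁ : c₁ * √(T * Real.log T / Γ) ≤ τ)
    (h₂ : τ ≤ c₂ * √(T * Real.log T / Γ)) (hlog : 1 ≤ Real.log τ) (hn : n ≤ c * Real.log τ) :
    10 * τ * K * (8 + 6 * Γ) + (T / (10 * τ * K) + 1) * (K * ((10 * K + 1) * (n + 1)) + 30 * K) ≤
      windowConstant K c c₁ c₂ * √(T * Γ * Real.log T) := by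
  set S := √(T * Γ * Real.log T)
  set E : ℝ := K * ((10 * K + 1) * (c + 1)) + 30 * K
  have hK' : (1 : ℝ) ≤ K := Nat.one_le_cast.2 hK
  have hΓ' : (1 : ℝ) ≤ Γ := Nat.one_le_cast.2 hΓ
  have hτ : 1 ≤ τ := Nat.one_le_iff_ne_zero.2 fun hτ => by norm_num [hτ] at hlog
  have hτ' : (0 : ℝ) < τ := Nat.cast_pos.2 hτ
  have hsample : K * ((10 * K + 1) * (n + 1)) + 30 * K ≤ E * Real.log τ :=
    calc K * ((10 * K + 1) * (n + 1)) + 30 * K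
        ≤ K * ((10 * K + 1) * (c * Real.log τ + Real.log τ)) + 30 * K * Real.log τ := by
          refine add_le_add (by gcongr) (le_mul_of_one_le_right (by positivity) hlog)
      _ = E * Real.log τ := by ring
  have hunlocked : 10 * τ * K * (8 + 6 * Γ) ≤ 140 * K * (|c₂| * S) :=
    calc (10 : ℝ) * τ * K * (8 + 6 * Γ) ≤ 10 * τ * K * (8 * Γ + 6 * Γ) := by
          gcongr
          linarith
      _ = 140 * K * (Γ * τ) := by ring
      _ ≤ 140 * K * (|c₂| * S) := by
          exact mul_le_mul_of_nonneg_left (mul_window_le hΓ h₂) (by positivity)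
  have hphase : (τ : ℝ) ≤ 10 * τ * K := by nlinarith
  calc 10 * τ * K * (8 + 6 * Γ) +
        (T / (10 * τ * K) + 1) * (K * ((10 * K + 1) * (n + 1)) + 30 * K)
      ≤ 140 * K * (|c₂| * S) + (T / τ + 1) * (E * Real.log τ) := by gcongr
    _ ≤ 140 * K * (|c₂| * S) + E * ((|Real.log c₂| / Real.log 2 + 1) / c₁ + |c₂|) * S := by
        exact add_le_add_right (phases_mul_log_le hT hΓ hτ hc₁ (by positivity) h₁ h₂) _
    _ = windowConstant K c c₁ c₂ * S := by rw [windowConstant]; ring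

end Window

end SWBandit

theorem theorem3_general (K : ℕ) (ω D c₁ c₂ : ℝ) (hω : 0 < ω) (hc₁ : 0 < c₁) :
    ∃ C : ℝ, ∀ (T Γ τ : ℕ), 2 ≤ T → 1 ≤ Γ →
      c₁ * Real.sqrt (T * Real.log T / Γ) ≤ τ →
      (τ : ℝ) ≤ c₂ * Real.sqrt (T * Real.log T / Γ) →
      ∀ (Ω : Type*) [mΩ : MeasurableSpace Ω] (P : MeasureTheory.Measure Ω)
        [MeasureTheory.IsProbabilityMeasure P] (ℱ : MeasureTheory.Filtration ℕ mΩ)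
        (ν : ℕ → Fin K → MeasureTheory.Measure ℝ) (X : ℕ → Fin K → Ω → ℝ)
        (l : Ω → ℕ → Fin K) (A : Ω → ℕ → Finset (Fin K)),
        (∀ t, 1 ≤ t → t ≤ T → ∃ b, SWBandit.IsSeparatedModel ω D (ν t) b) →
        SWBandit.numBreakpoints ν T ≤ Γ →
        SWBandit.IsEnvironment P ℱ ν X →
        SWBandit.IsPolicyRun P ℱ X τ l A →
        SWBandit.dynamicRegret P ν A T ≤ C * Real.sqrt (T * Γ * Real.log T) := by
  open SWBandit in
  obtain ⟨τ₀, hτ₀⟩ := Filter.eventually_atTop.1 ((Filter.eventually_imp_distrib_left.2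
    fun hK : 2 ≤ K => eventually_goodParameters hK hω).and (eventually_le_log 1))
  set C₁ := τ₀ / (c₁ * Real.log 2)
  set C₂ := windowConstant K (5 / ω + 2) c₁ c₂
  refine ⟨|D| * max C₁ C₂, fun T Γ τ hT hΓ h₁ h₂ Ω _ P _ ℱ ν X l A hmodel hbreak hE hrun => ?_⟩
  have : Nonempty (Fin K) := ⟨(hmodel 1 le_rfl (by omega)).choose⟩
  choose! best hbest using hmodel
  rcases le_or_gt K 1 with hK | hK
  · exact (dynamicRegret_nonpos hK hω hbest).trans (by positivity)
  rw [mul_assoc]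
  rcases le_or_gt τ τ₀ with hτ | hτ
  · refine (dynamicRegret_le_abs_mul hω hbest).trans ?_
    gcongr
    exact (horizon_le_of_window_le hT hΓ hc₁ h₁ hτ).trans (by gcongr; exact le_max_left _ _)
  · obtain ⟨hpar, hlog⟩ := hτ₀ τ hτ.le
    refine (dynamicRegret_le hω (hpar hK) hbest hE hrun hbreak).trans ?_
    gcongr
    exact (le_windowConstant_mul_sqrt hK.le hT hΓ hc₁ (by positivity) h₁ h₂ hlog
      (sampleSize_le hω hlog)).trans (by gcongr; exact le_max_right _ _)

theorem theorem3 (K : ℕ) (ω D c₁ c₂ : ℝ) (hω : 0 < ω) (hc₁ : 0 < c₁) :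
    ∃ C : ℝ, ∀ (T Γ τ : ℕ), 2 ≤ T → 1 ≤ Γ → 1 ≤ τ →
      c₁ * Real.sqrt (T * Real.log T / Γ) ≤ τ →
      (τ : ℝ) ≤ c₂ * Real.sqrt (T * Real.log T / Γ) →
      ∀ (Ω : Type*) [mΩ : MeasurableSpace Ω] (P : MeasureTheory.Measure Ω)
        [MeasureTheory.IsProbabilityMeasure P] (ℱ : MeasureTheory.Filtration ℕ mΩ)
        (ν : ℕ → Fin K → MeasureTheory.Measure ℝ) (X : ℕ → Fin K → Ω → ℝ)
        (l : Ω → ℕ → Fin K) (A : Ω → ℕ → Finset (Fin K)),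
        (∀ t, 1 ≤ t → t ≤ T → SWBandit.IsExpFamModel ω D (ν t)) →
        SWBandit.numBreakpoints ν T ≤ Γ →
        SWBandit.IsEnvironment P ℱ ν X →
        SWBandit.IsPolicyRun P ℱ X τ l A →
        SWBandit.dynamicRegret P ν A T ≤ C * Real.sqrt (T * Γ * Real.log T) := by
  obtain ⟨C, hC⟩ := theorem3_general K ω D c₁ c₂ hω hc₁
  exact ⟨C, fun T Γ τ hT hΓ _ h₁ h₂ Ω _ P _ ℱ ν X l A hmodel =>
    hC T Γ τ hT hΓ h₁ h₂ Ω P ℱ ν X l A fun t ht htT => (hmodel t ht htT).exists_isSeparatedModel hω⟩
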